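/- Let $\delta>0$, $G=\{(\xi,\eta):\xi\in\mathbb R,\ 0<\eta<\delta\}$, $\partial_1G=\{\eta=0\}$, $\partial_2G=\{\eta=\delta\}$. Let $\beta\in C^1([0,\delta])$ be real-valued with $\beta'>0$ on $(0,\delta)$, and $h=e^{-\beta}$. Let $\gamma\in C^\infty(\mathbb R)$ be real-valued with compact support and $|\gamma|\le A/\delta$ for some constant $A\in[0,1)$, and put $p(\xi,\eta)=1+\eta\gamma(\xi)$. Let $L_2(G;h)$ be the Hilbert space of functions $\phi:G\to\mathbb C$ with norm $\|\phi\|^2=\int_{\mathbb R}\int_0^\delta|\phi|^2\,h\,p\,d\eta\,d\xi$. Define $$\mathcal L_\gamma\Phi=-\frac1{p^2}\Phi_{\xi\xi}-\Phi_{\eta\eta}+\frac{p_\xi}{p^3}\Phi_\xi+\Big(\beta'-\frac{p_\eta}{p}\Big)\Phi_\eta,\qquad \mathcal M_\gamma\Phi=-\frac ip\,\beta'\,\Phi_\xi ,$$ and, for $\omega\in\mathbb C$, let $\mathcal A_\gamma(\omega)=\omega\mathcal L_\gamma-\mathcal M_\gamma$, as an operator in $L_2(G;h)$ with domain $\{\Phi\in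 H^2(G):\Phi|_{\partial_1G}=0,\ \Phi_\eta|_{\partial_2G}=0\}$. The spectrum $\mathrm{spec}(\mathcal A_\gamma)$ is the set of $\omega\in\mathbb C$ for which $\mathcal A_\gamma(\omega)$ is not (boundedly) invertible. The essential spectrum $\mathrm{spec}_{ess}(\mathcal A_\gamma)$ is the set of $\omega\in\mathbb R$ for which $\mathcal A_\gamma(\omega)$ is not Fredholm. The discrete spectrum $\mathrm{spec}_{dis}(\mathcal A_\gamma)$ is the set of real points of the spectrum that are not in the essential spectrum, are isolated in the spectrum and are eigenvalues of finite multiplicity, i.e. $0<\dim\ker\mathcal A_\gamma(\omega)<\infty$. Let $\widetilde H^1_0(G;\partial_1G;h)$ be the $H^1$-closure of the functions that are smooth up to the boundary of $G$, vanish near $\partial_1G$, and vanish for large $|\xi|$. On it, let $$\langle\mathcal L_\gamma\Psi,\Psi\rangle=\int_{\mathbb R}\int_0^\delta\Big(\frac1p|\Psi_\xi|^2+p|\Psi_\eta|^2\Big)e^{-\beta}\,d\eta\,d\xi,\qquad \langle\mathcal M_\gamma\Psi,\Psi\rangle=\int_{\mathbb R}\int_0^\delta(\mathcal M_\gamma\Psi)\,\overline\Psi\,h\,p\,d\eta\,d\xi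 .$$ For $j=1,2,\dots$ define, in $[-\infty,\infty]$, $$\mu_{\gamma,j}=\sup_{\substack{U\subset\widetilde H^1_0(G;\partial_1G;h)\\ \dim U=j}}\ \inf_{\substack{\Psi\in U\\ \Psi\ne0}}\ \frac{\langle\mathcal M_\gamma\Psi,\Psi\rangle}{\langle\mathcal L_\gamma\Psi,\Psi\rangle}.$$ Proposition. The sequence $(\mu_{\gamma,j})_{j\ge1}$ is non-increasing and has a limit $\underline\mu_\gamma\in[-\infty,\infty]$, and: (i) if $\underline\mu_\gamma>-\infty$, then $\sup\mathrm{spec}_{ess}(\mathcal A_\gamma)=\underline\mu_\gamma$; (ii) if $\underline\mu_\gamma=-\infty$, then $\mathrm{spec}_{ess}(\mathcal A_\gamma)=\emptyset$. Moreover, for every $j\ge1$, if $\mu_{\gamma,j}>\underline\mu_\gamma$, then $\mu_{\gamma,j}\in\mathrm{spec}_{dis}(\mathcal A_\gamma)$. -/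

import Mathlib

open MeasureTheory Set Filter Topology

/-- A curved strip of constant width `δ` carrying a longitudinally uniform, monotone depth profile
`H = exp β`: the standing data and conditions. `γ` is the signed curvature, as a function of the
arc-length parameter `ξ`, of the boundary curve `η = 0`. -/
structure ShelfStrip where
  /-- the width of the strip -/
  δ : ℝ
  /-- the logarithm of the depth profile, a function of the transversal coordinate `η` -/
  β : ℝ → ℝ
  /-- the signed curvature, a function of the longitudinal coordinate `ξ` -/
  γ : ℝ → ℝ
  δ_pos : 0 < δ
  β_contDiffOn : ContDiffOn ℝ 1 β (Icc 0 δ)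
  β_deriv_pos : ∀ η ∈ Ioo 0 δ, 0 < deriv β η
  γ_smooth : ContDiff ℝ (⊤ : ℕ∞) γ
  γ_compact : HasCompactSupport γ
  /-- `κ⁺ ≤ A / δ` and `κ⁻ ≤ A / δ` for a constant `A ∈ [0, 1)` -/
  γ_bound : ∃ A : ℝ, 0 ≤ A ∧ A < 1 ∧ ∀ ξ, |γ ξ| ≤ A / δ

namespace ShelfStrip

noncomputable section

variable (S : ShelfStrip)

/-- The strip `G = {(ξ, η) : ξ ∈ ℝ, 0 < η < δ}` in the curvilinear coordinates. -/
def G : Set (ℝ × ℝ) := {z | 0 < z.2 ∧ z.2 < S.δ}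

/-- `p(ξ, η) = 1 + η γ(ξ)`; the Euclidean metric is `p² dξ² + dη²`. -/
def p (z : ℝ × ℝ) : ℝ := 1 + z.2 * S.γ z.1

/-- `∂p/∂ξ`. -/
def pξ (z : ℝ × ℝ) : ℝ := z.2 * deriv S.γ z.1

/-- `∂p/∂η`. -/
def pη (z : ℝ × ℝ) : ℝ := S.γ z.1

/-- `β'(η)` as a function on the strip. -/
def β' (z : ℝ × ℝ) : ℝ := deriv S.β z.2

/-- The measure `h dG_γ = exp (-β(η)) p(ξ, η) dξ dη` on the strip. -/
def wMeasure : Measure (ℝ × ℝ) :=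
  (volume.restrict S.G).withDensity fun z => ENNReal.ofReal (Real.exp (-S.β z.2) * S.p z)

/-- The weighted Hilbert space `L₂(G; h)`. -/
abbrev L2 : Type := Lp ℂ 2 S.wMeasure

/-- `v` is the weak derivative of `u` on the strip `G` in the direction `e`. -/
def HasWeakDeriv (e : ℝ × ℝ) (u v : S.L2) : Prop :=
  ∀ φ : ℝ × ℝ → ℝ, ContDiff ℝ (⊤ : ℕ∞) φ → HasCompactSupport φ → tsupport φ ⊆ S.G →
    ∫ z in S.G, fderiv ℝ φ z e • u z = - ∫ z in S.G, φ z • v z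

/-- The unit vector of the `ξ`-direction. -/
def eξ : ℝ × ℝ := (1, 0)

/-- The unit vector of the `η`-direction. -/
def eη : ℝ × ℝ := (0, 1)

/-- The class `C̃₀^∞(G; ∂₁G)`: functions smooth up to the boundary, vanishing for large `|ξ|` and
near `∂₁G = {η = 0}` (no condition on `∂₂G = {η = δ}`). They are given as restrictions to the strip
of smooth functions on the plane; the cut-off at large `η > δ` is immaterial. -/
def IsTest (φ : ℝ × ℝ → ℂ) : Prop :=
  ContDiff ℝ (⊤ : ℕ∞) φ ∧ HasCompactSupport φ ∧ tsupport φ ⊆ {z | 0 < z.2}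

lemma isTest_zero : IsTest 0 :=
  ⟨contDiff_const, HasCompactSupport.zero, by simp [tsupport]⟩

lemma IsTest.add {φ ψ : ℝ × ℝ → ℂ} (hφ : IsTest φ) (hψ : IsTest ψ) : IsTest (φ + ψ) :=
  ⟨hφ.1.add hψ.1, hφ.2.1.add hψ.2.1,
    (tsupport_add φ ψ).trans (union_subset hφ.2.2 hψ.2.2)⟩

lemma IsTest.smul {φ : ℝ × ℝ → ℂ} (c : ℂ) (hφ : IsTest φ) : IsTest (c • φ) :=
  ⟨hφ.1.const_smul c, hφ.2.1.smul_left (f := fun _ => c),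
    (closure_mono (Function.support_const_smul_subset c φ)).trans hφ.2.2⟩

lemma IsTest.differentiableAt {φ : ℝ × ℝ → ℂ} (hφ : IsTest φ) (z : ℝ × ℝ) :
    DifferentiableAt ℝ φ z :=
  (hφ.1.differentiable (by simp)).differentiableAt

/-- The functions of `C̃₀^∞(G; ∂₁G)`, each taken together with its two partial derivatives. -/
def testJets : Submodule ℂ (S.L2 × S.L2 × S.L2) where
  carrier := {Ψ | ∃ φ, IsTest φ ∧ Ψ.1 =ᵐ[S.wMeasure] φ ∧
    Ψ.2.1 =ᵐ[S.wMeasure] (fun z => fderiv ℝ φ z eξ) ∧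
    Ψ.2.2 =ᵐ[S.wMeasure] (fun z => fderiv ℝ φ z eη)}
  zero_mem' := by
    refine ⟨0, isTest_zero, Lp.coeFn_zero _ _ _, ?_, ?_⟩
    · filter_upwards [Lp.coeFn_zero ℂ 2 S.wMeasure] with z hz
      simpa using hz
    · filter_upwards [Lp.coeFn_zero ℂ 2 S.wMeasure] with z hz
      simpa using hz
  add_mem' := by
    rintro ⟨u, a, b⟩ ⟨u', a', b'⟩ ⟨φ, hφ, h1, h2, h3⟩ ⟨φ', hφ', h1', h2', h3'⟩
    refine ⟨φ + φ', hφ.add hφ', ?_, ?_, ?_⟩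
    · exact (Lp.coeFn_add u u').trans (h1.add h1')
    · refine (Lp.coeFn_add a a').trans ((h2.add h2').trans (.of_forall fun z => ?_))
      simp [fderiv_add (hφ.differentiableAt z) (hφ'.differentiableAt z)]
    · refine (Lp.coeFn_add b b').trans ((h3.add h3').trans (.of_forall fun z => ?_))
      simp [fderiv_add (hφ.differentiableAt z) (hφ'.differentiableAt z)]
  smul_mem' := by
    rintro c ⟨u, a, b⟩ ⟨φ, hφ, h1, h2, h3⟩
    refine ⟨c • φ, hφ.smul c, ?_, ?_, ?_⟩
    · exact (Lp.coeFn_smul c u).trans (h1.const_smul c)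
    · refine (Lp.coeFn_smul c a).trans ((h2.const_smul c).trans (.of_forall fun z => ?_))
      simp [fderiv_const_smul (hφ.differentiableAt z)]
    · refine (Lp.coeFn_smul c b).trans ((h3.const_smul c).trans (.of_forall fun z => ?_))
      simp [fderiv_const_smul (hφ.differentiableAt z)]

/-- The space `H̃₀¹(G; ∂₁G; h)`, the `H¹`-closure of `C̃₀^∞(G; ∂₁G)`. An element is a function
`Ψ.1 ∈ L₂(G; h)` together with its weak derivatives `Ψ.2.1 = ∂Ψ/∂ξ` and `Ψ.2.2 = ∂Ψ/∂η`, which it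
determines (`hasWeakDeriv_of_mem_H10`, `H10_ext`). Since `p` lies between two positive constants,
the closure is the same whether `|grad φ|² = p⁻² |∂φ/∂ξ|² + |∂φ/∂η|²` or the sum of the squared
partial derivatives is used. -/
def H10 : Submodule ℂ (S.L2 × S.L2 × S.L2) := S.testJets.topologicalClosure

/-! ### The weight is bounded below; weak derivatives are linear, unique and closed -/

lemma isOpen_G : IsOpen S.G :=
  (isOpen_lt continuous_const continuous_snd).inter (isOpen_lt continuous_snd continuous_const)

lemma exists_p_lower : ∃ c : ℝ, 0 < c ∧ ∀ z ∈ S.G, c ≤ S.p z := by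
  obtain ⟨A, _, hA1, hA⟩ := S.γ_bound
  refine ⟨1 - A, by linarith, fun z hz => ?_⟩
  have h1 := (abs_le.1 (hA z.1)).1
  have hδ := S.δ_pos
  have h0 : 0 < z.2 := hz.1
  have h2 : z.2 < S.δ := hz.2
  have hA0 : 0 ≤ A / S.δ := (abs_nonneg _).trans (hA z.1)
  have h3 : z.2 * (A / S.δ) ≤ S.δ * (A / S.δ) := mul_le_mul_of_nonneg_right h2.le hA0
  have h4 : S.δ * (A / S.δ) = A := by field_simp
  have h5 : z.2 * (-(A / S.δ)) ≤ z.2 * S.γ z.1 := mul_le_mul_of_nonneg_left h1 h0.le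
  simp only [p]
  nlinarith

lemma exists_weight_lower :
    ∃ c : ℝ, 0 < c ∧ ∀ z ∈ S.G, c ≤ Real.exp (-S.β z.2) * S.p z := by
  obtain ⟨c, hc, hp⟩ := S.exists_p_lower
  obtain ⟨M, hM⟩ := isCompact_Icc.bddAbove_image S.β_contDiffOn.continuousOn
  refine ⟨Real.exp (-M) * c, by positivity, fun z hz => ?_⟩
  have hz' : z.2 ∈ Icc 0 S.δ := ⟨hz.1.le, hz.2.le⟩
  have h1 : S.β z.2 ≤ M := hM ⟨z.2, hz', rfl⟩
  have h2 : Real.exp (-M) ≤ Real.exp (-S.β z.2) := Real.exp_le_exp.2 (by linarith)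
  exact mul_le_mul h2 (hp z hz) hc.le (Real.exp_pos _).le

lemma exists_le_smul_wMeasure :
    ∃ C : ENNReal, C ≠ ⊤ ∧ volume.restrict S.G ≤ C • S.wMeasure := by
  obtain ⟨c, hc, hw⟩ := S.exists_weight_lower
  have hc0 : ENNReal.ofReal c ≠ 0 := by simpa using hc
  refine ⟨(ENNReal.ofReal c)⁻¹, ENNReal.inv_ne_top.2 hc0, ?_⟩
  have h1 : ENNReal.ofReal c • volume.restrict S.G ≤ S.wMeasure := by
    rw [← withDensity_const]
    refine withDensity_mono ?_
    filter_upwards [ae_restrict_mem S.isOpen_G.measurableSet] with z hz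
    exact ENNReal.ofReal_le_ofReal (hw z hz)
  calc volume.restrict S.G
      = (ENNReal.ofReal c)⁻¹ • ENNReal.ofReal c • volume.restrict S.G := by
        rw [smul_smul, ENNReal.inv_mul_cancel hc0 ENNReal.ofReal_ne_top, one_smul]
    _ ≤ _ := by gcongr

lemma volume_ac : volume.restrict S.G ≪ S.wMeasure := by
  obtain ⟨C, _, h⟩ := S.exists_le_smul_wMeasure
  exact Measure.absolutelyContinuous_of_le_smul h

lemma wMeasure_ac : S.wMeasure ≪ volume.restrict S.G := withDensity_absolutelyContinuous _ _

lemma memLp_restrict (u : S.L2) : MemLp u 2 (volume.restrict S.G) := by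
  obtain ⟨C, hC, h⟩ := S.exists_le_smul_wMeasure
  exact (Lp.memLp u).of_measure_le_smul hC h

lemma integrable_smul (u : S.L2) {φ : ℝ × ℝ → ℝ} (hφ : Continuous φ)
    (hs : HasCompactSupport φ) : Integrable (fun z => φ z • u z) (volume.restrict S.G) :=
  have h : MemLp φ 2 (volume.restrict S.G) := hφ.memLp_of_hasCompactSupport hs
  memLp_one_iff_integrable.1 ((S.memLp_restrict u).smul h)

lemma integrable_mul (u : S.L2) {φ : ℝ × ℝ → ℂ} (hφ : Continuous φ)
    (hs : HasCompactSupport φ) : Integrable (fun z => u z * φ z) (volume.restrict S.G) :=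
  have h : MemLp φ 2 (volume.restrict S.G) := hφ.memLp_of_hasCompactSupport hs
  (S.memLp_restrict u).integrable_mul h

/-- Integration against a compactly supported continuous function, on `L₂(G; h)`. -/
lemma continuous_integral_smul {φ : ℝ × ℝ → ℝ} (hφ : Continuous φ) (hs : HasCompactSupport φ) :
    Continuous fun u : S.L2 => ∫ z in S.G, φ z • u z := by
  obtain ⟨C, hC, h⟩ := S.exists_le_smul_wMeasure
  have hm : MemLp φ 2 (volume.restrict S.G) := hφ.memLp_of_hasCompactSupport hs
  let L : S.L2 →ₗ[ℝ] ℂ :=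
    { toFun := fun u => ∫ z in S.G, φ z • u z
      map_add' := fun u v => by
        rw [← integral_add (S.integrable_smul u hφ hs) (S.integrable_smul v hφ hs)]
        refine integral_congr_ae ?_
        filter_upwards [S.volume_ac.ae_le (Lp.coeFn_add u v)] with z hz
        rw [hz, Pi.add_apply, smul_add]
      map_smul' := fun c u => by
        rw [RingHom.id_apply, ← integral_smul]
        refine integral_congr_ae ?_
        filter_upwards [S.volume_ac.ae_le (Lp.coeFn_smul c u)] with z hz
        rw [hz, Pi.smul_apply, smul_comm] }
  refine (L.mkContinuousOfExistsBound
    ⟨(eLpNorm φ 2 (volume.restrict S.G) * C ^ (1 / (2 : ENNReal)).toReal).toReal, ?_⟩).continuous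
  intro u
  have h0 : (∫⁻ z in S.G, ‖φ z • u z‖ₑ) ≤
      eLpNorm φ 2 (volume.restrict S.G) * C ^ (1 / (2 : ENNReal)).toReal *
        eLpNorm u 2 S.wMeasure := by
    calc (∫⁻ z in S.G, ‖φ z • u z‖ₑ) = eLpNorm (φ • ⇑u) 1 (volume.restrict S.G) := by
          rw [eLpNorm_one_eq_lintegral_enorm]; rfl
      _ ≤ eLpNorm φ 2 (volume.restrict S.G) * eLpNorm u 2 (volume.restrict S.G) :=
          eLpNorm_smul_le_mul_eLpNorm (S.memLp_restrict u).1 hm.1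
      _ ≤ eLpNorm φ 2 (volume.restrict S.G) *
          (C ^ (1 / (2 : ENNReal)).toReal * eLpNorm u 2 S.wMeasure) := by
          gcongr
          exact eLpNorm_le_of_measure_le_smul h
      _ = _ := by rw [mul_assoc]
  have hfin : eLpNorm φ 2 (volume.restrict S.G) * C ^ (1 / (2 : ENNReal)).toReal *
        eLpNorm u 2 S.wMeasure ≠ ⊤ :=
    ENNReal.mul_ne_top (ENNReal.mul_ne_top hm.2.ne
      (ENNReal.rpow_ne_top_of_nonneg ENNReal.toReal_nonneg hC)) (Lp.memLp u).2.ne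
  calc ‖∫ z in S.G, φ z • u z‖ ≤ (∫⁻ z in S.G, ‖φ z • u z‖ₑ).toReal := by
        have := enorm_integral_le_lintegral_enorm (μ := volume.restrict S.G) (fun z => φ z • u z)
        have := ENNReal.toReal_mono (ne_top_of_le_ne_top hfin h0) this
        simpa using this
    _ ≤ _ := ENNReal.toReal_mono hfin h0
    _ = _ := by rw [ENNReal.toReal_mul, Lp.norm_def]

variable {S} in
lemma HasWeakDeriv.add {e : ℝ × ℝ} {u v u' v' : S.L2} (h : S.HasWeakDeriv e u v)
    (h' : S.HasWeakDeriv e u' v') : S.HasWeakDeriv e (u + u') (v + v') := by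
  intro φ hφ hs hG
  have hd : Continuous fun z => fderiv ℝ φ z e :=
    (hφ.continuous_fderiv (by simp)).clm_apply continuous_const
  have hds : HasCompactSupport fun z => fderiv ℝ φ z e := hs.fderiv_apply ℝ e
  have key : ∀ {ψ : ℝ × ℝ → ℝ}, Continuous ψ → HasCompactSupport ψ → ∀ w w' : S.L2,
      ∫ z in S.G, ψ z • (w + w' : S.L2) z =
        (∫ z in S.G, ψ z • w z) + ∫ z in S.G, ψ z • w' z := by
    intro ψ hψ hψs w w'
    rw [← integral_add (S.integrable_smul w hψ hψs) (S.integrable_smul w' hψ hψs)]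
    refine integral_congr_ae ?_
    filter_upwards [S.volume_ac.ae_le (Lp.coeFn_add w w')] with z hz
    rw [hz, Pi.add_apply, smul_add]
  rw [key hd hds, key hφ.continuous hs, h φ hφ hs hG, h' φ hφ hs hG, neg_add]

variable {S} in
lemma HasWeakDeriv.smul {e : ℝ × ℝ} {u v : S.L2} (c : ℂ) (h : S.HasWeakDeriv e u v) :
    S.HasWeakDeriv e (c • u) (c • v) := by
  intro φ hφ hs hG
  have key : ∀ (ψ : ℝ × ℝ → ℝ) (w : S.L2),
      ∫ z in S.G, ψ z • (c • w : S.L2) z = c • ∫ z in S.G, ψ z • w z := by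
    intro ψ w
    rw [← integral_smul]
    refine integral_congr_ae ?_
    filter_upwards [S.volume_ac.ae_le (Lp.coeFn_smul c w)] with z hz
    rw [hz, Pi.smul_apply, smul_comm]
  rw [key, key, h φ hφ hs hG, smul_neg]

lemma hasWeakDeriv_zero (e : ℝ × ℝ) : S.HasWeakDeriv e 0 0 := by
  intro φ _ _ _
  have key : ∀ ψ : ℝ × ℝ → ℝ, ∫ z in S.G, ψ z • (0 : S.L2) z = 0 := by
    intro ψ
    rw [← integral_zero (ℝ × ℝ) ℂ (μ := volume.restrict S.G)]
    refine integral_congr_ae ?_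
    filter_upwards [S.volume_ac.ae_le (Lp.coeFn_zero ℂ 2 S.wMeasure)] with z hz
    rw [hz, Pi.zero_apply, smul_zero]
  rw [key, key, neg_zero]

variable {S} in
/-- A weak derivative of zero vanishes. -/
lemma HasWeakDeriv.eq_zero {e : ℝ × ℝ} {v : S.L2} (h : S.HasWeakDeriv e 0 v) : v = 0 := by
  have hz : ∀ φ : ℝ × ℝ → ℝ, ContDiff ℝ (⊤ : ℕ∞) φ → HasCompactSupport φ → tsupport φ ⊆ S.G →
      ∫ z, φ z • v z ∂(volume.restrict S.G) = 0 := by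
    intro φ hφ hs hG
    have h1 := h φ hφ hs hG
    have h2 := S.hasWeakDeriv_zero e φ hφ hs hG
    rw [h2, neg_inj] at h1
    rw [← h1, ← integral_zero (ℝ × ℝ) ℂ (μ := volume.restrict S.G)]
    refine integral_congr_ae ?_
    filter_upwards [S.volume_ac.ae_le (Lp.coeFn_zero ℂ 2 S.wMeasure)] with z hz
    rw [hz, Pi.zero_apply, smul_zero]
  have hl : LocallyIntegrable v (volume.restrict S.G) :=
    (S.memLp_restrict v).locallyIntegrable (by norm_num)
  have h3 := S.isOpen_G.ae_eq_zero_of_integral_contDiff_smul_eq_zero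
    (μ := volume.restrict S.G) (hl.locallyIntegrableOn _) hz
  refine (Lp.eq_zero_iff_ae_eq_zero).2 (S.wMeasure_ac.ae_le ?_)
  filter_upwards [h3, ae_restrict_mem S.isOpen_G.measurableSet] with z hz hG
  exact hz hG

lemma isClosed_hasWeakDeriv (e : ℝ × ℝ) : IsClosed {q : S.L2 × S.L2 | S.HasWeakDeriv e q.1 q.2} := by
  simp only [HasWeakDeriv, ofPred_forall]
  refine isClosed_iInter fun φ => isClosed_iInter fun hφ => isClosed_iInter fun hs =>
    isClosed_iInter fun _ => isClosed_eq ?_ ?_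
  · exact (S.continuous_integral_smul ((hφ.continuous_fderiv (by simp)).clm_apply
      continuous_const) (hs.fderiv_apply ℝ e)).comp continuous_fst
  · exact ((S.continuous_integral_smul hφ.continuous hs).comp continuous_snd).neg

lemma hasWeakDeriv_of_test {φ : ℝ × ℝ → ℂ} (hφ : IsTest φ) {e : ℝ × ℝ} {u v : S.L2}
    (hu : u =ᵐ[S.wMeasure] φ) (hv : v =ᵐ[S.wMeasure] fun z => fderiv ℝ φ z e) :
    S.HasWeakDeriv e u v := by
  intro g hg hs hG
  have hgd : Continuous fun z => fderiv ℝ g z e :=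
    (hg.continuous_fderiv (by simp)).clm_apply continuous_const
  have hφd : Continuous fun z => fderiv ℝ φ z e :=
    (hφ.1.continuous_fderiv (by simp)).clm_apply continuous_const
  have hgds : HasCompactSupport fun z => fderiv ℝ g z e := hs.fderiv_apply ℝ e
  have h0 : ∀ z ∉ S.G, g z = 0 := fun z hz => image_eq_zero_of_notMem_tsupport fun h => hz (hG h)
  have h0' : ∀ z ∉ S.G, fderiv ℝ g z e = 0 := fun z hz => by
    rw [fderiv_of_notMem_tsupport (𝕜 := ℝ) fun h => hz (hG h)]; rfl
  have e1 : ∫ z in S.G, fderiv ℝ g z e • u z = ∫ z, fderiv ℝ g z e • φ z := by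
    rw [← setIntegral_eq_integral_of_forall_compl_eq_zero (s := S.G)
      (f := fun z => fderiv ℝ g z e • φ z) (fun z hz => by simp only [h0' z hz, zero_smul])]
    refine integral_congr_ae ?_
    filter_upwards [S.volume_ac.ae_le hu] with z hz
    rw [hz]
  have e2 : ∫ z in S.G, g z • v z = ∫ z, g z • fderiv ℝ φ z e := by
    rw [← setIntegral_eq_integral_of_forall_compl_eq_zero (s := S.G)
      (f := fun z => g z • fderiv ℝ φ z e) (fun z hz => by simp only [h0 z hz, zero_smul])]
    refine integral_congr_ae ?_
    filter_upwards [S.volume_ac.ae_le hv] with z hz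
    rw [hz]
  rw [e1, e2, integral_smul_fderiv_eq_neg_fderiv_smul_of_integrable, neg_neg]
  · exact (hgd.smul hφ.1.continuous).integrable_of_hasCompactSupport hgds.smul_right
  · exact (hg.continuous.smul hφd).integrable_of_hasCompactSupport hs.smul_right
  · exact (hg.continuous.smul hφ.1.continuous).integrable_of_hasCompactSupport hs.smul_right
  · exact fun z _ => (hg.differentiable (by simp)).differentiableAt
  · exact fun z _ => hφ.differentiableAt z

/-- The second and third components of an element of `H̃₀¹(G; ∂₁G; h)` are the weak derivatives of
the first one. -/
lemma hasWeakDeriv_of_mem_H10 {Ψ : S.L2 × S.L2 × S.L2} (hΨ : Ψ ∈ S.H10) :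
    S.HasWeakDeriv eξ Ψ.1 Ψ.2.1 ∧ S.HasWeakDeriv eη Ψ.1 Ψ.2.2 := by
  have hc : IsClosed {Ψ : S.L2 × S.L2 × S.L2 |
      S.HasWeakDeriv eξ Ψ.1 Ψ.2.1 ∧ S.HasWeakDeriv eη Ψ.1 Ψ.2.2} :=
    ((S.isClosed_hasWeakDeriv eξ).preimage
      (continuous_fst.prodMk (continuous_fst.comp continuous_snd))).inter
    ((S.isClosed_hasWeakDeriv eη).preimage
      (continuous_fst.prodMk (continuous_snd.comp continuous_snd)))
  refine closure_minimal ?_ hc hΨ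
  rintro Ψ' ⟨φ, hφ, h1, h2, h3⟩
  exact ⟨S.hasWeakDeriv_of_test hφ h1 h2, S.hasWeakDeriv_of_test hφ h1 h3⟩

/-- An element of `H̃₀¹(G; ∂₁G; h)` is determined by its first component. -/
lemma H10_ext {Ψ Ψ' : S.L2 × S.L2 × S.L2} (h : Ψ ∈ S.H10) (h' : Ψ' ∈ S.H10) (h1 : Ψ.1 = Ψ'.1) :
    Ψ = Ψ' := by
  have hd := S.hasWeakDeriv_of_mem_H10 (S.H10.sub_mem h h')
  have h0 : (Ψ - Ψ').1 = 0 := by simp [h1]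
  rw [h0] at hd
  exact sub_eq_zero.1 (Prod.ext h0 (Prod.ext hd.1.eq_zero hd.2.eq_zero))

/-! ### The variational side -/

/-- `𝓜_γ Ψ = -(i / p) β' ∂Ψ/∂ξ`, in terms of `uξ = ∂Ψ/∂ξ`. -/
def Mexpr (uξ : S.L2) (z : ℝ × ℝ) : ℂ :=
  -(Complex.I / S.p z) * S.β' z * uξ z

/-- `𝓛_γ Ψ = -p⁻² Ψ_ξξ - Ψ_ηη + p⁻³ p_ξ Ψ_ξ + (β' - p⁻¹ p_η) Ψ_η`, in terms of the derivatives. -/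
def Lexpr (uξ uη uξξ uηη : S.L2) (z : ℝ × ℝ) : ℂ :=
  -(1 / (S.p z : ℂ) ^ 2) * uξξ z - uηη z + (1 / (S.p z : ℂ) ^ 3) * S.pξ z * uξ z
    + (S.β' z - (1 / (S.p z : ℂ)) * S.pη z) * uη z

/-- The (real) value `⟨𝓜_γ Ψ, Ψ⟩` in `L₂(G; h)`. -/
def mForm (Ψ : S.H10) : ℝ :=
  (∫ z, S.Mexpr Ψ.1.2.1 z * (starRingEnd ℂ) (Ψ.1.1 z) ∂S.wMeasure).re

/-- The quadratic form `⟨𝓛_γ Ψ, Ψ⟩`, that is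
`∫∫ (p⁻¹ |Ψ_ξ|² + p |Ψ_η|²) exp (-β) dη dξ`. -/
def lForm (Ψ : S.H10) : ℝ :=
  ∫ z in S.G, ((1 / S.p z) * ‖Ψ.1.2.1 z‖ ^ 2 + S.p z * ‖Ψ.1.2.2 z‖ ^ 2) * Real.exp (-S.β z.2)

/-- The min–max values `μ_{γ,j}`, for `j ≥ 1`, in the extended reals. -/
def mu (j : ℕ) : EReal :=
  ⨆ (U : Submodule ℂ S.H10) (_ : Module.finrank ℂ U = j),
    ⨅ (Ψ : S.H10) (_ : Ψ ∈ U) (_ : Ψ ≠ 0), ((S.mForm Ψ / S.lForm Ψ : ℝ) : EReal)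

/-! ### The operator pencil -/

/-- `u ∈ Dom 𝓐_γ` with the derivatives `uξ, …, uηη`: `u ∈ H²(G)`, `u = 0` on `∂₁G`, and
`∂u/∂η = 0` on `∂₂G`. The latter is expressed by Green's formula: there is no boundary term when
`∂u/∂η` is integrated by parts against functions which vanish near `∂₁G`. -/
structure IsDomJet (u uξ uη uξξ uξη uηη : S.L2) : Prop where
  deriv_ξ : S.HasWeakDeriv eξ u uξ
  deriv_η : S.HasWeakDeriv eη u uη
  deriv_ξξ : S.HasWeakDeriv eξ uξ uξξ
  deriv_ξη : S.HasWeakDeriv eη uξ uξη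
  deriv_ηη : S.HasWeakDeriv eη uη uηη
  dirichlet : (u, uξ, uη) ∈ S.H10
  neumann : ∀ φ : ℝ × ℝ → ℂ, IsTest φ →
    ∫ z in S.G, (uη z * fderiv ℝ φ z eη + uηη z * φ z) = 0

variable {S} in
lemma IsDomJet.add {u uξ uη uξξ uξη uηη v vξ vη vξξ vξη vηη : S.L2}
    (h : S.IsDomJet u uξ uη uξξ uξη uηη) (k : S.IsDomJet v vξ vη vξξ vξη vηη) :
    S.IsDomJet (u + v) (uξ + vξ) (uη + vη) (uξξ + vξξ) (uξη + vξη) (uηη + vηη) where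
  deriv_ξ := h.deriv_ξ.add k.deriv_ξ
  deriv_η := h.deriv_η.add k.deriv_η
  deriv_ξξ := h.deriv_ξξ.add k.deriv_ξξ
  deriv_ξη := h.deriv_ξη.add k.deriv_ξη
  deriv_ηη := h.deriv_ηη.add k.deriv_ηη
  dirichlet := S.H10.add_mem h.dirichlet k.dirichlet
  neumann := by
    intro φ hφ
    have hd : Continuous fun z => fderiv ℝ φ z eη :=
      (hφ.1.continuous_fderiv (by simp)).clm_apply continuous_const
    have hds : HasCompactSupport fun z => fderiv ℝ φ z eη := hφ.2.1.fderiv_apply ℝ eη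
    have key : ∀ w w' : S.L2, Integrable
        (fun z => w z * fderiv ℝ φ z eη + w' z * φ z) (volume.restrict S.G) := fun w w' =>
      (S.integrable_mul w hd hds).add (S.integrable_mul w' hφ.1.continuous hφ.2.1)
    have hsum := congrArg₂ (· + ·) (h.neumann φ hφ) (k.neumann φ hφ)
    simp only [add_zero] at hsum
    rw [← integral_add (key uη uηη) (key vη vηη)] at hsum
    rw [← hsum]
    refine integral_congr_ae ?_
    filter_upwards [S.volume_ac.ae_le (Lp.coeFn_add uη vη),
      S.volume_ac.ae_le (Lp.coeFn_add uηη vηη)] with z h1 h2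
    rw [h1, h2, Pi.add_apply, Pi.add_apply]
    ring

variable {S} in
lemma IsDomJet.smul (c : ℂ) {u uξ uη uξξ uξη uηη : S.L2}
    (h : S.IsDomJet u uξ uη uξξ uξη uηη) :
    S.IsDomJet (c • u) (c • uξ) (c • uη) (c • uξξ) (c • uξη) (c • uηη) where
  deriv_ξ := h.deriv_ξ.smul c
  deriv_η := h.deriv_η.smul c
  deriv_ξξ := h.deriv_ξξ.smul c
  deriv_ξη := h.deriv_ξη.smul c
  deriv_ηη := h.deriv_ηη.smul c
  dirichlet := S.H10.smul_mem c h.dirichlet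
  neumann := by
    intro φ hφ
    have hc := congrArg (c • ·) (h.neumann φ hφ)
    simp only [smul_zero] at hc
    rw [← integral_smul] at hc
    rw [← hc]
    refine integral_congr_ae ?_
    filter_upwards [S.volume_ac.ae_le (Lp.coeFn_smul c uη),
      S.volume_ac.ae_le (Lp.coeFn_smul c uηη)] with z h1 h2
    rw [h1, h2, Pi.smul_apply, Pi.smul_apply]
    simp only [smul_eq_mul]
    ring

/-- The graph of `𝓐_γ(ω) = ω 𝓛_γ - 𝓜_γ` on `Dom 𝓐_γ`, as an operator in `L₂(G; h)`. -/
def pencilGraph (ω : ℂ) : Submodule ℂ (S.L2 × S.L2) where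
  carrier := {q | ∃ uξ uη uξξ uξη uηη : S.L2, S.IsDomJet q.1 uξ uη uξξ uξη uηη ∧
    q.2 =ᵐ[S.wMeasure] fun z => ω * S.Lexpr uξ uη uξξ uηη z - S.Mexpr uξ z}
  zero_mem' := by
    refine ⟨0, 0, 0, 0, 0, ⟨S.hasWeakDeriv_zero _, S.hasWeakDeriv_zero _, S.hasWeakDeriv_zero _,
      S.hasWeakDeriv_zero _, S.hasWeakDeriv_zero _, S.H10.zero_mem, fun φ _ => ?_⟩, ?_⟩
    · rw [← integral_zero (ℝ × ℝ) ℂ (μ := volume.restrict S.G)]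
      refine integral_congr_ae ?_
      filter_upwards [S.volume_ac.ae_le (Lp.coeFn_zero ℂ 2 S.wMeasure)] with z h1
      simp only [h1, Pi.zero_apply, zero_mul, add_zero]
    · filter_upwards [Lp.coeFn_zero ℂ 2 S.wMeasure] with z h1
      change (0 : S.L2) z = _
      simp only [Lexpr, Mexpr, h1, Pi.zero_apply, mul_zero, add_zero, sub_zero]
  add_mem' := by
    rintro ⟨u, f⟩ ⟨v, g⟩ ⟨uξ, uη, uξξ, uξη, uηη, h, hf⟩ ⟨vξ, vη, vξξ, vξη, vηη, k, hg⟩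
    refine ⟨_, _, _, _, _, h.add k, ?_⟩
    filter_upwards [Lp.coeFn_add f g, hf, hg, Lp.coeFn_add uξ vξ, Lp.coeFn_add uη vη,
      Lp.coeFn_add uξξ vξξ, Lp.coeFn_add uηη vηη] with z h0 h1 h2 h3 h4 h5 h6
    change (f + g : S.L2) z = _
    rw [h0, Pi.add_apply]
    simp only [Lexpr, Mexpr] at h1 h2 ⊢
    rw [h1, h2, h3, h4, h5, h6]
    simp only [Pi.add_apply]
    ring
  smul_mem' := by
    rintro c ⟨u, f⟩ ⟨uξ, uη, uξξ, uξη, uηη, h, hf⟩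
    refine ⟨_, _, _, _, _, h.smul c, ?_⟩
    filter_upwards [Lp.coeFn_smul c f, hf, Lp.coeFn_smul c uξ, Lp.coeFn_smul c uη,
      Lp.coeFn_smul c uξξ, Lp.coeFn_smul c uηη] with z h0 h1 h3 h4 h5 h6
    change (c • f : S.L2) z = _
    rw [h0, Pi.smul_apply]
    simp only [Lexpr, Mexpr] at h1 ⊢
    rw [h1, h3, h4, h5, h6]
    simp only [Pi.smul_apply, smul_eq_mul]
    ring

/-- `pencilGraph ω` is the graph of a (single-valued) operator. -/
lemma pencilGraph_functional (ω : ℂ) :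
    ∀ q ∈ S.pencilGraph ω, q.1 = 0 → q.2 = 0 := by
  rintro ⟨u, f⟩ ⟨uξ, uη, uξξ, uξη, uηη, h, hf⟩ rfl
  obtain rfl := h.deriv_ξ.eq_zero
  obtain rfl := h.deriv_η.eq_zero
  obtain rfl := h.deriv_ξξ.eq_zero
  obtain rfl := h.deriv_ηη.eq_zero
  refine Lp.eq_zero_iff_ae_eq_zero.2 ?_
  filter_upwards [hf, Lp.coeFn_zero ℂ 2 S.wMeasure] with z h0 h1
  simp only [Lexpr, Mexpr, h1] at h0
  simpa using h0

/-- The operator pencil `𝓐_γ(ω) = ω 𝓛_γ - 𝓜_γ`, an operator in `L₂(G; h)` with domain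
`Dom 𝓐_γ`. -/
def pencil (ω : ℂ) : S.L2 →ₗ.[ℂ] S.L2 := (S.pencilGraph ω).toLinearPMap

lemma graph_pencil (ω : ℂ) : (S.pencil ω).graph = S.pencilGraph ω :=
  (S.pencilGraph ω).toLinearPMap_graph_eq (S.pencilGraph_functional ω)

/-! ### Spectra -/

variable {E : Type*} [NormedAddCommGroup E] [NormedSpace ℂ E] in
/-- `T` has an everywhere defined bounded inverse. -/
def IsInvertibleOp (T : E →ₗ.[ℂ] E) : Prop :=
  Function.Bijective T.toFun ∧ ∃ C : ℝ, ∀ x : T.domain, ‖(x : E)‖ ≤ C * ‖T x‖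

variable {E : Type*} [NormedAddCommGroup E] [NormedSpace ℂ E] in
/-- `T` is Fredholm: its kernel is finite-dimensional, and its range is closed and of finite
codimension. -/
def IsFredholmOp (T : E →ₗ.[ℂ] E) : Prop :=
  FiniteDimensional ℂ (LinearMap.ker T.toFun) ∧
    IsClosed (LinearMap.range T.toFun : Set E) ∧
    FiniteDimensional ℂ (E ⧸ LinearMap.range T.toFun)

/-- The spectrum of the pencil. -/
def spec : Set ℂ := {ω | ¬ IsInvertibleOp (S.pencil ω)}

/-- The essential spectrum of the pencil. -/
def specEss : Set ℝ := {ω | ¬ IsFredholmOp (S.pencil ω)}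

/-- `ω` is an eigenvalue of finite multiplicity of the pencil. -/
def IsFiniteEigenvalue (ω : ℂ) : Prop :=
  LinearMap.ker (S.pencil ω).toFun ≠ ⊥ ∧ FiniteDimensional ℂ (LinearMap.ker (S.pencil ω).toFun)

/-- The discrete spectrum: the points of the spectrum outside the essential spectrum, which are
isolated points of the spectrum and eigenvalues of finite multiplicity. -/
def specDisc : Set ℝ :=
  {ω | (ω : ℂ) ∈ S.spec ∧ ω ∉ S.specEss ∧
    (∃ ε > 0, ∀ ζ ∈ S.spec, ζ ≠ ω → ε ≤ ‖ζ - ω‖) ∧ S.IsFiniteEigenvalue ω}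

end

end ShelfStrip

/-! ### Min–max values of a bounded operator on a complex inner product space. -/

section MinMax

open Module

local notation "⟪" x ", " y "⟫" => inner ℂ x y

variable {E : Type*} [NormedAddCommGroup E] [InnerProductSpace ℂ E]

/-! The pencil is replaced by one bounded self-adjoint operator `K`. By the Poincaré inequality
(`exists_poincare`, `exists_norm_le_grad`), the form of 𝓛 is an inner product on `H10` equivalent to
the H¹ one; the resulting Hilbert space is `Energy`. If J denotes its embedding into L₂(G; h), the
adjoint J* is the weak solution operator of 𝓛, and `energyOp` is K = J*𝓜. For ω ≠ 0, the equation
𝓐(ω)u = f says that u = Jx with (ω - K)x = J*f (`mem_graph_pencil_iff`). The quotient of the two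
forms is the Rayleigh quotient of K, so the numbers μ_j are the min–max values of K
(`mu_eq_minmax`). K is self-adjoint because the weight in the form of 𝓜 is exp(-β)β', in which p has
cancelled: it does not depend on ξ, and -i∂/∂ξ can be moved across it (`wint_snd_eq_neg`).

The passage to the energy space needs weak solutions to lie in the H² domain
(`isWeakSol_iff_isDomJet`). Translations in ξ preserve the strip and change the coefficients by
O(s), so the difference quotients of a weak solution are bounded in `H10`; a weak limit shows that
the ξ-derivative is again in `H10`. The second η-derivative is then read off from the equation. As β
is only C¹, products with its exponential are handled through C¹ multipliers of `H10` (`IsMult`).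

The rest is spectral theory of K, which need not be compact. Let m be the limit of the min–max
values. Above m, the form of K - c is nonpositive on the complement of a finite-dimensional space
for some c < ω, so ω - K is Fredholm (`IsSelfAdjoint.fredholm_of_limit_minmax_lt`). At m, a Fredholm
m - K would make m isolated in the spectrum, or no point of it, with finite-dimensional kernel. Then
the spectral projection onto (m - c/2, ∞) would have finite rank, which forces the min–max values
below m eventually (`IsSelfAdjoint.not_fredholm_limit_minmax`). A min–max value above m cannot lie
in a spectral gap, hence is an isolated eigenvalue (`IsSelfAdjoint.minmax_eigenvalue`). Fredholmness
and invertibility are carried between ω - K and 𝓐(ω) by `isFredholmOp_of_graph`,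
`fredholm_of_isFredholmOp` and `isInvertibleOp_of_graph`.

The point ω = 0, where the reduction breaks down, never matters: disjoint translates of one wave
packet are orthogonal for both forms and give μ_j ≥ c > 0 for all j (`exists_pos_le_minmax`). So m
is positive and finite, and case (ii) does not occur. -/

lemma Submodule.exists_le_finrank_eq {n : ℕ} (U : Submodule ℂ E)
    (h : (n : Cardinal) ≤ Module.rank ℂ U) : ∃ U' ≤ U, finrank ℂ U' = n := by
  obtain ⟨s, hs, hli⟩ := le_rank_iff_exists_linearIndependent_finset.1 h
  have hli' : LinearIndependent ℂ (fun x : s => ((x : U) : E)) :=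
    hli.map' U.subtype (Submodule.ker_subtype U)
  refine ⟨Submodule.span ℂ (Set.range fun x : s => ((x : U) : E)), ?_, ?_⟩
  · rw [Submodule.span_le]
    rintro _ ⟨x, rfl⟩
    exact (x : U).2
  · rw [finrank_span_eq_card hli', Fintype.card_coe, hs]

/-- The min–max values of a bounded operator on a complex inner product space. -/
noncomputable def minmax (K : E →L[ℂ] E) (j : ℕ) : EReal :=
  ⨆ (U : Submodule ℂ E) (_ : finrank ℂ U = j), ⨅ (x : E) (_ : x ∈ U) (_ : x ≠ 0),
    ((K.rayleighQuotient x : ℝ) : EReal)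

variable {K : E →L[ℂ] E} {j : ℕ} {c : ℝ}

lemma le_rayleighQuotient_iff {x : E} (hx : x ≠ 0) :
    c ≤ K.rayleighQuotient x ↔ c * ‖x‖ ^ 2 ≤ K.reApplyInnerSelf x := by
  have : 0 < ‖x‖ := norm_pos_iff.2 hx
  rw [ContinuousLinearMap.rayleighQuotient, le_div_iff₀ (by positivity)]

lemma rayleighQuotient_le_iff {x : E} (hx : x ≠ 0) :
    K.rayleighQuotient x ≤ c ↔ K.reApplyInnerSelf x ≤ c * ‖x‖ ^ 2 := by
  have : 0 < ‖x‖ := norm_pos_iff.2 hx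
  rw [ContinuousLinearMap.rayleighQuotient, div_le_iff₀ (by positivity)]

lemma le_minmax {U : Submodule ℂ E} (hU : finrank ℂ U = j)
    (h : ∀ x ∈ U, c * ‖x‖ ^ 2 ≤ K.reApplyInnerSelf x) : (c : EReal) ≤ minmax K j := by
  refine le_trans ?_ (le_iSup₂ (f := fun (U : Submodule ℂ E) (_ : finrank ℂ U = j) =>
    ⨅ (x : E) (_ : x ∈ U) (_ : x ≠ 0), ((K.rayleighQuotient x : ℝ) : EReal)) U hU)
  refine le_iInf fun x => le_iInf fun hx => le_iInf fun h0 => ?_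
  exact EReal.coe_le_coe_iff.2 ((le_rayleighQuotient_iff h0).2 (h x hx))

lemma exists_of_lt_minmax (h : (c : EReal) < minmax K j) :
    ∃ U : Submodule ℂ E, finrank ℂ U = j ∧ ∀ x ∈ U, c * ‖x‖ ^ 2 ≤ K.reApplyInnerSelf x := by
  obtain ⟨U, hU⟩ := lt_iSup_iff.1 h
  obtain ⟨hj, hU⟩ := lt_iSup_iff.1 hU
  refine ⟨U, hj, fun x hx => ?_⟩
  by_cases h0 : x = 0
  · simp [h0, ContinuousLinearMap.reApplyInnerSelf]
  · have := hU.le.trans ((iInf_le _ x).trans ((iInf_le _ hx).trans (iInf_le _ h0)))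
    exact (le_rayleighQuotient_iff h0).1 (EReal.coe_le_coe_iff.1 this)

lemma minmax_le (h : ∀ U : Submodule ℂ E, finrank ℂ U = j →
    ∃ x ∈ U, x ≠ 0 ∧ K.reApplyInnerSelf x ≤ c * ‖x‖ ^ 2) : minmax K j ≤ c := by
  refine iSup₂_le fun U hU => ?_
  obtain ⟨x, hx, h0, hc⟩ := h U hU
  refine (iInf_le _ x).trans ((iInf_le _ hx).trans ((iInf_le _ h0).trans ?_))
  exact EReal.coe_le_coe_iff.2 ((rayleighQuotient_le_iff h0).2 hc)

lemma antitone_minmax (K : E →L[ℂ] E) : Antitone (minmax K) := by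
  refine antitone_nat_of_succ_le fun j => iSup₂_le fun U hU => ?_
  have : (j : Cardinal) ≤ Module.rank ℂ U := by
    -- `finrank` is 0 by default on infinite-dimensional spaces, so a positive value gives finite
    -- dimension.
    have : FiniteDimensional ℂ U := FiniteDimensional.of_finrank_pos (by omega)
    rw [← finrank_eq_rank, hU]
    exact_mod_cast Nat.le_succ j
  obtain ⟨U', hle, hU'⟩ := U.exists_le_finrank_eq this
  refine le_trans ?_ (le_iSup₂ (f := fun (U : Submodule ℂ E) (_ : finrank ℂ U = j) =>
    ⨅ (x : E) (_ : x ∈ U) (_ : x ≠ 0), ((K.rayleighQuotient x : ℝ) : EReal)) U' hU')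
  exact le_iInf fun x => le_iInf fun hx => iInf_le_of_le x (iInf_le _ (hle hx))

lemma minmax_le_norm (K : E →L[ℂ] E) (hj : 1 ≤ j) : minmax K j ≤ (‖K‖ : ℝ) := by
  refine minmax_le fun U hU => ?_
  have : Nontrivial U := nontrivial_of_finrank_pos (R := ℂ) (by omega)
  obtain ⟨x, hx⟩ := exists_ne (0 : U)
  refine ⟨x, x.2, by simpa using hx, ?_⟩
  calc K.reApplyInnerSelf x ≤ ‖⟪K x, (x : E)⟫‖ := Complex.re_le_norm _
    _ ≤ ‖K x‖ * ‖(x : E)‖ := norm_inner_le_norm _ _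
    _ ≤ (‖K‖ * ‖(x : E)‖) * ‖(x : E)‖ := by gcongr; exact K.le_opNorm _
    _ = _ := by ring

/-- The form of `K` is at most `c` off a finite-dimensional subspace if some min–max value is
below `c`. -/
lemma exists_finiteDimensional_orthogonal_le (hK : (K : E →ₗ[ℂ] E).IsSymmetric)
    (h : minmax K j < c) : ∃ F : Submodule ℂ E, FiniteDimensional ℂ F ∧
      ∀ w ∈ Fᗮ, K.reApplyInnerSelf w ≤ c * ‖w‖ ^ 2 := by
  classical
  -- Subspaces on which the form of `K - c` is nonnegative have dimension at most `j`, because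
  -- `minmax K j < c`. Let `U` be one of maximal dimension.
  let P : ℕ → Prop := fun n => ∃ U : Submodule ℂ E, FiniteDimensional ℂ U ∧ finrank ℂ U = n ∧
    ∀ x ∈ U, c * ‖x‖ ^ 2 ≤ K.reApplyInnerSelf x
  have hP0 : P 0 := ⟨⊥, inferInstance, finrank_bot ℂ E, fun x hx => by
    simp [(Submodule.mem_bot ℂ).1 hx, ContinuousLinearMap.reApplyInnerSelf]⟩
  have hPj : ∀ n, P n → n ≤ j := by
    rintro n ⟨U, _, hU, hx⟩
    by_contra! hn
    obtain ⟨U', hle, hU'⟩ := U.exists_le_finrank_eq (n := j) (by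
      rw [← finrank_eq_rank, hU]; exact_mod_cast hn.le)
    exact (le_minmax hU' fun x h => hx x (hle h)).not_gt h
  obtain ⟨U, _, hU, hUx⟩ : P (Nat.findGreatest P j) := Nat.findGreatest_spec (Nat.zero_le j) hP0
  set B : E →L[ℂ] E := K - (c : ℂ) • ContinuousLinearMap.id ℂ E with hB
  have hBs : ∀ x y, ⟪B x, y⟫ = ⟪x, B y⟫ := fun x y => by
    have := hK x y
    simp only [ContinuousLinearMap.coe_coe] at this
    simp [hB, this]
  have hBq : ∀ x, (⟪B x, x⟫).re = K.reApplyInnerSelf x - c * ‖x‖ ^ 2 := fun x => by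
    have : ((‖x‖ : ℂ) ^ 2).re = ‖x‖ ^ 2 := by norm_cast
    simp [hB, inner_self_eq_norm_sq_to_K, ContinuousLinearMap.reApplyInnerSelf, this]
  -- `F = B(U)`: a vector `w` orthogonal to it has no cross terms with `U` in the form of `B`. If
  -- the form were positive at `w`, then `w ∉ U`, and `U` enlarged by `w` would contradict
  -- maximality.
  refine ⟨U.map (B : E →ₗ[ℂ] E), inferInstance, fun w hw => ?_⟩
  by_contra! hlt
  have hort : ∀ u ∈ U, ⟪B u, w⟫ = 0 := fun u hu =>
    hw _ (Submodule.mem_map_of_mem hu)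
  have hwU : w ∉ U := fun hwU => by
    have := hBq w
    rw [hort w hwU] at this
    simp at this
    linarith
  have hP : P (Nat.findGreatest P j + 1) := by
    refine ⟨U ⊔ Submodule.span ℂ {w}, inferInstance, ?_, ?_⟩
    · rw [← hU]
      have hw0 : w ≠ 0 := fun h0 => hwU (h0 ▸ U.zero_mem)
      have h1 := Submodule.finrank_sup_add_finrank_inf_eq U (Submodule.span ℂ {w})
      rw [(Submodule.disjoint_span_singleton' hw0).2 hwU |>.eq_bot, finrank_bot,
        finrank_span_singleton hw0] at h1
      omega
    · intro x hx
      obtain ⟨u, hu, v, hv, rfl⟩ := Submodule.mem_sup.1 hx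
      obtain ⟨a, rfl⟩ := Submodule.mem_span_singleton.1 hv
      have h1 := hBq (u + a • w)
      have h2 : ⟪B w, u⟫ = 0 := by rw [hBs, ← inner_conj_symm, hort u hu, map_zero]
      have h3 := hBq u
      have h4 := hBq w
      have h5 : (⟪B (u + a • w), u + a • w⟫).re =
          (⟪B u, u⟫).re + ‖a‖ ^ 2 * (⟪B w, w⟫).re := by
        rw [map_add, map_smul, inner_add_left, inner_add_right, inner_add_right, inner_smul_left,
          inner_smul_left, inner_smul_right, inner_smul_right, hort u hu, h2]
        have : (starRingEnd ℂ) a * (a * ⟪B w, w⟫) = ((‖a‖ ^ 2 : ℝ) : ℂ) * ⟪B w, w⟫ := by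
          rw [← mul_assoc, Complex.conj_mul']
          push_cast
          rfl
        rw [this]
        simp [-Complex.ofReal_pow]
      have h6 := hUx u hu
      have h7 : 0 ≤ ‖a‖ ^ 2 * (⟪B w, w⟫).re := by
        rw [h4]; exact mul_nonneg (by positivity) (by linarith)
      linarith
  have := Nat.le_findGreatest (hPj _ hP) hP
  omega

/-! ### Closed range, kernels and resolvents of self-adjoint operators. -/

section Closed

variable [CompleteSpace E] {B : E →L[ℂ] E}

/-- An operator which is bounded below off a finite-dimensional subspace is semi-Fredholm. -/
lemma finiteDimensional_ker_and_isClosed_range {F : Submodule ℂ E} [FiniteDimensional ℂ F]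
    {c : ℝ} (hc : 0 < c) (h : ∀ w ∈ Fᗮ, c * ‖w‖ ≤ ‖B w‖) :
    FiniteDimensional ℂ (LinearMap.ker (B : E →ₗ[ℂ] E)) ∧
      IsClosed (LinearMap.range (B : E →ₗ[ℂ] E) : Set E) := by
  constructor
  · let f : LinearMap.ker (B : E →ₗ[ℂ] E) →ₗ[ℂ] F :=
      (F.orthogonalProjectionOnto : E →ₗ[ℂ] F) ∘ₗ (LinearMap.ker (B : E →ₗ[ℂ] E)).subtype
    refine FiniteDimensional.of_injective f ?_
    rw [injective_iff_map_eq_zero]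
    intro x hx
    have h1 : (x : E) ∈ Fᗮ := Submodule.orthogonalProjectionOnto_eq_zero_iff.1 hx
    have h2 := h x h1
    have h3 : B x = 0 := x.2
    rw [h3, norm_zero] at h2
    have : ‖(x : E)‖ ≤ 0 := by
      by_contra! h4
      nlinarith [mul_pos hc h4]
    exact Subtype.ext (norm_le_zero_iff.1 this)
  · let g : Fᗮ →L[ℂ] E := B.comp Fᗮ.subtypeL
    have hg : AntilipschitzWith (Real.toNNReal c⁻¹) g := by
      refine AddMonoidHomClass.antilipschitz_of_bound g fun x => ?_
      rw [Real.coe_toNNReal _ (by positivity), inv_mul_eq_div, le_div_iff₀ hc, mul_comm]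
      exact h x x.2
    have hcl : IsClosed (LinearMap.range (g : Fᗮ →ₗ[ℂ] E) : Set E) :=
      hg.isClosed_range g.uniformContinuous
    -- The range is the closed space `B(Fᗮ)` plus the finite-dimensional `B(F)`.
    have := Submodule.isClosed_sup_finiteDimensional _ (F.map (B : E →ₗ[ℂ] E)) hcl
    convert this using 2
    apply le_antisymm
    · rintro _ ⟨x, rfl⟩
      rw [← F.starProjection_add_starProjection_orthogonal x, map_add, add_comm]
      exact Submodule.add_mem_sup ⟨⟨_, Submodule.starProjection_apply_mem _ _⟩, rfl⟩
        (Submodule.mem_map_of_mem (Submodule.starProjection_apply_mem _ _))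
    · refine sup_le ?_ ?_
      · rintro _ ⟨x, rfl⟩
        exact ⟨x, rfl⟩
      · rintro _ ⟨x, -, rfl⟩
        exact ⟨x, rfl⟩

/-- Restricted to the orthogonal complement of its kernel, `B` is injective and keeps its range, so
the open mapping theorem bounds the inverse. -/
lemma exists_bound_orthogonal_ker (hr : IsClosed (LinearMap.range (B : E →ₗ[ℂ] E) : Set E)) :
    ∃ c : ℝ, 0 < c ∧ ∀ x ∈ (LinearMap.ker (B : E →ₗ[ℂ] E))ᗮ, c * ‖x‖ ≤ ‖B x‖ := by
  have hk : IsClosed (LinearMap.ker (B : E →ₗ[ℂ] E) : Set E) := B.isClosed_ker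
  have : CompleteSpace (LinearMap.ker (B : E →ₗ[ℂ] E)) := hk.completeSpace_coe
  set N := LinearMap.ker (B : E →ₗ[ℂ] E) with hN
  let g : Nᗮ →L[ℂ] E := B.comp Nᗮ.subtypeL
  have hinj : Function.Injective g := by
    rw [injective_iff_map_eq_zero]
    intro x hx
    have h1 : (x : E) ∈ N := hx
    have : (x : E) ∈ N ⊓ Nᗮ := ⟨h1, x.2⟩
    rw [Submodule.inf_orthogonal_eq_bot] at this
    exact Subtype.ext ((Submodule.mem_bot ℂ).1 this)
  have hrg : IsClosed (Set.range g) := by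
    convert hr using 1
    ext y
    constructor
    · rintro ⟨x, rfl⟩
      exact ⟨x, rfl⟩
    · rintro ⟨x, rfl⟩
      refine ⟨⟨Nᗮ.starProjection x, Submodule.starProjection_apply_mem _ _⟩, ?_⟩
      have h1 := N.starProjection_add_starProjection_orthogonal x
      have h2 : B (N.starProjection x) = 0 :=
        (Submodule.starProjection_apply_mem N x : _ ∈ N)
      change B (Nᗮ.starProjection x) = B x
      conv_rhs => rw [← h1, map_add, h2, zero_add]
  obtain ⟨C, hlip⟩ : ∃ C, AntilipschitzWith C g :=
    g.antilipschitz_of_injective_of_isClosed_range hinj hrg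
  -- The antilipschitz constant may be zero; adding 1 allows the inversion.
  refine ⟨((C : ℝ) + 1)⁻¹, by positivity, fun x hx => ?_⟩
  have h1 : ‖x‖ ≤ C * ‖B x‖ := hlip.le_mul_norm (map_zero g) (⟨x, hx⟩ : Nᗮ)
  rw [inv_mul_eq_div, div_le_iff₀ (by positivity)]
  nlinarith [norm_nonneg (B x)]

variable {K : E →L[ℂ] E}

lemma IsSelfAdjoint.inner_shift (hK : IsSelfAdjoint K) (ζ : ℂ) (x y : E) :
    ⟪(ζ • (1 : E →L[ℂ] E) - K) x, y⟫ = ⟪x, ((starRingEnd ℂ) ζ • (1 : E →L[ℂ] E) - K) y⟫ := by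
  have := (ContinuousLinearMap.isSelfAdjoint_iff_isSymmetric.1 hK) x y
  simp only [ContinuousLinearMap.coe_coe] at this
  simp [this, mul_comm]

/-- The bound at `ζ` gives injectivity and closed range; the bound at the conjugate kills the
orthogonal complement of the range, which is the kernel of the adjoint. -/
lemma IsSelfAdjoint.isUnit_shift (hK : IsSelfAdjoint K) {ζ : ℂ} {d : ℝ} (hd : 0 < d)
    (h : ∀ x, d * ‖x‖ ≤ ‖(ζ • (1 : E →L[ℂ] E) - K) x‖)
    (h' : ∀ x, d * ‖x‖ ≤ ‖((starRingEnd ℂ) ζ • (1 : E →L[ℂ] E) - K) x‖) :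
    IsUnit (ζ • (1 : E →L[ℂ] E) - K) := by
  set T := ζ • (1 : E →L[ℂ] E) - K with hT
  have hanti : AntilipschitzWith (Real.toNNReal d⁻¹) T := by
    refine AddMonoidHomClass.antilipschitz_of_bound T fun x => ?_
    rw [Real.coe_toNNReal _ (by positivity), inv_mul_eq_div, le_div_iff₀ hd, mul_comm]
    exact h x
  have hcl : IsClosed (LinearMap.range (T : E →ₗ[ℂ] E) : Set E) :=
    hanti.isClosed_range T.uniformContinuous
  have := hcl.completeSpace_coe
  have hbot : (LinearMap.range (T : E →ₗ[ℂ] E))ᗮ = ⊥ := by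
    rw [Submodule.eq_bot_iff]
    intro y hy
    have h1 : ((starRingEnd ℂ) ζ • (1 : E →L[ℂ] E) - K) y = 0 := by
      rw [← inner_self_eq_zero (𝕜 := ℂ), ← hK.inner_shift]
      exact hy _ ⟨_, rfl⟩
    have h2 := h' y
    rw [h1, norm_zero] at h2
    have : ‖y‖ ≤ 0 := by
      by_contra! h4
      nlinarith [mul_pos hd h4]
    exact norm_le_zero_iff.1 this
  rw [ContinuousLinearMap.isUnit_iff_bijective]
  refine ⟨hanti.injective, fun y => ?_⟩
  have htop : LinearMap.range (T : E →ₗ[ℂ] E) = ⊤ :=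
    (Submodule.orthogonal_eq_bot_iff).1 hbot
  exact (htop ▸ Submodule.mem_top : y ∈ LinearMap.range (T : E →ₗ[ℂ] E))

/-- A real point at which a self-adjoint operator has closed range has a punctured neighbourhood,
or a neighbourhood if it is no eigenvalue, in the resolvent set. -/
lemma IsSelfAdjoint.isUnit_shift_of_bound (hK : IsSelfAdjoint K) {ω c : ℝ}
    (hc : ∀ x ∈ (LinearMap.ker (((ω : ℂ) • (1 : E →L[ℂ] E) - K : E →L[ℂ] E) : E →ₗ[ℂ] E))ᗮ,
      c * ‖x‖ ≤ ‖((ω : ℂ) • (1 : E →L[ℂ] E) - K) x‖)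
    {ζ : ℂ} (hζ : ‖ζ - ω‖ < c)
    (h : ζ ≠ ω ∨ LinearMap.ker (((ω : ℂ) • (1 : E →L[ℂ] E) - K : E →L[ℂ] E) : E →ₗ[ℂ] E) = ⊥) :
    IsUnit (ζ • (1 : E →L[ℂ] E) - K) := by
  have hcl : IsClosed (LinearMap.ker (((ω : ℂ) • (1 : E →L[ℂ] E) - K : E →L[ℂ] E) :
    E →ₗ[ℂ] E) : Set E) := ContinuousLinearMap.isClosed_ker _
  set N := LinearMap.ker (((ω : ℂ) • (1 : E →L[ℂ] E) - K : E →L[ℂ] E) : E →ₗ[ℂ] E) with hN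
  have := hcl.completeSpace_coe
  -- `s` bounds `ζ - K` from below on the eigenspace `N`. There `ζ - K` is multiplication by `ζ -
  -- ω`; if `N` is trivial, any positive value serves.
  obtain ⟨s, hs, hsN⟩ : ∃ s : ℝ, 0 < s ∧ ∀ ζ' : ℂ, ‖ζ' - ω‖ = ‖ζ - ω‖ → ∀ a ∈ N,
      s * ‖a‖ ≤ ‖ζ' - ω‖ * ‖a‖ := by
    rcases h with h | h
    · exact ⟨‖ζ - ω‖, norm_pos_iff.2 (sub_ne_zero.2 h), fun ζ' h' a _ => by rw [h']⟩
    · refine ⟨1, one_pos, fun ζ' _ a ha => ?_⟩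
      rw [h, Submodule.mem_bot] at ha
      simp [ha]
  -- The estimate depends only on the distance to `ω`, so that it also applies to the conjugate of
  -- `ζ`.
  have key : ∀ ζ' : ℂ, ‖ζ' - ω‖ = ‖ζ - ω‖ → ∀ x,
      (1 / s + 2 / (c - ‖ζ - ω‖))⁻¹ * ‖x‖ ≤ ‖(ζ' • (1 : E →L[ℂ] E) - K) x‖ := by
    intro ζ' h' x
    have hcr : 0 < c - ‖ζ - ω‖ := by linarith
    have hpos : 0 < 1 / s + 2 / (c - ‖ζ - ω‖) := by positivity
    rw [inv_mul_eq_div, div_le_iff₀ hpos]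
    set a := N.starProjection x with ha
    set b := Nᗮ.starProjection x with hb
    have hab : a + b = x := N.starProjection_add_starProjection_orthogonal x
    have haN : a ∈ N := Submodule.starProjection_apply_mem N x
    have hbN : b ∈ Nᗮ := Submodule.starProjection_apply_mem Nᗮ x
    have hTa : ∀ ξ : ℂ, (ξ • (1 : E →L[ℂ] E) - K) a = (ξ - ω) • a := fun ξ => by
      have : ((ω : ℂ) • (1 : E →L[ℂ] E) - K) a = 0 := haN
      simp only [_root_.sub_apply, _root_.smul_apply,
        one_apply_eq_self] at this ⊢
      rw [← sub_eq_zero.1 this, sub_smul]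
    set y := (ζ' • (1 : E →L[ℂ] E) - K) x with hy
    -- Pairing `y` with `a` and moving the operator onto `a` isolates the component in `N`.
    have h1 : ‖ζ' - ω‖ * ‖a‖ ≤ ‖y‖ := by
      have e1 : ⟪a, y⟫ = (ζ' - ω) * ‖a‖ ^ 2 := by
        have := hK.inner_shift ((starRingEnd ℂ) ζ') a x
        rw [Complex.conj_conj] at this
        rw [hy, ← this, hTa, inner_smul_left, ← hab, inner_add_right,
          (Submodule.mem_orthogonal _ _).1 hbN a haN, add_zero, inner_self_eq_norm_sq_to_K]
        simp
      have e2 : ‖ζ' - ω‖ * ‖a‖ ^ 2 ≤ ‖a‖ * ‖y‖ := by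
        have := norm_inner_le_norm (𝕜 := ℂ) a y
        rw [e1] at this
        simpa using this
      by_cases h0 : ‖a‖ = 0
      · rw [h0, mul_zero]; positivity
      · have : 0 < ‖a‖ := lt_of_le_of_ne (norm_nonneg _) (Ne.symm h0)
        nlinarith
    -- One `‖y‖` is the term itself, the other bounds the contribution of `a` through `h1`; the term
    -- in `b` is absorbed.
    have h2 : (c - ‖ζ - ω‖) * ‖b‖ ≤ 2 * ‖y‖ := by
      have e1 : ((ω : ℂ) • (1 : E →L[ℂ] E) - K) b = y - (ζ' - ω) • a - (ζ' - ω) • b := by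
        rw [hy, ← hab, map_add, hTa]
        simp only [_root_.sub_apply, _root_.smul_apply,
          one_apply_eq_self, sub_smul]
        abel
      have e2 := hc b hbN
      rw [e1] at e2
      have e3 := norm_sub_le (y - (ζ' - ω) • a) ((ζ' - ω) • b)
      have e4 := norm_sub_le y ((ζ' - ω) • a)
      rw [norm_smul] at e3 e4
      rw [h'] at e3 e4 h1
      nlinarith
    have h3 : ‖a‖ ≤ 1 / s * ‖y‖ := by
      rw [one_div, inv_mul_eq_div, le_div_iff₀ hs, mul_comm]
      exact (hsN ζ' h' a haN).trans h1
    have h4 : ‖b‖ ≤ 2 / (c - ‖ζ - ω‖) * ‖y‖ := by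
      rw [div_mul_eq_mul_div, le_div_iff₀ hcr, mul_comm]
      exact h2
    calc ‖x‖ = ‖a + b‖ := by rw [hab]
      _ ≤ ‖a‖ + ‖b‖ := norm_add_le _ _
      _ ≤ _ := by rw [mul_add, mul_comm, mul_comm ‖y‖]; linarith
  refine hK.isUnit_shift (d := (1 / s + 2 / (c - ‖ζ - ω‖))⁻¹) ?_ (key ζ rfl) (key _ ?_)
  · have hcr : 0 < c - ‖ζ - ω‖ := by linarith
    positivity
  · rw [← Complex.conj_ofReal ω, ← map_sub, RCLike.norm_conj, Complex.conj_ofReal]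

end Closed

/-! ### Spectral projections at gaps of the spectrum, by continuous functional calculus. -/

section SpectralProjection

variable [CompleteSpace E] {K : E →L[ℂ] E}

/-- The spectral projection of `K` for `(t, ∞)`, provided that `t` lies in a gap of the
spectrum. -/
noncomputable def upperProjection (K : E →L[ℂ] E) (t : ℝ) : E →L[ℂ] E :=
  cfc (fun x : ℝ => if t < x then (1 : ℝ) else 0) K

/-- Off the gap, the indicator coincides with a linear ramp across the gap, clamped to [0, 1]. -/
lemma continuousOn_indicator_gap {s : Set ℝ} {t ε : ℝ} (hε : 0 < ε)
    (h : ∀ x ∈ s, x ≤ t - ε ∨ t + ε ≤ x) :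
    ContinuousOn (fun x : ℝ => if t < x then (1 : ℝ) else 0) s := by
  have hc : Continuous fun x : ℝ => max 0 (min 1 ((x - t + ε) / (2 * ε))) := by fun_prop
  refine hc.continuousOn.congr fun x hx => ?_
  rcases h x hx with h1 | h1
  · have h2 : (x - t + ε) / (2 * ε) ≤ 0 := div_nonpos_of_nonpos_of_nonneg (by linarith) (by linarith)
    have h3 : ¬ t < x := by linarith
    simp only [h3, if_false]
    rw [max_eq_left ((min_le_right _ _).trans h2)]
  · have h2 : 1 ≤ (x - t + ε) / (2 * ε) := by rw [le_div_iff₀ (by linarith)]; linarith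
    have h3 : t < x := by linarith
    simp only [h3, if_true]
    rw [min_eq_left h2, max_eq_right zero_le_one]

lemma upperProjection_apply_self {t ε : ℝ} (hε : 0 < ε)
    (h : ∀ x ∈ spectrum ℝ K, x ≤ t - ε ∨ t + ε ≤ x) (x : E) :
    upperProjection K t (upperProjection K t x) = upperProjection K t x := by
  have hc := continuousOn_indicator_gap hε h
  have : upperProjection K t * upperProjection K t = upperProjection K t := by
    rw [upperProjection, ← cfc_mul _ _ K hc hc]
    refine cfc_congr fun x _ => ?_
    split_ifs <;> simp
  exact congrArg (fun T : E →L[ℂ] E => T x) this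

omit [CompleteSpace E] in
lemma re_inner_sub_smul (K : E →L[ℂ] E) (c : ℝ) (x : E) :
    (⟪K x - c • x, x⟫).re = K.reApplyInnerSelf x - c * ‖x‖ ^ 2 := by
  have : ((‖x‖ : ℂ) ^ 2).re = ‖x‖ ^ 2 := by norm_cast
  rw [← Complex.coe_smul, inner_sub_left, inner_smul_left, Complex.conj_ofReal,
    inner_self_eq_norm_sq_to_K]
  simp [ContinuousLinearMap.reApplyInnerSelf, this]

/-- The function (x - (t + ε))·1_{x > t} is nonnegative on the spectrum, so the operator obtained
from it is positive; it acts as `K - (t + ε)` on the range of the projection. -/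
lemma IsSelfAdjoint.le_of_upperProjection_eq_self (hK : IsSelfAdjoint K) {t ε : ℝ} (hε : 0 < ε)
    (h : ∀ x ∈ spectrum ℝ K, x ≤ t - ε ∨ t + ε ≤ x) {x : E} (hx : upperProjection K t x = x) :
    (t + ε) * ‖x‖ ^ 2 ≤ K.reApplyInnerSelf x := by
  have hc := continuousOn_indicator_gap hε h
  have h1 : (K - (t + ε) • (1 : E →L[ℂ] E)) * upperProjection K t =
      cfc (fun x : ℝ => (x - (t + ε)) * if t < x then (1 : ℝ) else 0) K := by
    rw [cfc_mul (fun x : ℝ => x - (t + ε)) _ K (by fun_prop) hc,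
      cfc_sub (fun x : ℝ => x) (fun _ => t + ε) K, cfc_id' ℝ K, cfc_const _ K,
      Algebra.algebraMap_eq_smul_one]
    rfl
  have h2 : 0 ≤ (K - (t + ε) • (1 : E →L[ℂ] E)) * upperProjection K t := by
    rw [h1]
    refine cfc_nonneg fun y hy => ?_
    rcases h y hy with h3 | h3
    · rw [if_neg (by linarith), mul_zero]
    · rw [if_pos (by linarith), mul_one]; linarith
  have h3 := ((ContinuousLinearMap.nonneg_iff_isPositive _).1 h2).re_inner_nonneg_left x
  rw [mul_apply_eq_comp, hx] at h3
  have h4 := re_inner_sub_smul K (t + ε) x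
  have : 0 ≤ (⟪K x - (t + ε) • x, x⟫).re := h3
  linarith

/-- The same argument with the complementary projection and (t - ε) - x. -/
lemma IsSelfAdjoint.le_of_upperProjection_eq_zero (hK : IsSelfAdjoint K) {t ε : ℝ} (hε : 0 < ε)
    (h : ∀ x ∈ spectrum ℝ K, x ≤ t - ε ∨ t + ε ≤ x) {x : E} (hx : upperProjection K t x = 0) :
    K.reApplyInnerSelf x ≤ (t - ε) * ‖x‖ ^ 2 := by
  have hc := continuousOn_indicator_gap hε h
  have h1 : ((t - ε) • (1 : E →L[ℂ] E) - K) * (1 - upperProjection K t) =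
      cfc (fun x : ℝ => ((t - ε) - x) * (1 - if t < x then (1 : ℝ) else 0)) K := by
    rw [cfc_mul (fun x : ℝ => (t - ε) - x) (fun x => 1 - if t < x then (1 : ℝ) else 0) K (by fun_prop)
         (continuousOn_const.sub hc),
      cfc_sub (fun _ => t - ε) (fun x : ℝ => x) K, cfc_id' ℝ K, cfc_const _ K,
      cfc_sub (fun _ => (1 : ℝ)) (fun x : ℝ => if t < x then (1 : ℝ) else 0) K
        continuousOn_const hc, cfc_const _ K,
      Algebra.algebraMap_eq_smul_one, Algebra.algebraMap_eq_smul_one, one_smul]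
    rfl
  have h2 : 0 ≤ ((t - ε) • (1 : E →L[ℂ] E) - K) * (1 - upperProjection K t) := by
    rw [h1]
    refine cfc_nonneg fun y hy => ?_
    rcases h y hy with h3 | h3
    · rw [if_neg (by linarith), sub_zero, mul_one]; linarith
    · rw [if_pos (by linarith), sub_self, mul_zero]
  have h3 := ((ContinuousLinearMap.nonneg_iff_isPositive _).1 h2).re_inner_nonneg_left x
  have hx' : (1 - upperProjection K t) x = x := by
    rw [_root_.sub_apply, hx, sub_zero]; rfl
  rw [mul_apply_eq_comp, hx'] at h3
  have h4 := re_inner_sub_smul K (t - ε) x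
  have h5 : 0 ≤ (⟪(t - ε) • x - K x, x⟫).re := h3
  rw [← neg_sub, inner_neg_left, Complex.neg_re] at h5
  linarith

omit [CompleteSpace E] in
lemma Submodule.exists_ne_zero_map_eq_zero {G : Type*} [AddCommGroup G] [Module ℂ G]
    {U : Submodule ℂ E} [FiniteDimensional ℂ U] (f : E →ₗ[ℂ] G)
    [FiniteDimensional ℂ (LinearMap.range f)]
    (h : finrank ℂ (LinearMap.range f) < finrank ℂ U) : ∃ x ∈ U, x ≠ 0 ∧ f x = 0 := by
  by_contra! hne
  have hinj : Function.Injective (f.rangeRestrict ∘ₗ U.subtype) := by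
    rw [injective_iff_map_eq_zero]
    intro x hx
    by_contra h0
    exact hne x x.2 (by simpa using h0) (congrArg Subtype.val hx)
  exact (LinearMap.finrank_le_finrank_of_injective hinj).not_gt h

/-- Below a spectral gap, min–max values cannot jump: a real number in a gap of the spectrum is
not a min–max value. -/
lemma IsSelfAdjoint.minmax_notMem_gap (hK : IsSelfAdjoint K) {t ε : ℝ} (hε : 0 < ε)
    (h : ∀ x ∈ spectrum ℝ K, x ≤ t - ε ∨ t + ε ≤ x) (hj : 1 ≤ j) :
    minmax K j ≤ (t - ε : ℝ) ∨ ((t + ε : ℝ) : EReal) ≤ minmax K j := by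
  -- The index is compared with the rank of the projection, as a cardinal since the rank may be
  -- infinite. If the rank is at least `j`, its range contains a trial space with large quotients;
  -- otherwise each `j`-dimensional space meets its kernel, where the quotients are small.
  by_cases hr : (j : Cardinal) ≤ Module.rank ℂ (LinearMap.range (upperProjection K t : E →ₗ[ℂ] E))
  · right
    obtain ⟨U, hU, hj⟩ := Submodule.exists_le_finrank_eq _ hr
    refine le_minmax hj fun x hx => ?_
    obtain ⟨y, rfl⟩ := hU hx
    exact hK.le_of_upperProjection_eq_self hε h (upperProjection_apply_self hε h y)
  · left
    have hfd : FiniteDimensional ℂ (LinearMap.range (upperProjection K t : E →ₗ[ℂ] E)) :=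
      Module.rank_lt_aleph0_iff.1 ((not_le.1 hr).trans (Cardinal.natCast_lt_aleph0))
    refine minmax_le fun U hU => ?_
    have : FiniteDimensional ℂ U := FiniteDimensional.of_finrank_pos (by omega)
    obtain ⟨x, hx, h0, hx0⟩ := U.exists_ne_zero_map_eq_zero (upperProjection K t : E →ₗ[ℂ] E) (by
      rw [← finrank_eq_rank] at hr
      rw [hU]
      exact_mod_cast not_le.1 hr)
    exact ⟨x, hx, h0, hK.le_of_upperProjection_eq_zero hε h hx0⟩

omit [CompleteSpace E] in
lemma mem_spectrum_real_iff (x : ℝ) :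
    x ∈ spectrum ℝ K ↔ ¬ IsUnit ((x : ℂ) • (1 : E →L[ℂ] E) - K) := by
  rw [spectrum.mem_iff, Algebra.algebraMap_eq_smul_one]
  rfl

end SpectralProjection

/-! ### Spectrum of a self-adjoint operator at and above the limit of its min–max values. -/

section Main

variable [CompleteSpace E] {K : E →L[ℂ] E} {m : ℝ}

/-- Above the limit of the min–max values, `ω - K` is Fredholm. -/
theorem IsSelfAdjoint.fredholm_of_limit_minmax_lt (hK : IsSelfAdjoint K)
    (hm : Tendsto (minmax K) atTop (𝓝 (m : EReal))) {ω : ℝ} (hω : m < ω) :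
    FiniteDimensional ℂ (LinearMap.ker (((ω : ℂ) • (1 : E →L[ℂ] E) - K : E →L[ℂ] E) :
        E →ₗ[ℂ] E)) ∧
      IsClosed (LinearMap.range (((ω : ℂ) • (1 : E →L[ℂ] E) - K : E →L[ℂ] E) :
        E →ₗ[ℂ] E) : Set E) := by
  obtain ⟨c, hmc, hcω⟩ := exists_between hω
  obtain ⟨j, hj⟩ := (hm.eventually_lt_const (EReal.coe_lt_coe_iff.2 hmc)).exists
  obtain ⟨F, hF, hw⟩ := exists_finiteDimensional_orthogonal_le
    (ContinuousLinearMap.isSelfAdjoint_iff_isSymmetric.1 hK) hj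
  -- On `Fᗮ`, the form of `ω - K` is at least `(ω - c)‖w‖²`, and Cauchy–Schwarz turns this into a
  -- lower bound for the norm.
  refine finiteDimensional_ker_and_isClosed_range (F := F) (sub_pos.2 hcω) fun w hwF => ?_
  have h1 := hw w hwF
  have h2 := re_inner_sub_smul K ω w
  set y := ((ω : ℂ) • (1 : E →L[ℂ] E) - K) w with hy
  have hy' : K w - ω • w = -y := by
    rw [hy]
    simp only [_root_.sub_apply, _root_.smul_apply, one_apply_eq_self, neg_sub]
    rfl
  rw [hy', inner_neg_left, Complex.neg_re] at h2
  have h3 : (⟪y, w⟫).re ≤ ‖y‖ * ‖w‖ := (Complex.re_le_norm _).trans (norm_inner_le_norm _ _)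
  by_cases h0 : ‖w‖ = 0
  · rw [h0, mul_zero]; positivity
  · have : 0 < ‖w‖ := lt_of_le_of_ne (norm_nonneg _) (Ne.symm h0)
    nlinarith

/-- At the limit of the min–max values, `ω - K` is not Fredholm. -/
theorem IsSelfAdjoint.not_fredholm_limit_minmax (hK : IsSelfAdjoint K)
    (hm : Tendsto (minmax K) atTop (𝓝 (m : EReal))) :
    ¬ (FiniteDimensional ℂ (LinearMap.ker (((m : ℂ) • (1 : E →L[ℂ] E) - K : E →L[ℂ] E) :
        E →ₗ[ℂ] E)) ∧
      IsClosed (LinearMap.range (((m : ℂ) • (1 : E →L[ℂ] E) - K : E →L[ℂ] E) :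
        E →ₗ[ℂ] E) : Set E)) := by
  rintro ⟨hker, hr⟩
  obtain ⟨c, hc, hbd⟩ := exists_bound_orthogonal_ker hr
  -- Closed range makes `m` at worst an isolated point of the spectrum, which leaves gaps around `m
  -- - c/2` and `m + c/2`, each of half-width `c/4`.
  have hspec : ∀ x ∈ spectrum ℝ K, x ≠ m → c ≤ |x - m| := by
    intro x hx hxm
    by_contra! hlt
    refine (mem_spectrum_real_iff x).1 hx (hK.isUnit_shift_of_bound hbd ?_ (Or.inl ?_))
    · rwa [← Complex.ofReal_sub, Complex.norm_real]
    · exact_mod_cast hxm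
  have hc4 : 0 < c / 4 := by linarith
  have hgap1 : ∀ x ∈ spectrum ℝ K, x ≤ (m - c / 2) - c / 4 ∨ (m - c / 2) + c / 4 ≤ x := by
    intro x hx
    by_cases h : x = m
    · right; linarith
    · rcases le_abs.1 (hspec x hx h) with h | h
      · right; linarith
      · left; linarith
  have hgap2 : ∀ x ∈ spectrum ℝ K, x ≤ (m + c / 2) - c / 4 ∨ (m + c / 2) + c / 4 ≤ x := by
    intro x hx
    by_cases h : x = m
    · left; linarith
    · rcases le_abs.1 (hspec x hx h) with h | h
      · right; linarith
      · left; linarith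
  set P := upperProjection K (m - c / 2) with hP
  set Q := upperProjection K (m + c / 2) with hQ
  obtain ⟨N, hN⟩ := (hm.eventually_lt_const (u := ((m + c / 2 + c / 4 : ℝ) : EReal))
    (EReal.coe_lt_coe_iff.2 (by linarith))).exists
  -- Otherwise all min–max values would be at least `m + 3c/4`.
  have hQfd : FiniteDimensional ℂ (LinearMap.range (Q : E →ₗ[ℂ] E)) := by
    refine Module.rank_lt_aleph0_iff.1 (lt_of_lt_of_le (not_le.1 fun hr => ?_)
      (Cardinal.natCast_lt_aleph0 (n := N)).le)
    obtain ⟨U, hU, hj⟩ := Submodule.exists_le_finrank_eq _ hr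
    refine (le_minmax hj fun x hx => ?_).not_gt hN
    obtain ⟨y, rfl⟩ := hU hx
    exact hK.le_of_upperProjection_eq_self hc4 hgap2 (upperProjection_apply_self hc4 hgap2 y)
  -- `P - Q` is the spectral projection for the single point `m`, so its range lies in the
  -- eigenspace.
  have hPQ : ((m : ℂ) • (1 : E →L[ℂ] E) - K) * (P - Q) = 0 := by
    have h1 := continuousOn_indicator_gap hc4 hgap1
    have h2 := continuousOn_indicator_gap hc4 hgap2
    have h3 : (m • (1 : E →L[ℂ] E) - K) * (P - Q) = cfc (fun x : ℝ => (m - x) *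
        ((if m - c / 2 < x then (1 : ℝ) else 0) - if m + c / 2 < x then (1 : ℝ) else 0)) K := by
      rw [cfc_mul (fun x : ℝ => m - x) (fun x => (if m - c / 2 < x then (1 : ℝ) else 0) -
          if m + c / 2 < x then (1 : ℝ) else 0) K (by fun_prop) (h1.sub h2),
        cfc_sub (fun _ => m) (fun x : ℝ => x) K, cfc_id' ℝ K, cfc_const _ K,
        cfc_sub _ _ K h1 h2, Algebra.algebraMap_eq_smul_one]
      rfl
    refine h3.trans ?_
    rw [← cfc_zero ℝ K]
    refine cfc_congr fun x hx => ?_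
    by_cases h : x = m
    · simp [h]
    · rcases le_abs.1 (hspec x hx h) with h | h
      · simp only [Pi.zero_apply]
        rw [if_pos (by linarith), if_pos (by linarith), sub_self, mul_zero]
      · simp only [Pi.zero_apply]
        rw [if_neg (by linarith), if_neg (by linarith), sub_self, mul_zero]
  have hPfd : FiniteDimensional ℂ (LinearMap.range (P : E →ₗ[ℂ] E)) := by
    refine Submodule.finiteDimensional_of_le (S₂ := LinearMap.range (Q : E →ₗ[ℂ] E) ⊔
      LinearMap.ker (((m : ℂ) • (1 : E →L[ℂ] E) - K : E →L[ℂ] E) : E →ₗ[ℂ] E)) ?_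
    rintro _ ⟨x, rfl⟩
    refine Submodule.mem_sup.2 ⟨Q x, ⟨x, rfl⟩, (P - Q) x, ?_, ?_⟩
    · exact congrArg (fun T : E →L[ℂ] E => T x) hPQ
    · simp
  -- One dimension more than the rank of `P`: a trial space of dimension `n` for the level `m - c/2`
  -- contains a nonzero vector of the kernel of `P`, where the quotient is at most `m - 3c/4`.
  set n := finrank ℂ (LinearMap.range (P : E →ₗ[ℂ] E)) + 1 with hn
  have hmn : (m : EReal) ≤ minmax K n := (antitone_minmax K).le_of_tendsto hm n
  obtain ⟨U, hU, hx⟩ := exists_of_lt_minmax (c := m - c / 2) (lt_of_lt_of_le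
    (EReal.coe_lt_coe_iff.2 (by linarith)) hmn)
  have : FiniteDimensional ℂ U := FiniteDimensional.of_finrank_pos (by omega)
  obtain ⟨x, hxU, h0, hx0⟩ := U.exists_ne_zero_map_eq_zero (P : E →ₗ[ℂ] E) (by omega)
  have h1 := hK.le_of_upperProjection_eq_zero hc4 hgap1 hx0
  have h2 := hx x hxU
  have : 0 < ‖x‖ ^ 2 := by positivity
  nlinarith

/-- A min–max value above the limit is an eigenvalue, isolated in the spectrum. -/
theorem IsSelfAdjoint.minmax_eigenvalue (hK : IsSelfAdjoint K)
    (hm : Tendsto (minmax K) atTop (𝓝 (m : EReal))) {ω : ℝ} (hj : 1 ≤ j)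
    (hωj : minmax K j = ω) (hω : m < ω) :
    LinearMap.ker (((ω : ℂ) • (1 : E →L[ℂ] E) - K : E →L[ℂ] E) : E →ₗ[ℂ] E) ≠ ⊥ ∧
      ∃ ε > 0, ∀ ζ : ℂ, ζ ≠ ω → ‖ζ - ω‖ < ε → IsUnit (ζ • (1 : E →L[ℂ] E) - K) := by
  obtain ⟨hfd, hr⟩ := hK.fredholm_of_limit_minmax_lt hm hω
  obtain ⟨c, hc, hbd⟩ := exists_bound_orthogonal_ker hr
  refine ⟨fun hbot => ?_, c, hc, fun ζ h1 h2 => hK.isUnit_shift_of_bound hbd h2 (Or.inl h1)⟩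
  -- With trivial kernel, `ω` would be the centre of a spectral gap, which contains no min–max
  -- value.
  have hspec : ∀ x ∈ spectrum ℝ K, x ≤ ω - c ∨ ω + c ≤ x := by
    intro x hx
    by_contra! hlt
    refine (mem_spectrum_real_iff x).1 hx (hK.isUnit_shift_of_bound hbd ?_ (Or.inr hbot))
    rw [← Complex.ofReal_sub, Complex.norm_real, Real.norm_eq_abs, abs_lt]
    constructor <;> linarith
  rcases hK.minmax_notMem_gap hc hspec hj with h | h
  · rw [hωj, EReal.coe_le_coe_iff] at h
    linarith
  · rw [hωj, EReal.coe_le_coe_iff] at h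
    linarith

end Main

/-! ### Transfer between an operator `T` in `H` and `ω - ι ∘L M` in `E`. -/

section Graph

open ShelfStrip

variable [CompleteSpace E] {H : Type*} [NormedAddCommGroup H] [InnerProductSpace ℂ H]
  {j : E →L[ℂ] H} {ι : H →L[ℂ] E} {M : E →L[ℂ] H} {ω : ℂ} {T : H →ₗ.[ℂ] H}

omit [CompleteSpace E] in
-- The hypothesis `hT` is the abstract form of `mem_graph_pencil_iff`: in the application, `E` is
-- the energy space, `j` its embedding into L₂(G; h) and `ι` the adjoint of `j`.
lemma range_eq_comap_of_graph (hT : ∀ u f, (u, f) ∈ T.graph ↔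
      ∃ x, j x = u ∧ (ω • (1 : E →L[ℂ] E) - ι ∘L M) x = ι f) :
    LinearMap.range T.toFun = (LinearMap.range
      ((ω • (1 : E →L[ℂ] E) - ι ∘L M : E →L[ℂ] E) : E →ₗ[ℂ] E)).comap (ι : H →ₗ[ℂ] E) := by
  ext f
  constructor
  · rintro ⟨u, rfl⟩
    obtain ⟨x, -, hx⟩ := (hT _ _).1 (T.mem_graph u)
    exact ⟨x, hx⟩
  · rintro ⟨x, hx⟩
    obtain ⟨u, -, hu⟩ := (LinearPMap.mem_graph_iff T).1 ((hT (j x) f).2 ⟨x, rfl, hx⟩)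
    exact ⟨u, hu⟩

/-- If `ω - K` is Fredholm, so is the operator it induces. -/
lemma isFredholmOp_of_graph {ω : ℝ} (hK : IsSelfAdjoint (ι ∘L M))
    (hT : ∀ u f, (u, f) ∈ T.graph ↔
      ∃ x, j x = u ∧ ((ω : ℂ) • (1 : E →L[ℂ] E) - ι ∘L M) x = ι f)
    (hker : FiniteDimensional ℂ (LinearMap.ker
      (((ω : ℂ) • (1 : E →L[ℂ] E) - ι ∘L M : E →L[ℂ] E) : E →ₗ[ℂ] E)))
    (hr : IsClosed (LinearMap.range
      (((ω : ℂ) • (1 : E →L[ℂ] E) - ι ∘L M : E →L[ℂ] E) : E →ₗ[ℂ] E) : Set E)) :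
    IsFredholmOp T := by
  have hrange := range_eq_comap_of_graph hT
  set B := (ω : ℂ) • (1 : E →L[ℂ] E) - ι ∘L M with hB
  refine ⟨?_, ?_, ?_⟩
  · have hle : (LinearMap.ker T.toFun).map T.domain.subtype ≤
        (LinearMap.ker (B : E →ₗ[ℂ] E)).map (j : E →ₗ[ℂ] H) := by
      rintro _ ⟨u, hu, rfl⟩
      obtain ⟨x, hx, hx'⟩ := (hT _ _).1 (T.mem_graph u)
      refine ⟨x, ?_, hx⟩
      change T u = 0 at hu
      rw [hu, map_zero] at hx'
      exact hx'
    have := Submodule.finiteDimensional_of_le hle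
    exact Module.Finite.equiv ((LinearMap.ker T.toFun).equivMapOfInjective _
      T.domain.injective_subtype).symm
  · rw [hrange]
    exact hr.preimage ι.continuous
  · rw [hrange]
    set R := LinearMap.range (B : E →ₗ[ℂ] E) with hR
    have := hr.completeSpace_coe
    -- Self-adjointness and `ω` real give the cokernel of `B` the dimension of its kernel.
    have hRk : Rᗮ = LinearMap.ker (B : E →ₗ[ℂ] E) := by
      ext y
      rw [Submodule.mem_orthogonal]
      constructor
      · intro h
        have h1 := h _ ⟨B y, rfl⟩
        simp only [ContinuousLinearMap.coe_coe] at h1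
        have h2 := hK.inner_shift ω (B y) y
        rw [Complex.conj_ofReal] at h2
        exact inner_self_eq_zero.1 (h2.symm.trans h1)
      · rintro h _ ⟨x, rfl⟩
        have h2 := hK.inner_shift ω x y
        rw [Complex.conj_ofReal] at h2
        refine h2.trans ?_
        rw [show ((ω : ℂ) • (1 : E →L[ℂ] E) - ι ∘L M) y = 0 from h, inner_zero_right]
    have hfd : FiniteDimensional ℂ (E ⧸ R) := by
      rw [← hRk] at hker
      exact Module.Finite.equiv
        (Submodule.quotientEquivOfIsCompl R Rᗮ R.isCompl_orthogonal).symm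
    -- The quotient by a preimage under `ι` injects into the quotient by `R`.
    refine FiniteDimensional.of_injective
      (Submodule.mapQ (R.comap (ι : H →ₗ[ℂ] E)) R (ι : H →ₗ[ℂ] E) le_rfl) ?_
    rw [← LinearMap.ker_eq_bot, Submodule.ker_mapQ]
    exact Submodule.mkQ_map_self _

/-- An algebraic complement of the range is finite-dimensional, hence closed. After restriction to
the orthogonal complement of the kernel, the map is injective with a closed complement to its range,
which makes the range closed. -/
lemma ContinuousLinearMap.isClosed_range_of_finiteDimensional_quotient (B : E →L[ℂ] E)
    (h : FiniteDimensional ℂ (E ⧸ LinearMap.range (B : E →ₗ[ℂ] E))) :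
    IsClosed (LinearMap.range (B : E →ₗ[ℂ] E) : Set E) := by
  have := B.isClosed_ker.completeSpace_coe
  set N := LinearMap.ker (B : E →ₗ[ℂ] E) with hN
  let g : Nᗮ →L[ℂ] E := B.comp Nᗮ.subtypeL
  have hinj : LinearMap.ker (g : Nᗮ →ₗ[ℂ] E) = ⊥ := by
    rw [Submodule.eq_bot_iff]
    intro x hx
    have : (x : E) ∈ N ⊓ Nᗮ := ⟨hx, x.2⟩
    rw [Submodule.inf_orthogonal_eq_bot] at this
    exact Subtype.ext ((Submodule.mem_bot ℂ).1 this)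
  have hrg : LinearMap.range (g : Nᗮ →ₗ[ℂ] E) = LinearMap.range (B : E →ₗ[ℂ] E) := by
    apply le_antisymm
    · rintro _ ⟨x, rfl⟩
      exact ⟨x, rfl⟩
    · rintro _ ⟨x, rfl⟩
      refine ⟨⟨Nᗮ.starProjection x, Submodule.starProjection_apply_mem _ _⟩, ?_⟩
      have h1 := N.starProjection_add_starProjection_orthogonal x
      have h2 : B (N.starProjection x) = 0 :=
        (Submodule.starProjection_apply_mem N x : _ ∈ N)
      change B (Nᗮ.starProjection x) = B x
      conv_rhs => rw [← h1, map_add, h2, zero_add]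
  obtain ⟨G, hG⟩ := Submodule.exists_isCompl (LinearMap.range (B : E →ₗ[ℂ] E))
  have hGfd : FiniteDimensional ℂ G :=
    Module.Finite.equiv (Submodule.quotientEquivOfIsCompl _ G hG)
  have := g.closed_complemented_range_of_isCompl_of_ker_eq_bot G (by rwa [hrg])
    G.closed_of_finiteDimensional hinj
  rwa [hrg] at this

/-- If the operator induced by `ω - K` is Fredholm, so is `ω - K`. -/
lemma fredholm_of_isFredholmOp (hω : ω ≠ 0) (hj : Function.Injective j)
    (hT : ∀ u f, (u, f) ∈ T.graph ↔
      ∃ x, j x = u ∧ (ω • (1 : E →L[ℂ] E) - ι ∘L M) x = ι f) (h : IsFredholmOp T) :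
    FiniteDimensional ℂ (LinearMap.ker
      ((ω • (1 : E →L[ℂ] E) - ι ∘L M : E →L[ℂ] E) : E →ₗ[ℂ] E)) ∧
    IsClosed (LinearMap.range
      ((ω • (1 : E →L[ℂ] E) - ι ∘L M : E →L[ℂ] E) : E →ₗ[ℂ] E) : Set E) := by
  have hrange := range_eq_comap_of_graph hT
  obtain ⟨hk, -, hq⟩ := h
  rw [hrange] at hq
  set B := ω • (1 : E →L[ℂ] E) - ι ∘L M with hB
  constructor
  · have hle : (LinearMap.ker (B : E →ₗ[ℂ] E)).map (j : E →ₗ[ℂ] H) ≤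
        (LinearMap.ker T.toFun).map T.domain.subtype := by
      rintro _ ⟨x, hx, rfl⟩
      obtain ⟨u, hu, hu'⟩ := (LinearPMap.mem_graph_iff T).1
        ((hT (j x) 0).2 ⟨x, rfl, by rw [map_zero]; exact hx⟩)
      exact ⟨u, hu', hu⟩
    have := Submodule.finiteDimensional_of_le hle
    exact Module.Finite.equiv ((LinearMap.ker (B : E →ₗ[ℂ] E)).equivMapOfInjective _ hj).symm
  · refine B.isClosed_range_of_finiteDimensional_quotient ?_
    set R := LinearMap.range (B : E →ₗ[ℂ] E) with hR
    refine Module.Finite.of_surjective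
      (Submodule.mapQ (R.comap (ι : H →ₗ[ℂ] E)) R (ι : H →ₗ[ℂ] E) le_rfl) ?_
    intro q
    obtain ⟨y, rfl⟩ := R.mkQ_surjective q
    -- From `ω y = B y + ι (M y)`: modulo the range of `B`, every `y` is in the image of `ι`. This
    -- is where `ω ≠ 0` enters.
    refine ⟨Submodule.Quotient.mk (ω⁻¹ • M y), ?_⟩
    rw [Submodule.mapQ_apply, Submodule.mkQ_apply, Submodule.Quotient.eq]
    refine ⟨-(ω⁻¹ • y), ?_⟩
    simp only [hB, ContinuousLinearMap.coe_coe, _root_.sub_apply, _root_.smul_apply,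
      one_apply_eq_self, map_neg, map_smul, ContinuousLinearMap.comp_apply, smul_sub, smul_smul,
      inv_mul_cancel₀ hω, one_smul]
    abel

omit [CompleteSpace E] in
-- The inverse is `j`, after the inverse of `ω - ι ∘L M`, after `ι`.
lemma isInvertibleOp_of_graph (hT : ∀ u f, (u, f) ∈ T.graph ↔
      ∃ x, j x = u ∧ (ω • (1 : E →L[ℂ] E) - ι ∘L M) x = ι f)
    (h : IsUnit (ω • (1 : E →L[ℂ] E) - ι ∘L M)) : IsInvertibleOp T := by
  obtain ⟨B, hB⟩ := h
  have hinv : ∀ x, (↑B⁻¹ : E →L[ℂ] E) ((ω • (1 : E →L[ℂ] E) - ι ∘L M) x) = x := fun x => by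
    rw [← hB]
    exact congrArg (fun S : E →L[ℂ] E => S x) B.inv_mul
  have hinv' : ∀ x, (ω • (1 : E →L[ℂ] E) - ι ∘L M) ((↑B⁻¹ : E →L[ℂ] E) x) = x := fun x => by
    rw [← hB]
    exact congrArg (fun S : E →L[ℂ] E => S x) B.mul_inv
  have hu : ∀ u : T.domain, (u : H) = j ((↑B⁻¹ : E →L[ℂ] E) (ι (T u))) := fun u => by
    obtain ⟨x, hx, hx'⟩ := (hT _ _).1 (T.mem_graph u)
    rw [← hx', hinv, hx]
  refine ⟨⟨?_, ?_⟩, ‖j ∘L (↑B⁻¹ : E →L[ℂ] E) ∘L ι‖, fun u => ?_⟩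
  · intro u v huv
    change T u = T v at huv
    exact Subtype.ext (by rw [hu u, hu v, huv])
  · intro f
    obtain ⟨u, -, hu⟩ := (LinearPMap.mem_graph_iff T).1
      ((hT _ f).2 ⟨(↑B⁻¹ : E →L[ℂ] E) (ι f), rfl, hinv' _⟩)
    exact ⟨u, hu⟩
  · conv_lhs => rw [hu u]
    exact (j ∘L (↑B⁻¹ : E →L[ℂ] E) ∘L ι).le_opNorm (T u)

omit [CompleteSpace E] in
lemma ker_ne_bot_of_graph (hj : Function.Injective j)
    (hT : ∀ u f, (u, f) ∈ T.graph ↔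
      ∃ x, j x = u ∧ (ω • (1 : E →L[ℂ] E) - ι ∘L M) x = ι f)
    (h : LinearMap.ker ((ω • (1 : E →L[ℂ] E) - ι ∘L M : E →L[ℂ] E) : E →ₗ[ℂ] E) ≠ ⊥) :
    LinearMap.ker T.toFun ≠ ⊥ := by
  obtain ⟨x, hx, hx0⟩ := Submodule.exists_mem_ne_zero_of_ne_bot h
  obtain ⟨u, hu, hu'⟩ := (LinearPMap.mem_graph_iff T).1
    ((hT (j x) 0).2 ⟨x, rfl, by rw [map_zero]; exact hx⟩)
  intro hbot
  have h1 : u ∈ LinearMap.ker T.toFun := hu'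
  rw [hbot, Submodule.mem_bot] at h1
  rw [h1] at hu
  exact hx0 (hj (by rw [map_zero]; exact hu.symm))

end Graph

end MinMax

namespace ShelfStrip

noncomputable section

variable (S : ShelfStrip)

/-! ### Bounded continuous coefficients -/

/-- Real coefficients which are continuous and bounded on the strip. -/
structure BddCont (a : ℝ × ℝ → ℝ) : Prop where
  cont : ContinuousOn a S.G
  bdd : ∃ C, ∀ z ∈ S.G, |a z| ≤ C

section BddCont

variable {S} {a b : ℝ × ℝ → ℝ}

lemma BddCont.add (ha : S.BddCont a) (hb : S.BddCont b) : S.BddCont (fun z => a z + b z) := by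
  obtain ⟨C, hC⟩ := ha.bdd
  obtain ⟨D, hD⟩ := hb.bdd
  exact ⟨ha.cont.add hb.cont, C + D, fun z hz =>
    (abs_add_le _ _).trans (add_le_add (hC z hz) (hD z hz))⟩

lemma BddCont.mul (ha : S.BddCont a) (hb : S.BddCont b) : S.BddCont (fun z => a z * b z) := by
  obtain ⟨C, hC⟩ := ha.bdd
  obtain ⟨D, hD⟩ := hb.bdd
  refine ⟨ha.cont.mul hb.cont, C * D, fun z hz => ?_⟩
  rw [abs_mul]
  exact mul_le_mul (hC z hz) (hD z hz) (abs_nonneg _) ((abs_nonneg _).trans (hC z hz))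

lemma BddCont.neg (ha : S.BddCont a) : S.BddCont (fun z => -a z) := by
  obtain ⟨C, hC⟩ := ha.bdd
  exact ⟨ha.cont.neg, C, fun z hz => by rw [abs_neg]; exact hC z hz⟩

lemma BddCont.sub (ha : S.BddCont a) (hb : S.BddCont b) : S.BddCont (fun z => a z - b z) := by
  simpa only [sub_eq_add_neg] using ha.add hb.neg

lemma bddCont_const (c : ℝ) : S.BddCont (fun _ => c) :=
  ⟨continuousOn_const, |c|, fun _ _ => le_rfl⟩

lemma BddCont.congr (ha : S.BddCont a) (h : ∀ z ∈ S.G, b z = a z) : S.BddCont b := by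
  obtain ⟨C, hC⟩ := ha.bdd
  exact ⟨ha.cont.congr h, C, fun z hz => by rw [h z hz]; exact hC z hz⟩

/-- Boundedness of a function of `η` which is continuous up to the boundary. -/
lemma bddCont_of_Icc {b : ℝ → ℝ} (hb : ContinuousOn b (Icc 0 S.δ)) :
    S.BddCont (fun z => b z.2) := by
  refine ⟨hb.comp continuous_snd.continuousOn fun z hz => ⟨hz.1.le, hz.2.le⟩, ?_⟩
  obtain ⟨C, hC⟩ := isCompact_Icc.exists_bound_of_continuousOn hb
  exact ⟨C, fun z hz => hC z.2 ⟨hz.1.le, hz.2.le⟩⟩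

end BddCont

lemma differentiable_γ : Differentiable ℝ S.γ := S.γ_smooth.differentiable (by simp)

lemma continuous_deriv_γ : Continuous (deriv S.γ) := S.γ_smooth.continuous_deriv (by simp)

lemma exists_bound_deriv_γ : ∃ C, ∀ x, |deriv S.γ x| ≤ C :=
  S.γ_compact.deriv.exists_bound_of_continuous S.continuous_deriv_γ

lemma abs_le_δ {z : ℝ × ℝ} (hz : z ∈ S.G) : |z.2| ≤ S.δ := by
  rw [abs_of_pos hz.1]
  exact hz.2.le

lemma bddCont_pη : S.BddCont S.pη := by
  obtain ⟨A, -, -, hA⟩ := S.γ_bound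
  exact ⟨(S.γ_smooth.continuous.comp continuous_fst).continuousOn, A / S.δ, fun z _ => hA z.1⟩

lemma bddCont_pξ : S.BddCont S.pξ := by
  obtain ⟨C, hC⟩ := S.exists_bound_deriv_γ
  refine ⟨(continuous_snd.mul (S.continuous_deriv_γ.comp continuous_fst)).continuousOn,
    S.δ * C, fun z hz => ?_⟩
  rw [pξ, abs_mul]
  exact mul_le_mul (S.abs_le_δ hz) (hC _) (abs_nonneg _) S.δ_pos.le

lemma bddCont_snd : S.BddCont Prod.snd := bddCont_of_Icc (b := id) continuousOn_id

lemma bddCont_p : S.BddCont S.p := (bddCont_const 1).add (S.bddCont_snd.mul S.bddCont_pη)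

lemma p_pos {z : ℝ × ℝ} (hz : z ∈ S.G) : 0 < S.p z := by
  obtain ⟨c, hc, h⟩ := S.exists_p_lower
  exact hc.trans_le (h z hz)

lemma bddCont_p_inv : S.BddCont (fun z => 1 / S.p z) := by
  obtain ⟨c, hc, h⟩ := S.exists_p_lower
  refine ⟨continuousOn_const.div S.bddCont_p.cont fun z hz => (S.p_pos hz).ne', 1 / c,
    fun z hz => ?_⟩
  rw [abs_of_pos (by have := S.p_pos hz; positivity)]
  exact one_div_le_one_div_of_le hc (h z hz)

lemma bddCont_exp_neg : S.BddCont (fun z => Real.exp (-S.β z.2)) :=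
  bddCont_of_Icc (b := fun η => Real.exp (-S.β η)) S.β_contDiffOn.continuousOn.neg.rexp

lemma continuousOn_derivWithin_β : ContinuousOn (derivWithin S.β (Icc 0 S.δ)) (Icc 0 S.δ) :=
  S.β_contDiffOn.continuousOn_derivWithin (uniqueDiffOn_Icc S.δ_pos) le_rfl

lemma derivWithin_β {z : ℝ × ℝ} (hz : z ∈ S.G) :
    derivWithin S.β (Icc 0 S.δ) z.2 = S.β' z :=
  derivWithin_of_mem_nhds (Icc_mem_nhds hz.1 hz.2)

/-- `deriv S.β` carries no information at the endpoints; inside it agrees with the one-sided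
derivative, which is continuous on the closed interval and therefore bounded. -/
lemma bddCont_β' : S.BddCont S.β' :=
  (bddCont_of_Icc S.continuousOn_derivWithin_β).congr fun _ hz => (S.derivWithin_β hz).symm

/-- The weight of `L₂(G; h)`. -/
def w (z : ℝ × ℝ) : ℝ := Real.exp (-S.β z.2) * S.p z

lemma bddCont_w : S.BddCont S.w := S.bddCont_exp_neg.mul S.bddCont_p

lemma w_pos {z : ℝ × ℝ} (hz : z ∈ S.G) : 0 < S.w z := mul_pos (Real.exp_pos _) (S.p_pos hz)

lemma exists_wMeasure_le :
    ∃ C : ENNReal, C ≠ ⊤ ∧ S.wMeasure ≤ C • volume.restrict S.G := by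
  obtain ⟨C, hC⟩ := S.bddCont_w.bdd
  refine ⟨ENNReal.ofReal C, ENNReal.ofReal_ne_top, ?_⟩
  rw [← withDensity_const]
  refine withDensity_mono ?_
  filter_upwards [ae_restrict_mem S.isOpen_G.measurableSet] with z hz
  exact ENNReal.ofReal_le_ofReal ((le_abs_self _).trans (hC z hz))

variable {S} in
lemma ae_iff {P : ℝ × ℝ → Prop} :
    (∀ᵐ z ∂S.wMeasure, P z) ↔ ∀ᵐ z ∂(volume.restrict S.G), P z :=
  ⟨fun h => S.volume_ac.ae_le h, fun h => S.wMeasure_ac.ae_le h⟩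

lemma ae_mem_G : ∀ᵐ z ∂S.wMeasure, z ∈ S.G :=
  ae_iff.2 (ae_restrict_mem S.isOpen_G.measurableSet)

variable {S} in
lemma BddCont.aestronglyMeasurable {a : ℝ × ℝ → ℝ} (ha : S.BddCont a) :
    AEStronglyMeasurable (fun z => (a z : ℂ)) (volume.restrict S.G) :=
  Complex.continuous_ofReal.comp_aestronglyMeasurable
    (ha.cont.aestronglyMeasurable S.isOpen_G.measurableSet)

/-! ### Multiplication operators -/

section mulOp

variable {S} {a b : ℝ × ℝ → ℝ}

lemma BddCont.memLp_mul (ha : S.BddCont a) (u : S.L2) :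
    MemLp (fun z => (a z : ℂ) * u z) 2 S.wMeasure := by
  obtain ⟨C, hC⟩ := ha.bdd
  refine (Lp.memLp u).of_le_mul (c := C)
    ((ha.aestronglyMeasurable.mono_ac S.wMeasure_ac).mul (Lp.aestronglyMeasurable u)) ?_
  filter_upwards [S.ae_mem_G] with z hz
  rw [norm_mul, Complex.norm_real]
  exact mul_le_mul_of_nonneg_right (hC z hz) (norm_nonneg _)

/-- Multiplication by a bounded continuous coefficient, on `L₂(G; h)`. -/
def mulOp (ha : S.BddCont a) : S.L2 →L[ℂ] S.L2 :=
  LinearMap.mkContinuousOfExistsBound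
    { toFun := fun u => ((ha.memLp_mul u).toLp _)
      map_add' := fun u v => by
        refine Lp.ext ?_
        filter_upwards [(ha.memLp_mul (u + v)).coeFn_toLp, (ha.memLp_mul u).coeFn_toLp,
          (ha.memLp_mul v).coeFn_toLp, Lp.coeFn_add u v,
          Lp.coeFn_add ((ha.memLp_mul u).toLp _) ((ha.memLp_mul v).toLp _)] with z h1 h2 h3 h4 h5
        rw [h1, h5, Pi.add_apply, h2, h3, h4, Pi.add_apply, mul_add]
      map_smul' := fun c u => by
        refine Lp.ext ?_
        filter_upwards [(ha.memLp_mul (c • u)).coeFn_toLp, (ha.memLp_mul u).coeFn_toLp,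
          Lp.coeFn_smul c u, Lp.coeFn_smul c ((ha.memLp_mul u).toLp _)] with z h1 h2 h4 h5
        rw [RingHom.id_apply, h1, h5, Pi.smul_apply, h2, h4, Pi.smul_apply, smul_eq_mul,
          smul_eq_mul, mul_left_comm] }
    (by
      obtain ⟨C, hC⟩ := ha.bdd
      refine ⟨C, fun u => Lp.norm_le_mul_norm_of_ae_le_mul ?_⟩
      filter_upwards [(ha.memLp_mul u).coeFn_toLp, S.ae_mem_G] with z h1 hz
      change ‖((ha.memLp_mul u).toLp _) z‖ ≤ _
      rw [h1, norm_mul, Complex.norm_real]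
      exact mul_le_mul_of_nonneg_right (hC z hz) (norm_nonneg _))

lemma coeFn_mulOp (ha : S.BddCont a) (u : S.L2) :
    mulOp ha u =ᵐ[S.wMeasure] fun z => (a z : ℂ) * u z :=
  (ha.memLp_mul u).coeFn_toLp

lemma norm_mulOp_sub_le (ha : S.BddCont a) (hb : S.BddCont b) {C : ℝ}
    (h : ∀ z ∈ S.G, |a z - b z| ≤ C) (u : S.L2) : ‖mulOp ha u - mulOp hb u‖ ≤ C * ‖u‖ := by
  refine Lp.norm_le_mul_norm_of_ae_le_mul ?_
  filter_upwards [coeFn_mulOp ha u, coeFn_mulOp hb u, Lp.coeFn_sub (mulOp ha u) (mulOp hb u),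
    S.ae_mem_G] with z h1 h2 h3 hz
  rw [h3, Pi.sub_apply, h1, h2, ← sub_mul, norm_mul, ← Complex.ofReal_sub, Complex.norm_real]
  exact mul_le_mul_of_nonneg_right (h z hz) (norm_nonneg _)

lemma norm_mulOp_le (ha : S.BddCont a) {C : ℝ} (h : ∀ z ∈ S.G, |a z| ≤ C) (u : S.L2) :
    ‖mulOp ha u‖ ≤ C * ‖u‖ := by
  refine Lp.norm_le_mul_norm_of_ae_le_mul ?_
  filter_upwards [coeFn_mulOp ha u, S.ae_mem_G] with z h1 hz
  rw [h1, norm_mul, Complex.norm_real]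
  exact mul_le_mul_of_nonneg_right (h z hz) (norm_nonneg _)

end mulOp

/-! ### Weighted integrals of products -/

/-- `∫∫_G a u v̄`. -/
def wint (a : ℝ × ℝ → ℝ) (u v : S.L2) : ℂ :=
  ∫ z in S.G, (a z : ℂ) * u z * (starRingEnd ℂ) (v z)

section wint

variable {S} {a b : ℝ × ℝ → ℝ}

lemma BddCont.integrable (ha : S.BddCont a) (u v : S.L2) :
    Integrable (fun z => (a z : ℂ) * u z * (starRingEnd ℂ) (v z)) (volume.restrict S.G) := by
  obtain ⟨C, hC⟩ := ha.bdd
  have h : Integrable (fun z => u z * (starRingEnd ℂ) (v z)) (volume.restrict S.G) :=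
    (S.memLp_restrict u).integrable_mul (S.memLp_restrict v).star
  have := h.bdd_mul (c := C) ha.aestronglyMeasurable (by
    filter_upwards [ae_restrict_mem S.isOpen_G.measurableSet] with z hz
    rw [Complex.norm_real]
    exact hC z hz)
  simpa only [mul_assoc] using this

lemma wint_congr (h : ∀ z ∈ S.G, a z = b z) (u v : S.L2) : S.wint a u v = S.wint b u v := by
  refine setIntegral_congr_fun S.isOpen_G.measurableSet fun z hz => ?_
  simp only [h z hz]

lemma wint_add_left (ha : S.BddCont a) (u u' v : S.L2) :
    S.wint a (u + u') v = S.wint a u v + S.wint a u' v := by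
  rw [wint, wint, wint, ← integral_add (ha.integrable u v) (ha.integrable u' v)]
  refine integral_congr_ae ?_
  filter_upwards [ae_iff.1 (Lp.coeFn_add u u')] with z hz
  rw [hz, Pi.add_apply]
  ring

lemma wint_add_right (ha : S.BddCont a) (u v v' : S.L2) :
    S.wint a u (v + v') = S.wint a u v + S.wint a u v' := by
  rw [wint, wint, wint, ← integral_add (ha.integrable u v) (ha.integrable u v')]
  refine integral_congr_ae ?_
  filter_upwards [ae_iff.1 (Lp.coeFn_add v v')] with z hz
  rw [hz, Pi.add_apply, map_add]
  ring

lemma wint_smul_left (c : ℂ) (u v : S.L2) : S.wint a (c • u) v = c * S.wint a u v := by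
  rw [wint, wint, ← integral_const_mul]
  refine integral_congr_ae ?_
  filter_upwards [ae_iff.1 (Lp.coeFn_smul c u)] with z hz
  rw [hz, Pi.smul_apply, smul_eq_mul]
  ring

lemma wint_smul_right (c : ℂ) (u v : S.L2) :
    S.wint a u (c • v) = (starRingEnd ℂ) c * S.wint a u v := by
  rw [wint, wint, ← integral_const_mul]
  refine integral_congr_ae ?_
  filter_upwards [ae_iff.1 (Lp.coeFn_smul c v)] with z hz
  rw [hz, Pi.smul_apply, smul_eq_mul, map_mul]
  ring

lemma wint_neg_left (u v : S.L2) : S.wint a (-u) v = -S.wint a u v := by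
  have := wint_smul_left (a := a) (-1) u v
  simpa using this

lemma wint_neg_right (u v : S.L2) : S.wint a u (-v) = -S.wint a u v := by
  have := wint_smul_right (a := a) (-1) u v
  simpa using this

lemma wint_sub_left (ha : S.BddCont a) (u u' v : S.L2) :
    S.wint a (u - u') v = S.wint a u v - S.wint a u' v := by
  rw [sub_eq_add_neg, wint_add_left ha, wint_neg_left, sub_eq_add_neg]

lemma wint_sub_right (ha : S.BddCont a) (u v v' : S.L2) :
    S.wint a u (v - v') = S.wint a u v - S.wint a u v' := by
  rw [sub_eq_add_neg, wint_add_right ha, wint_neg_right, sub_eq_add_neg]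

lemma wint_add_coeff (ha : S.BddCont a) (hb : S.BddCont b) (u v : S.L2) :
    S.wint (fun z => a z + b z) u v = S.wint a u v + S.wint b u v := by
  rw [wint, wint, wint, ← integral_add (ha.integrable u v) (hb.integrable u v)]
  refine integral_congr_ae (.of_forall fun z => ?_)
  simp only [Complex.ofReal_add]
  ring

lemma wint_neg_coeff (u v : S.L2) : S.wint (fun z => -a z) u v = -S.wint a u v := by
  rw [wint, wint, ← integral_neg]
  refine integral_congr_ae (.of_forall fun z => ?_)
  simp only [Complex.ofReal_neg]
  ring

lemma wint_sub_coeff (ha : S.BddCont a) (hb : S.BddCont b) (u v : S.L2) :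
    S.wint (fun z => a z - b z) u v = S.wint a u v - S.wint b u v := by
  simp only [sub_eq_add_neg]
  rw [wint_add_coeff ha hb.neg, wint_neg_coeff]

lemma wint_mulOp_left (hb : S.BddCont b) (u v : S.L2) :
    S.wint a (mulOp hb u) v = S.wint (fun z => a z * b z) u v := by
  refine integral_congr_ae ?_
  filter_upwards [ae_iff.1 (coeFn_mulOp hb u)] with z hz
  rw [hz, Complex.ofReal_mul]
  ring

lemma wint_mulOp_right (hb : S.BddCont b) (u v : S.L2) :
    S.wint a u (mulOp hb v) = S.wint (fun z => a z * b z) u v := by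
  refine integral_congr_ae ?_
  filter_upwards [ae_iff.1 (coeFn_mulOp hb v)] with z hz
  rw [hz, Complex.ofReal_mul, map_mul, Complex.conj_ofReal]
  ring

lemma wint_conj (u v : S.L2) : (starRingEnd ℂ) (S.wint a u v) = S.wint a v u := by
  rw [wint, wint, ← integral_conj]
  refine integral_congr_ae (.of_forall fun z => ?_)
  simp only [map_mul, Complex.conj_ofReal, Complex.conj_conj]
  ring

variable (S) in
-- Cauchy–Schwarz, after comparison of Lebesgue measure with the weighted one. That `C` does not
-- depend on the coefficient allows uniform approximation and Lipschitz estimates of coefficients.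
lemma exists_norm_wint_le : ∃ C : ℝ, 0 ≤ C ∧ ∀ (a : ℝ × ℝ → ℝ) (c : ℝ), (∀ z ∈ S.G, |a z| ≤ c) →
    ∀ u v : S.L2, ‖S.wint a u v‖ ≤ c * (C * (‖u‖ * ‖v‖)) := by
  obtain ⟨C, hC, hle⟩ := S.exists_le_smul_wMeasure
  refine ⟨C.toReal, ENNReal.toReal_nonneg, fun a c hac u v => ?_⟩
  -- The strip is nonempty: the bound is evaluated on its centre line.
  have hc : 0 ≤ c := by
    have : ((0 : ℝ), S.δ / 2) ∈ S.G := by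
      have := S.δ_pos
      constructor <;> simp only <;> linarith
    exact (abs_nonneg _).trans (hac _ this)
  have h1 : (∫⁻ z in S.G, ‖(a z : ℂ) * u z * (starRingEnd ℂ) (v z)‖ₑ) ≤
      ENNReal.ofReal c * (C * (eLpNorm u 2 S.wMeasure * eLpNorm v 2 S.wMeasure)) := by
    calc (∫⁻ z in S.G, ‖(a z : ℂ) * u z * (starRingEnd ℂ) (v z)‖ₑ)
        ≤ ∫⁻ z in S.G, ENNReal.ofReal c * ‖u z • v z‖ₑ := by
          refine lintegral_mono_ae ?_
          filter_upwards [ae_restrict_mem S.isOpen_G.measurableSet] with z hz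
          rw [mul_assoc, enorm_mul, enorm_mul, enorm_smul]
          gcongr
          · rw [← ofReal_norm, Complex.norm_real]
            exact ENNReal.ofReal_le_ofReal (hac z hz)
          · rw [← ofReal_norm, RCLike.norm_conj, ofReal_norm]
      _ = ENNReal.ofReal c * ∫⁻ z in S.G, ‖u z • v z‖ₑ :=
          lintegral_const_mul' _ _ ENNReal.ofReal_ne_top
      _ ≤ ENNReal.ofReal c * (C * ∫⁻ z, ‖u z • v z‖ₑ ∂S.wMeasure) := by
          gcongr
          rw [← smul_eq_mul C, ← lintegral_smul_measure]
          exact lintegral_mono' hle le_rfl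
      _ = ENNReal.ofReal c * (C * eLpNorm (⇑u • ⇑v) 1 S.wMeasure) := by
          rw [eLpNorm_one_eq_lintegral_enorm]; rfl
      _ ≤ _ := by
          gcongr
          exact eLpNorm_smul_le_mul_eLpNorm (Lp.aestronglyMeasurable v) (Lp.aestronglyMeasurable u)
  have hfin : ENNReal.ofReal c * (C * (eLpNorm u 2 S.wMeasure * eLpNorm v 2 S.wMeasure)) ≠ ⊤ :=
    ENNReal.mul_ne_top ENNReal.ofReal_ne_top (ENNReal.mul_ne_top hC
      (ENNReal.mul_ne_top (Lp.memLp u).2.ne (Lp.memLp v).2.ne))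
  calc ‖S.wint a u v‖
      ≤ (∫⁻ z in S.G, ‖(a z : ℂ) * u z * (starRingEnd ℂ) (v z)‖ₑ).toReal := by
        have := ENNReal.toReal_mono (ne_top_of_le_ne_top hfin h1)
          (enorm_integral_le_lintegral_enorm (μ := volume.restrict S.G)
            (fun z => (a z : ℂ) * u z * (starRingEnd ℂ) (v z)))
        simpa [wint] using this
    _ ≤ _ := ENNReal.toReal_mono hfin h1
    _ = _ := by
        rw [ENNReal.toReal_mul, ENNReal.toReal_mul, ENNReal.toReal_mul, Lp.norm_def, Lp.norm_def,
          ENNReal.toReal_ofReal hc]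

lemma continuous_wint_right (ha : S.BddCont a) (u : S.L2) : Continuous fun v => S.wint a u v := by
  obtain ⟨C, -, hC⟩ := S.exists_norm_wint_le
  obtain ⟨c, hc⟩ := ha.bdd
  let L : S.L2 →ₗ⋆[ℂ] ℂ :=
    { toFun := fun v => S.wint a u v
      map_add' := wint_add_right ha u
      map_smul' := fun c v => wint_smul_right c u v }
  refine (L.mkContinuous (c * (C * ‖u‖)) fun v => ?_).continuous
  calc ‖S.wint a u v‖ ≤ _ := hC a c hc u v
    _ = _ := by ring

lemma continuous_wint_left (ha : S.BddCont a) (v : S.L2) : Continuous fun u => S.wint a u v := by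
  have := Complex.continuous_conj.comp (continuous_wint_right ha v)
  refine this.congr fun u => ?_
  exact wint_conj v u

lemma tendsto_wint_coeff {an : ℕ → ℝ × ℝ → ℝ} (ha : S.BddCont a) (hn : ∀ n, S.BddCont (an n))
    {ε : ℕ → ℝ} (hε : Tendsto ε atTop (𝓝 0)) (h : ∀ n, ∀ z ∈ S.G, |an n z - a z| ≤ ε n)
    (u v : S.L2) : Tendsto (fun n => S.wint (an n) u v) atTop (𝓝 (S.wint a u v)) := by
  obtain ⟨C, -, hC⟩ := S.exists_norm_wint_le
  rw [tendsto_iff_norm_sub_tendsto_zero]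
  refine squeeze_zero (fun _ => norm_nonneg _) (fun n => ?_)
    (by simpa using hε.mul_const (C * (‖u‖ * ‖v‖)))
  rw [← wint_sub_coeff (hn n) ha]
  exact hC _ _ (h n) u v

lemma integral_wMeasure (f : ℝ × ℝ → ℂ) :
    ∫ z, f z ∂S.wMeasure = ∫ z in S.G, (S.w z : ℂ) * f z := by
  have hm : AEMeasurable (fun z => ENNReal.ofReal (Real.exp (-S.β z.2) * S.p z))
      (volume.restrict S.G) :=
    (S.bddCont_w.cont.aemeasurable S.isOpen_G.measurableSet).ennreal_ofReal
  rw [wMeasure, integral_withDensity_eq_integral_toReal_smul₀ hm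
    (.of_forall fun _ => ENNReal.ofReal_lt_top)]
  refine setIntegral_congr_fun S.isOpen_G.measurableSet fun z hz => ?_
  change (ENNReal.ofReal (S.w z)).toReal • f z = _
  rw [ENNReal.toReal_ofReal (S.w_pos hz).le, Complex.real_smul]

lemma inner_eq_wint (u v : S.L2) : inner ℂ v u = S.wint S.w u v := by
  rw [L2.inner_def, integral_wMeasure]
  refine integral_congr_ae (.of_forall fun z => ?_)
  simp only [RCLike.inner_apply]
  ring

end wint

/-! ### Translations -/

/-- The translation by `s` in the `ξ`-direction. -/
def trans (s : ℝ) (z : ℝ × ℝ) : ℝ × ℝ := (z.1 + s, z.2)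

lemma trans_eq (s : ℝ) : trans s = fun z => z + (s, (0 : ℝ)) := by
  ext z <;> simp [trans]

lemma measurePreserving_trans (s : ℝ) :
    MeasurePreserving (trans s) (volume.restrict S.G) (volume.restrict S.G) := by
  have h : MeasurePreserving (trans s) volume volume := by
    rw [trans_eq]
    exact measurePreserving_add_right volume _
  exact h.restrict_preimage S.isOpen_G.measurableSet

lemma measurableEmbedding_trans (s : ℝ) : MeasurableEmbedding (trans s) := by
  rw [trans_eq]
  exact measurableEmbedding_addRight _

lemma memLp_of_restrict {f : ℝ × ℝ → ℂ} (h : MemLp f 2 (volume.restrict S.G)) :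
    MemLp f 2 S.wMeasure := by
  obtain ⟨C, hC, hle⟩ := S.exists_wMeasure_le
  exact h.of_measure_le_smul hC hle

lemma memLp_trans (s : ℝ) (u : S.L2) : MemLp (fun z => u (trans s z)) 2 S.wMeasure :=
  S.memLp_of_restrict ((S.memLp_restrict u).comp_measurePreserving (S.measurePreserving_trans s))

lemma exists_eLpNorm_trans_le : ∃ C : ENNReal, C ≠ ⊤ ∧ ∀ (s : ℝ) (u : S.L2),
    eLpNorm (fun z => u (trans s z)) 2 S.wMeasure ≤ C * eLpNorm u 2 S.wMeasure := by
  obtain ⟨C, hC, hle⟩ := S.exists_wMeasure_le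
  obtain ⟨D, hD, hle'⟩ := S.exists_le_smul_wMeasure
  refine ⟨C ^ (1 / (2 : ENNReal)).toReal * D ^ (1 / (2 : ENNReal)).toReal,
    ENNReal.mul_ne_top (ENNReal.rpow_ne_top_of_nonneg ENNReal.toReal_nonneg hC)
      (ENNReal.rpow_ne_top_of_nonneg ENNReal.toReal_nonneg hD), fun s u => ?_⟩
  calc eLpNorm (fun z => u (trans s z)) 2 S.wMeasure
      ≤ C ^ (1 / (2 : ENNReal)).toReal *
        eLpNorm (fun z => u (trans s z)) 2 (volume.restrict S.G) :=
        eLpNorm_le_of_measure_le_smul hle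
    _ = C ^ (1 / (2 : ENNReal)).toReal * eLpNorm u 2 (volume.restrict S.G) := by
        congr 1
        exact eLpNorm_comp_measurePreserving (S.memLp_restrict u).1 (S.measurePreserving_trans s)
    _ ≤ C ^ (1 / (2 : ENNReal)).toReal *
        (D ^ (1 / (2 : ENNReal)).toReal * eLpNorm u 2 S.wMeasure) := by
        gcongr
        exact eLpNorm_le_of_measure_le_smul hle'
    _ = _ := by rw [mul_assoc]

lemma ae_trans {P : ℝ × ℝ → Prop} (s : ℝ) (h : ∀ᵐ z ∂S.wMeasure, P z) :
    ∀ᵐ z ∂S.wMeasure, P (trans s z) :=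
  ae_iff.2 ((S.measurePreserving_trans s).quasiMeasurePreserving.ae (ae_iff.1 h))

/-- Translation by `s` in the `ξ`-direction, on `L₂(G; h)`. -/
def shift (s : ℝ) : S.L2 →L[ℂ] S.L2 :=
  LinearMap.mkContinuousOfExistsBound
    { toFun := fun u => ((S.memLp_trans s u).toLp _)
      map_add' := fun u v => by
        refine Lp.ext ?_
        filter_upwards [(S.memLp_trans s (u + v)).coeFn_toLp, (S.memLp_trans s u).coeFn_toLp,
          (S.memLp_trans s v).coeFn_toLp, S.ae_trans s (Lp.coeFn_add u v),
          Lp.coeFn_add ((S.memLp_trans s u).toLp _) ((S.memLp_trans s v).toLp _)] with z h1 h2 h3 h4 h5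
        rw [h1, h5, Pi.add_apply, h2, h3, h4, Pi.add_apply]
      map_smul' := fun c u => by
        refine Lp.ext ?_
        filter_upwards [(S.memLp_trans s (c • u)).coeFn_toLp, (S.memLp_trans s u).coeFn_toLp,
          S.ae_trans s (Lp.coeFn_smul c u), Lp.coeFn_smul c ((S.memLp_trans s u).toLp _)]
          with z h1 h2 h4 h5
        rw [RingHom.id_apply, h1, h5, Pi.smul_apply, h2, h4, Pi.smul_apply] }
    (by
      obtain ⟨C, hC, h⟩ := S.exists_eLpNorm_trans_le
      refine ⟨C.toReal, fun u => ?_⟩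
      change ‖((S.memLp_trans s u).toLp _)‖ ≤ _
      rw [Lp.norm_toLp, Lp.norm_def, ← ENNReal.toReal_mul]
      exact ENNReal.toReal_mono (ENNReal.mul_ne_top hC (Lp.memLp u).2.ne) (h s u))

lemma coeFn_shift (s : ℝ) (u : S.L2) : S.shift s u =ᵐ[S.wMeasure] fun z => u (trans s z) :=
  (S.memLp_trans s u).coeFn_toLp

/-- Translation preserves Lebesgue measure but not the weight, which depends on ξ through `p`;
comparability of the measures still gives a bound uniform in `s`. -/
lemma exists_norm_shift_le : ∃ C : ℝ, 0 < C ∧ ∀ (s : ℝ) (u : S.L2), ‖S.shift s u‖ ≤ C * ‖u‖ := by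
  obtain ⟨C, hC, h⟩ := S.exists_eLpNorm_trans_le
  refine ⟨C.toReal + 1, by positivity, fun s u => ?_⟩
  have : ‖S.shift s u‖ ≤ C.toReal * ‖u‖ := by
    change ‖((S.memLp_trans s u).toLp _)‖ ≤ _
    rw [Lp.norm_toLp, Lp.norm_def, ← ENNReal.toReal_mul]
    exact ENNReal.toReal_mono (ENNReal.mul_ne_top hC (Lp.memLp u).2.ne) (h s u)
  nlinarith [norm_nonneg u]

lemma shift_neg_shift (s : ℝ) (u : S.L2) : S.shift s (S.shift (-s) u) = u := by
  refine Lp.ext ?_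
  filter_upwards [S.coeFn_shift s (S.shift (-s) u), S.ae_trans s (S.coeFn_shift (-s) u)]
    with z h1 h2
  rw [h1, h2]
  simp [trans]

/-- A change of variables moves the translation onto the coefficient, so pairings with a coefficient
depending on `η` only are invariant. -/
lemma wint_shift (a : ℝ × ℝ → ℝ) (s : ℝ) (u v : S.L2) :
    S.wint a (S.shift s u) (S.shift s v) = S.wint (fun z => a (trans (-s) z)) u v := by
  rw [wint, wint, ← (S.measurePreserving_trans s).integral_comp (measurableEmbedding_trans s)
    (fun z => (a (trans (-s) z) : ℂ) * u z * (starRingEnd ℂ) (v z))]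
  refine integral_congr_ae ?_
  filter_upwards [ae_iff.1 (S.coeFn_shift s u), ae_iff.1 (S.coeFn_shift s v)] with z h1 h2
  rw [h1, h2]
  simp [trans]

end

end ShelfStrip

namespace ShelfStrip

noncomputable section

variable (S : ShelfStrip)

/-! ### Jets of test functions -/

lemma memLp_of_compactSupport {f : ℝ × ℝ → ℂ} (hf : Continuous f) (hs : HasCompactSupport f) :
    MemLp f 2 S.wMeasure :=
  S.memLp_of_restrict (hf.memLp_of_hasCompactSupport hs)

lemma IsTest.continuous_fderiv {φ : ℝ × ℝ → ℂ} (hφ : IsTest φ) (e : ℝ × ℝ) :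
    Continuous fun z => fderiv ℝ φ z e :=
  (hφ.1.continuous_fderiv (by simp)).clm_apply continuous_const

/-- The jet of a test function. -/
def testJet {φ : ℝ × ℝ → ℂ} (hφ : IsTest φ) : S.L2 × S.L2 × S.L2 :=
  ((S.memLp_of_compactSupport hφ.1.continuous hφ.2.1).toLp _,
    (S.memLp_of_compactSupport (hφ.continuous_fderiv eξ) (hφ.2.1.fderiv_apply ℝ eξ)).toLp _,
    (S.memLp_of_compactSupport (hφ.continuous_fderiv eη) (hφ.2.1.fderiv_apply ℝ eη)).toLp _)

section testJet

variable {S} {φ : ℝ × ℝ → ℂ}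

lemma coeFn_testJet (hφ : IsTest φ) : (S.testJet hφ).1 =ᵐ[S.wMeasure] φ :=
  (S.memLp_of_compactSupport hφ.1.continuous hφ.2.1).coeFn_toLp

lemma coeFn_testJet_ξ (hφ : IsTest φ) :
    (S.testJet hφ).2.1 =ᵐ[S.wMeasure] fun z => fderiv ℝ φ z eξ :=
  (S.memLp_of_compactSupport (hφ.continuous_fderiv eξ) (hφ.2.1.fderiv_apply ℝ eξ)).coeFn_toLp

lemma coeFn_testJet_η (hφ : IsTest φ) :
    (S.testJet hφ).2.2 =ᵐ[S.wMeasure] fun z => fderiv ℝ φ z eη :=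
  (S.memLp_of_compactSupport (hφ.continuous_fderiv eη) (hφ.2.1.fderiv_apply ℝ eη)).coeFn_toLp

lemma testJet_mem (hφ : IsTest φ) : S.testJet hφ ∈ S.H10 :=
  S.testJets.le_topologicalClosure
    ⟨φ, hφ, coeFn_testJet hφ, coeFn_testJet_ξ hφ, coeFn_testJet_η hφ⟩

lemma isClosed_H10 : IsClosed (S.H10 : Set (S.L2 × S.L2 × S.L2)) :=
  S.testJets.isClosed_topologicalClosure

/-- Closed properties of elements of `H̃₀¹` may be checked on test functions. -/
lemma H10_induction {P : S.L2 × S.L2 × S.L2 → Prop} (hP : IsClosed {Ψ | P Ψ})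
    (h : ∀ φ (hφ : IsTest φ), P (S.testJet hφ)) {Ψ : S.L2 × S.L2 × S.L2} (hΨ : Ψ ∈ S.H10) :
    P Ψ := by
  refine closure_minimal (t := {Ψ | P Ψ}) ?_ hP hΨ
  rintro Ψ' ⟨φ, hφ, h1, h2, h3⟩
  have : Ψ' = S.testJet hφ := Prod.ext (Lp.ext (h1.trans (coeFn_testJet hφ).symm))
    (Prod.ext (Lp.ext (h2.trans (coeFn_testJet_ξ hφ).symm))
      (Lp.ext (h3.trans (coeFn_testJet_η hφ).symm)))
  rw [this]
  exact h φ hφ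

lemma IsTest.conj (hφ : IsTest φ) : IsTest fun z => (starRingEnd ℂ) (φ z) := by
  have h0 : (fun z => (starRingEnd ℂ) (φ z)) = Complex.conjCLE ∘ φ := rfl
  refine ⟨?_, ?_, ?_⟩
  · rw [h0]
    exact Complex.conjCLE.contDiff.comp hφ.1
  · exact hφ.2.1.comp_left (map_zero _)
  · refine (closure_mono fun z hz => ?_).trans hφ.2.2
    exact fun h => hz (by simp [h])

lemma IsTest.fderiv_conj (hφ : IsTest φ) (z e : ℝ × ℝ) :
    fderiv ℝ (fun z => (starRingEnd ℂ) (φ z)) z e = (starRingEnd ℂ) (fderiv ℝ φ z e) := by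
  have h := Complex.conjCLE.toContinuousLinearMap.hasFDerivAt.comp z
    (hφ.differentiableAt z).hasFDerivAt
  exact congrArg (fun T : ℝ × ℝ →L[ℝ] ℂ => T e) h.fderiv

end testJet

/-! ### Multipliers of `H̃₀¹` -/

variable {S} in
lemma mulOp_congr {a b : ℝ × ℝ → ℝ} (ha : S.BddCont a) (hb : S.BddCont b)
    (h : ∀ z ∈ S.G, a z = b z) (u : S.L2) : mulOp ha u = mulOp hb u := by
  refine Lp.ext ?_
  filter_upwards [coeFn_mulOp ha u, coeFn_mulOp hb u, S.ae_mem_G] with z h1 h2 hz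
  rw [h1, h2, h z hz]

/-- The coefficient `a`, with partial derivatives `aξ` and `aη`, is a multiplier of `H̃₀¹`. -/
structure IsMult (a aξ aη : ℝ × ℝ → ℝ) : Prop where
  bdd : S.BddCont a
  bdd_ξ : S.BddCont aξ
  bdd_η : S.BddCont aη
  mem : ∀ Ψ ∈ S.H10, (mulOp bdd Ψ.1, mulOp bdd Ψ.2.1 + mulOp bdd_ξ Ψ.1,
    mulOp bdd Ψ.2.2 + mulOp bdd_η Ψ.1) ∈ S.H10

section IsMult

variable {S} {a aξ aη b bξ bη : ℝ × ℝ → ℝ}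

lemma IsMult.congr (h : S.IsMult a aξ aη) (h1 : ∀ z ∈ S.G, b z = a z)
    (h2 : ∀ z ∈ S.G, bξ z = aξ z) (h3 : ∀ z ∈ S.G, bη z = aη z) : S.IsMult b bξ bη := by
  refine ⟨h.bdd.congr h1, h.bdd_ξ.congr h2, h.bdd_η.congr h3, fun Ψ hΨ => ?_⟩
  rw [mulOp_congr _ h.bdd h1, mulOp_congr _ h.bdd h1, mulOp_congr _ h.bdd h1,
    mulOp_congr _ h.bdd_ξ h2, mulOp_congr _ h.bdd_η h3]
  exact h.mem Ψ hΨ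

lemma IsMult.mul (ha : S.IsMult a aξ aη) (hb : S.IsMult b bξ bη) :
    S.IsMult (fun z => a z * b z) (fun z => a z * bξ z + aξ z * b z)
      (fun z => a z * bη z + aη z * b z) := by
  refine ⟨ha.bdd.mul hb.bdd, (ha.bdd.mul hb.bdd_ξ).add (ha.bdd_ξ.mul hb.bdd),
    (ha.bdd.mul hb.bdd_η).add (ha.bdd_η.mul hb.bdd), fun Ψ hΨ => ?_⟩
  have key : ∀ {c d e f : ℝ × ℝ → ℝ} (hc : S.BddCont c) (hd : S.BddCont d) (he : S.BddCont e)
      (hf : S.BddCont f) (u v : S.L2),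
      mulOp hc (mulOp hd u + mulOp he v) + mulOp hf (mulOp hd v) =
        mulOp (hc.mul hd) u + mulOp ((hc.mul he).add (hf.mul hd)) v := by
    intro c d e f hc hd he hf u v
    refine Lp.ext ?_
    filter_upwards [coeFn_mulOp hc (mulOp hd u + mulOp he v), coeFn_mulOp hf (mulOp hd v),
      coeFn_mulOp hd u, coeFn_mulOp he v, coeFn_mulOp hd v, coeFn_mulOp (hc.mul hd) u,
      coeFn_mulOp ((hc.mul he).add (hf.mul hd)) v, Lp.coeFn_add (mulOp hd u) (mulOp he v),
      Lp.coeFn_add (mulOp hc (mulOp hd u + mulOp he v)) (mulOp hf (mulOp hd v)),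
      Lp.coeFn_add (mulOp (hc.mul hd) u) (mulOp ((hc.mul he).add (hf.mul hd)) v)]
      with z h1 h2 h3 h4 h5 h6 h7 h8 h9 h10
    rw [h9, h10, Pi.add_apply, Pi.add_apply, h1, h2, h6, h7, h8, Pi.add_apply, h3, h4, h5]
    push_cast
    ring
  have key' : mulOp ha.bdd (mulOp hb.bdd Ψ.1) = mulOp (ha.bdd.mul hb.bdd) Ψ.1 := by
    refine Lp.ext ?_
    filter_upwards [coeFn_mulOp ha.bdd (mulOp hb.bdd Ψ.1), coeFn_mulOp hb.bdd Ψ.1,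
      coeFn_mulOp (ha.bdd.mul hb.bdd) Ψ.1] with z h1 h2 h3
    rw [h1, h2, h3]
    push_cast
    ring
  have := ha.mem _ (hb.mem Ψ hΨ)
  rwa [key, key, key'] at this

/-- Smooth coefficients are multipliers. -/
lemma isMult_of_contDiff (h : ContDiff ℝ (⊤ : ℕ∞) a) (ha : S.BddCont a)
    (hξ : S.BddCont fun z => fderiv ℝ a z eξ) (hη : S.BddCont fun z => fderiv ℝ a z eη) :
    S.IsMult a (fun z => fderiv ℝ a z eξ) (fun z => fderiv ℝ a z eη) := by
  refine ⟨ha, hξ, hη, fun Ψ hΨ => ?_⟩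
  refine H10_induction (P := fun Ψ => (mulOp ha Ψ.1, mulOp ha Ψ.2.1 + mulOp hξ Ψ.1,
    mulOp ha Ψ.2.2 + mulOp hη Ψ.1) ∈ S.H10) ?_ (fun φ hφ => ?_) hΨ
  · have h1 := continuous_fst (X := S.L2) (Y := S.L2 × S.L2)
    have h2 := continuous_snd (X := S.L2) (Y := S.L2 × S.L2)
    exact isClosed_H10.preimage (((mulOp ha).continuous.comp h1).prodMk
      ((((mulOp ha).continuous.comp (continuous_fst.comp h2)).add
        ((mulOp hξ).continuous.comp h1)).prodMk
        (((mulOp ha).continuous.comp (continuous_snd.comp h2)).add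
          ((mulOp hη).continuous.comp h1))))
  · have hd : ∀ z, fderiv ℝ (fun z => a z • φ z) z =
        a z • fderiv ℝ φ z + (fderiv ℝ a z).smulRight (φ z) := fun z =>
      fderiv_fun_smul (h.differentiable (by simp)).differentiableAt (hφ.differentiableAt z)
    have ht1 : ContDiff ℝ (⊤ : ℕ∞) fun z => a z • φ z := h.smul hφ.1
    have hsub : Function.support (fun z => a z • φ z) ⊆ Function.support φ := fun z hz h0 =>
      hz (by simp only [show φ z = 0 from h0, smul_zero])
    have ht : IsTest fun z => a z • φ z :=
      ⟨ht1, hφ.2.1.mono hsub, (closure_mono hsub).trans hφ.2.2⟩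
    refine S.testJets.le_topologicalClosure ⟨_, ht, ?_, ?_, ?_⟩
    · filter_upwards [coeFn_mulOp ha (S.testJet hφ).1, coeFn_testJet (S := S) hφ] with z h1 h2
      rw [h1, h2, Complex.real_smul]
    · filter_upwards [coeFn_mulOp ha (S.testJet hφ).2.1, coeFn_mulOp hξ (S.testJet hφ).1,
        coeFn_testJet (S := S) hφ, coeFn_testJet_ξ (S := S) hφ,
        Lp.coeFn_add (mulOp ha (S.testJet hφ).2.1) (mulOp hξ (S.testJet hφ).1)]
        with z h1 h2 h3 h4 h5
      rw [h5, Pi.add_apply, h1, h2, h3, h4, hd]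
      simp
    · filter_upwards [coeFn_mulOp ha (S.testJet hφ).2.2, coeFn_mulOp hη (S.testJet hφ).1,
        coeFn_testJet (S := S) hφ, coeFn_testJet_η (S := S) hφ,
        Lp.coeFn_add (mulOp ha (S.testJet hφ).2.2) (mulOp hη (S.testJet hφ).1)]
        with z h1 h2 h3 h4 h5
      rw [h5, Pi.add_apply, h1, h2, h3, h4, hd]
      simp

lemma tendsto_mulOp {an : ℕ → ℝ × ℝ → ℝ} (ha : S.BddCont a) (hn : ∀ n, S.BddCont (an n))
    {ε : ℕ → ℝ} (hε : Tendsto ε atTop (𝓝 0)) (h : ∀ n, ∀ z ∈ S.G, |an n z - a z| ≤ ε n)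
    (u : S.L2) : Tendsto (fun n => mulOp (hn n) u) atTop (𝓝 (mulOp ha u)) := by
  rw [tendsto_iff_norm_sub_tendsto_zero]
  exact squeeze_zero (fun _ => norm_nonneg _) (fun n => norm_mulOp_sub_le (hn n) ha (h n) u)
    (by simpa using hε.mul_const ‖u‖)

/-- Uniform limits of multipliers, in the sense of `C¹`, are multipliers. -/
lemma isMult_of_tendsto {an anξ anη : ℕ → ℝ × ℝ → ℝ} (hn : ∀ n, S.IsMult (an n) (anξ n) (anη n))
    (ha : S.BddCont a) (hξ : S.BddCont aξ) (hη : S.BddCont aη)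
    {ε : ℕ → ℝ} (hε : Tendsto ε atTop (𝓝 0)) (h : ∀ n, ∀ z ∈ S.G, |an n z - a z| ≤ ε n)
    (h' : ∀ n, ∀ z ∈ S.G, |anξ n z - aξ z| ≤ ε n) (h'' : ∀ n, ∀ z ∈ S.G, |anη n z - aη z| ≤ ε n) :
    S.IsMult a aξ aη := by
  refine ⟨ha, hξ, hη, fun Ψ hΨ => ?_⟩
  have t := fun u => tendsto_mulOp ha (fun n => (hn n).bdd) hε h u
  have t' := fun u => tendsto_mulOp hξ (fun n => (hn n).bdd_ξ) hε h' u
  have t'' := fun u => tendsto_mulOp hη (fun n => (hn n).bdd_η) hε h'' u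
  exact isClosed_H10.mem_of_tendsto ((t Ψ.1).prodMk_nhds
    (((t Ψ.2.1).add (t' Ψ.1)).prodMk_nhds ((t Ψ.2.2).add (t'' Ψ.1))))
    (.of_forall fun n => (hn n).mem Ψ hΨ)

end IsMult

/-- Approximation of a `C¹` function on a compact interval by smooth functions. -/
lemma exists_contDiff_approx {b b' : ℝ → ℝ} {c d : ℝ} (hcd : c ≤ d)
    (hb : ∀ x ∈ Icc c d, HasDerivWithinAt b (b' x) (Icc c d) x)
    (hb' : ContinuousOn b' (Icc c d)) {ε : ℝ} (hε : 0 < ε) :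
    ∃ F : ℝ → ℝ, ContDiff ℝ (⊤ : ℕ∞) F ∧
      ∀ x ∈ Icc c d, |F x - b x| ≤ ε ∧ |deriv F x - b' x| ≤ ε := by
  have hpos : 0 < 1 + (d - c) := by linarith
  -- The derivative is approximated by a polynomial, which is then integrated. The tolerance is
  -- divided by `1 + (d - c)` so that both the integrated error and the error of the derivative stay
  -- below `ε`.
  obtain ⟨q, hq⟩ := exists_polynomial_near_of_continuousOn c d b' hb' (ε / (1 + (d - c)))
    (by positivity)
  have hle : ε / (1 + (d - c)) ≤ ε := div_le_self hε.le (by linarith)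
  set F : ℝ → ℝ := fun x => b c + ∫ t in c..x, q.eval t with hF
  have hd : ∀ x, HasDerivAt F (q.eval x) x := fun x =>
    (intervalIntegral.integral_hasDerivAt_right (q.continuous.intervalIntegrable _ _)
      (q.continuous.stronglyMeasurableAtFilter _ _) q.continuous.continuousAt).const_add _
  have hder : deriv F = fun x => q.eval x := funext fun x => (hd x).deriv
  refine ⟨F, ?_, fun x hx => ⟨?_, ?_⟩⟩
  · refine contDiff_infty_iff_deriv.2 ⟨fun x => (hd x).differentiableAt, ?_⟩
    rw [hder]
    exact (Polynomial.contDiff_aeval q _)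
  · have h1 := (convex_Icc c d).norm_image_sub_le_of_norm_hasDerivWithin_le
      (f := fun x => F x - b x) (f' := fun x => q.eval x - b' x) (C := ε / (1 + (d - c)))
      (fun y hy => (hd y).hasDerivWithinAt.sub (hb y hy)) (fun y hy => (hq y hy).le)
      (left_mem_Icc.2 hcd) hx
    have h2 : F c - b c = 0 := by simp [hF]
    rw [h2, sub_zero, Real.norm_eq_abs, Real.norm_eq_abs, abs_of_nonneg (sub_nonneg.2 hx.1)] at h1
    refine h1.trans ?_
    rw [div_mul_eq_mul_div, div_le_iff₀ hpos]
    have := hx.2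
    gcongr
    linarith
  · rw [hder]
    exact (hq x hx).le.trans hle

variable {S} in
/-- Composition of a `C¹` function with a smooth coefficient is a multiplier. -/
lemma isMult_comp {s : ℝ × ℝ → ℝ} (hs : ContDiff ℝ (⊤ : ℕ∞) s)
    (hξ : S.BddCont fun z => fderiv ℝ s z eξ) (hη : S.BddCont fun z => fderiv ℝ s z eη)
    {b b' : ℝ → ℝ} {c d : ℝ} (hcd : c ≤ d) (hsG : ∀ z ∈ S.G, s z ∈ Icc c d)
    (hb : ∀ x ∈ Icc c d, HasDerivWithinAt b (b' x) (Icc c d) x)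
    (hb' : ContinuousOn b' (Icc c d)) :
    S.IsMult (fun z => b (s z)) (fun z => b' (s z) * fderiv ℝ s z eξ)
      (fun z => b' (s z) * fderiv ℝ s z eη) := by
  have hcomp : ∀ {f : ℝ → ℝ}, ContinuousOn f (Icc c d) → S.BddCont fun z => f (s z) := by
    intro f hf
    obtain ⟨C, hC⟩ := isCompact_Icc.exists_bound_of_continuousOn hf
    exact ⟨hf.comp hs.continuous.continuousOn hsG, C, fun z hz => hC _ (hsG z hz)⟩
  choose F hF hFb using fun n : ℕ =>
    exists_contDiff_approx hcd hb hb' (Nat.one_div_pos_of_nat (α := ℝ) (n := n))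
  obtain ⟨C, hC⟩ := hξ.bdd
  obtain ⟨D, hD⟩ := hη.bdd
  have hfd : ∀ n z, fderiv ℝ (fun z => F n (s z)) z = deriv (F n) (s z) • fderiv ℝ s z :=
    fun n z => (((hF n).differentiable (by simp) (s z)).hasDerivAt.comp_hasFDerivAt z
      (hs.differentiable (by simp) z).hasFDerivAt).fderiv
  have hFc : ∀ n, ContinuousOn (F n) (Icc c d) := fun n => (hF n).continuous.continuousOn
  have hFd : ∀ n, ContinuousOn (deriv (F n)) (Icc c d) := fun n =>
    ((hF n).continuous_deriv (by simp)).continuousOn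
  refine isMult_of_tendsto (an := fun n z => F n (s z))
    (anξ := fun n z => deriv (F n) (s z) * fderiv ℝ s z eξ)
    (anη := fun n z => deriv (F n) (s z) * fderiv ℝ s z eη)
    -- The factor dominates 1 and the bounds `C`, `D` of the derivatives of `s`, so one null
    -- sequence serves for the function and both derivatives.
    (ε := fun n => 1 / ((n : ℝ) + 1) * (1 + |C| + |D|)) (fun n => ?_)
    (hcomp fun x hx => (hb x hx).continuousWithinAt) ((hcomp hb').mul hξ) ((hcomp hb').mul hη)
    ?_ ?_ ?_ ?_
  · refine (isMult_of_contDiff ((hF n).comp hs) (hcomp (hFc n))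
      (((hcomp (hFd n)).mul hξ).congr fun z _ => ?_)
      (((hcomp (hFd n)).mul hη).congr fun z _ => ?_)).congr (fun z _ => rfl) (fun z _ => ?_)
      (fun z _ => ?_)
    all_goals
      have := hfd n z
      simp only [Function.comp_def]
      rw [this]
      rfl
  · simpa using tendsto_one_div_add_atTop_nhds_zero_nat.mul_const (1 + |C| + |D|)
  · intro n z hz
    refine ((hFb n _ (hsG z hz)).1).trans (le_mul_of_one_le_right (by positivity) ?_)
    linarith [abs_nonneg C, abs_nonneg D]
  · intro n z hz
    rw [← sub_mul, abs_mul]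
    refine mul_le_mul (hFb n _ (hsG z hz)).2 ?_ (abs_nonneg _) (by positivity)
    linarith [abs_nonneg C, abs_nonneg D, hC z hz, le_abs_self C]
  · intro n z hz
    rw [← sub_mul, abs_mul]
    refine mul_le_mul (hFb n _ (hsG z hz)).2 ?_ (abs_nonneg _) (by positivity)
    linarith [abs_nonneg C, abs_nonneg D, hD z hz, le_abs_self D]

lemma fderiv_snd_eξ (z : ℝ × ℝ) : fderiv ℝ (Prod.snd : ℝ × ℝ → ℝ) z eξ = 0 := by
  rw [fderiv_snd]; rfl

lemma fderiv_snd_eη (z : ℝ × ℝ) : fderiv ℝ (Prod.snd : ℝ × ℝ → ℝ) z eη = 1 := by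
  rw [fderiv_snd]; rfl

/-- `C¹` functions of `η` are multipliers. -/
lemma isMult_snd {b b' : ℝ → ℝ}
    (hb : ∀ x ∈ Icc 0 S.δ, HasDerivWithinAt b (b' x) (Icc 0 S.δ) x)
    (hb' : ContinuousOn b' (Icc 0 S.δ)) :
    S.IsMult (fun z => b z.2) (fun _ => 0) (fun z => b' z.2) := by
  refine (isMult_comp (s := Prod.snd) contDiff_snd ((bddCont_const 0).congr fun z _ =>
    fderiv_snd_eξ z) ((bddCont_const 1).congr fun z _ => fderiv_snd_eη z) S.δ_pos.le
    (fun z hz => ⟨hz.1.le, hz.2.le⟩) hb hb').congr (fun _ _ => rfl) (fun z _ => ?_) (fun z _ => ?_)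
  · rw [fderiv_snd_eξ, mul_zero]
  · rw [fderiv_snd_eη, mul_one]

lemma hasDerivWithinAt_β {x : ℝ} (hx : x ∈ Icc 0 S.δ) :
    HasDerivWithinAt S.β (derivWithin S.β (Icc 0 S.δ) x) (Icc 0 S.δ) x :=
  ((S.β_contDiffOn.differentiableOn (by simp)) x hx).hasDerivWithinAt

lemma isMult_exp : S.IsMult (fun z => Real.exp (S.β z.2)) (fun _ => 0)
    (fun z => Real.exp (S.β z.2) * S.β' z) :=
  (S.isMult_snd (b := fun η => Real.exp (S.β η)) (fun _ hx => (S.hasDerivWithinAt_β hx).exp)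
    (S.β_contDiffOn.continuousOn.rexp.mul S.continuousOn_derivWithin_β)).congr (fun _ _ => rfl)
    (fun _ _ => rfl) (fun z hz => by rw [S.derivWithin_β hz])

lemma isMult_exp_neg : S.IsMult (fun z => Real.exp (-S.β z.2)) (fun _ => 0)
    (fun z => Real.exp (-S.β z.2) * -S.β' z) :=
  (S.isMult_snd (b := fun η => Real.exp (-S.β η)) (fun _ hx => (S.hasDerivWithinAt_β hx).neg.exp)
    (S.β_contDiffOn.continuousOn.neg.rexp.mul S.continuousOn_derivWithin_β.neg)).congr
    (fun _ _ => rfl) (fun _ _ => rfl) (fun z hz => by rw [S.derivWithin_β hz]; rfl)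

lemma hasFDerivAt_snd_mul_γ (z : ℝ × ℝ) : HasFDerivAt (fun z : ℝ × ℝ => z.2 * S.γ z.1)
    (z.2 • (deriv S.γ z.1 • ContinuousLinearMap.fst ℝ ℝ ℝ) +
      S.γ z.1 • ContinuousLinearMap.snd ℝ ℝ ℝ) z :=
  hasFDerivAt_snd.mul ((S.differentiable_γ z.1).hasDerivAt.comp_hasFDerivAt z hasFDerivAt_fst)

/-- On the strip, ηγ(ξ) takes values in [-A, A]; this reduces `p` and `1 / p` to the functions 1 + x
and 1/(1 + x) on that interval. -/
lemma isMult_comp_snd_mul_γ {b b' : ℝ → ℝ} {A : ℝ} (hA : 0 ≤ A) (hγ : ∀ x, |S.γ x| ≤ A / S.δ)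
    (hb : ∀ x ∈ Icc (-A) A, HasDerivWithinAt b (b' x) (Icc (-A) A) x)
    (hb' : ContinuousOn b' (Icc (-A) A)) :
    S.IsMult (fun z => b (z.2 * S.γ z.1)) (fun z => b' (z.2 * S.γ z.1) * S.pξ z)
      (fun z => b' (z.2 * S.γ z.1) * S.pη z) := by
  have e1 : ∀ z, fderiv ℝ (fun z : ℝ × ℝ => z.2 * S.γ z.1) z eξ = S.pξ z := fun z => by
    rw [(S.hasFDerivAt_snd_mul_γ z).fderiv]
    simp [eξ, pξ]
  have e2 : ∀ z, fderiv ℝ (fun z : ℝ × ℝ => z.2 * S.γ z.1) z eη = S.pη z := fun z => by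
    rw [(S.hasFDerivAt_snd_mul_γ z).fderiv]
    simp [eη, pη]
  refine (isMult_comp (s := fun z => z.2 * S.γ z.1)
    (contDiff_snd.mul (S.γ_smooth.comp contDiff_fst)) (S.bddCont_pξ.congr fun z _ => e1 z)
    (S.bddCont_pη.congr fun z _ => e2 z) (by linarith) (fun z hz => ?_) hb hb').congr
    (fun _ _ => rfl) (fun z _ => by rw [e1]) (fun z _ => by rw [e2])
  refine abs_le.1 ?_
  rw [abs_mul]
  calc |z.2| * |S.γ z.1| ≤ S.δ * (A / S.δ) :=
        mul_le_mul (S.abs_le_δ hz) (hγ _) (abs_nonneg _) S.δ_pos.le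
    _ = A := by have := S.δ_pos; field_simp

lemma isMult_p : S.IsMult S.p S.pξ S.pη := by
  obtain ⟨A, hA, -, hγ⟩ := S.γ_bound
  exact (S.isMult_comp_snd_mul_γ (b := fun x => 1 + x) (b' := fun _ => 1) hA hγ
    (fun x _ => ((hasDerivAt_id x).const_add 1).hasDerivWithinAt) continuousOn_const).congr
    (fun _ _ => rfl) (fun z _ => (one_mul _).symm) (fun z _ => (one_mul _).symm)

lemma isMult_p_inv : S.IsMult (fun z => 1 / S.p z) (fun z => -(S.pξ z / S.p z ^ 2))
    (fun z => -(S.pη z / S.p z ^ 2)) := by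
  obtain ⟨A, hA, hA1, hγ⟩ := S.γ_bound
  have hne : ∀ x ∈ Icc (-A) A, 1 + x ≠ 0 := fun x hx => by linarith [hx.1]
  refine (S.isMult_comp_snd_mul_γ (b := fun x => (1 + x)⁻¹) (b' := fun x => -1 / (1 + x) ^ 2) hA hγ
    (fun x hx => (((hasDerivAt_id x).const_add 1).inv (hne x hx)).hasDerivWithinAt)
    (continuousOn_const.div ((continuousOn_const.add continuousOn_id).pow 2)
      fun x hx => pow_ne_zero 2 (hne x hx))).congr
    (fun _ _ => one_div _) (fun z _ => ?_) (fun z _ => ?_)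
  · rw [p]; ring
  · rw [p]; ring

variable {S} in
lemma re_wint {a : ℝ × ℝ → ℝ} (ha : S.BddCont a) (u v : S.L2) :
    (S.wint a u v).re = ∫ z in S.G, ((a z : ℂ) * u z * (starRingEnd ℂ) (v z)).re :=
  (integral_re (𝕜 := ℂ) (ha.integrable u v)).symm

/-! ### Integration by parts -/

/-- Cut-offs in `η` alone commute with ∂/∂ξ, so they remove the boundary from integrations by parts
in the `ξ`-direction without producing error terms. -/
lemma exists_cutoff : ∃ χ : ℕ → ℝ → ℝ, (∀ n, ContDiff ℝ (⊤ : ℕ∞) (χ n)) ∧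
    (∀ n, tsupport (χ n) ⊆ Ioo 0 S.δ) ∧ (∀ n x, |χ n x| ≤ 1) ∧
    ∀ x ∈ Ioo 0 S.δ, Tendsto (fun n => χ n x) atTop (𝓝 1) := by
  have hδ := S.δ_pos
  have hpos : ∀ n : ℕ, (0 : ℝ) < (n : ℝ) + 1 := fun n => by positivity
  let B : (n : ℕ) → ContDiffBump (S.δ / 2) := fun n =>
    { rIn := S.δ / 2 * (1 - 1 / ((n : ℝ) + 2))
      rOut := S.δ / 2 * (1 - 1 / ((n : ℝ) + 3))
      rIn_pos := by
        have : 1 / ((n : ℝ) + 2) < 1 := by rw [div_lt_one (by positivity)]; linarith [hpos n]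
        have : 0 < 1 - 1 / ((n : ℝ) + 2) := by linarith
        positivity
      rIn_lt_rOut := by
        have : 1 / ((n : ℝ) + 3) < 1 / ((n : ℝ) + 2) :=
          one_div_lt_one_div_of_lt (by positivity) (by linarith)
        gcongr }
  refine ⟨fun n => B n, fun n => (B n).contDiff, fun n => ?_, fun n x => ?_, fun x hx => ?_⟩
  · rw [(B n).tsupport_eq]
    intro x hx
    rw [Metric.mem_closedBall, Real.dist_eq, abs_le] at hx
    have h3 : 0 < S.δ / 2 * (1 / ((n : ℝ) + 3)) := by positivity
    have h4 : (B n).rOut = S.δ / 2 * (1 - 1 / ((n : ℝ) + 3)) := rfl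
    rw [h4, mul_sub, mul_one] at hx
    constructor <;> linarith [hx.1, hx.2]
  · rw [abs_of_nonneg (B n).nonneg]
    exact (B n).le_one
  · have ht : Tendsto (fun n : ℕ => S.δ / 2 * (1 - 1 / ((n : ℝ) + 2))) atTop (𝓝 (S.δ / 2)) := by
      have h1 : Tendsto (fun n : ℕ => 1 / ((n : ℝ) + 2)) atTop (𝓝 0) := by
        have := (tendsto_add_atTop_iff_nat 1).2 (tendsto_one_div_add_atTop_nhds_zero_nat (𝕜 := ℝ))
        refine this.congr fun n => ?_
        push_cast
        ring
      simpa using (h1.const_sub 1).const_mul (S.δ / 2)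
    have hx' : |x - S.δ / 2| < S.δ / 2 := by
      rw [abs_lt]
      constructor <;> linarith [hx.1, hx.2]
    refine tendsto_const_nhds.congr' ?_
    filter_upwards [ht.eventually_const_lt hx'] with n hn
    refine ((B n).one_of_mem_closedBall ?_).symm
    rw [Metric.mem_closedBall, Real.dist_eq]
    exact hn.le

section ibp

variable {S} {g g' : S.L2}

/-- The weak `ξ`-derivative may be tested against functions which do not vanish near the
boundary. -/
lemma HasWeakDeriv.integral_real (h : S.HasWeakDeriv eξ g g') {φ : ℝ × ℝ → ℝ}
    (hφ : ContDiff ℝ (⊤ : ℕ∞) φ) (hs : HasCompactSupport φ) :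
    ∫ z in S.G, fderiv ℝ φ z eξ • g z = - ∫ z in S.G, φ z • g' z := by
  obtain ⟨χ, hχ, hsupp, hbd, hlim⟩ := S.exists_cutoff
  have hd : Continuous fun z => fderiv ℝ φ z eξ :=
    (hφ.continuous_fderiv (by simp)).clm_apply continuous_const
  have hds : HasCompactSupport fun z => fderiv ℝ φ z eξ := hs.fderiv_apply ℝ eξ
  have hfd : ∀ n z, fderiv ℝ (fun z => χ n z.2 * φ z) z eξ = χ n z.2 * fderiv ℝ φ z eξ := by
    intro n z
    have h1 : HasFDerivAt (fun z : ℝ × ℝ => χ n z.2)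
        (deriv (χ n) z.2 • ContinuousLinearMap.snd ℝ ℝ ℝ) z :=
      ((hχ n).differentiable (by simp) z.2).hasDerivAt.comp_hasFDerivAt z hasFDerivAt_snd
    have h2 : HasFDerivAt (fun z => χ n z.2 * φ z) _ z :=
      h1.mul (hφ.differentiable (by simp) z).hasFDerivAt
    rw [h2.fderiv]
    simp [eξ]
  have hn : ∀ n, ∫ z in S.G, (χ n z.2 * fderiv ℝ φ z eξ) • g z =
      - ∫ z in S.G, (χ n z.2 * φ z) • g' z := by
    intro n
    have := h (fun z => χ n z.2 * φ z) (((hχ n).comp contDiff_snd).mul hφ) hs.mul_left ?_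
    · simpa only [hfd] using this
    · refine (tsupport_mul_subset_left (f := fun z : ℝ × ℝ => χ n z.2) (g := φ)).trans ?_
      exact (tsupport_comp_subset_preimage (χ n) continuous_snd).trans
        (fun z hz => hsupp n hz)
  have hdc : ∀ {ψ : ℝ × ℝ → ℝ}, Continuous ψ → HasCompactSupport ψ → ∀ u : S.L2,
      Tendsto (fun n => ∫ z in S.G, (χ n z.2 * ψ z) • u z) atTop
        (𝓝 (∫ z in S.G, ψ z • u z)) := by
    intro ψ hψ hψs u
    refine tendsto_integral_of_dominated_convergence (fun z => ‖ψ z • u z‖) (fun n => ?_)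
      (S.integrable_smul u hψ hψs).norm (fun n => .of_forall fun z => ?_) ?_
    · exact ((((hχ n).continuous.comp continuous_snd).mul hψ).aestronglyMeasurable).smul
        (S.memLp_restrict u).1
    · rw [norm_smul, norm_smul, norm_mul]
      refine mul_le_mul_of_nonneg_right ?_ (norm_nonneg _)
      exact mul_le_of_le_one_left (norm_nonneg _) (hbd n z.2)
    · filter_upwards [ae_restrict_mem S.isOpen_G.measurableSet] with z hz
      simpa using ((hlim z.2 ⟨hz.1, hz.2⟩).mul_const (ψ z)).smul_const (u z)
  exact tendsto_nhds_unique ((hdc hd hds g).congr hn) (hdc hφ.continuous hs g').neg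

lemma HasWeakDeriv.integral_test (h : S.HasWeakDeriv eξ g g') {φ : ℝ × ℝ → ℂ} (hφ : IsTest φ) :
    ∫ z in S.G, g z * fderiv ℝ φ z eξ = - ∫ z in S.G, g' z * φ z := by
  have hre : ContDiff ℝ (⊤ : ℕ∞) fun z => (φ z).re := Complex.reCLM.contDiff.comp hφ.1
  have him : ContDiff ℝ (⊤ : ℕ∞) fun z => (φ z).im := Complex.imCLM.contDiff.comp hφ.1
  have hres : HasCompactSupport fun z => (φ z).re := hφ.2.1.comp_left Complex.zero_re
  have hims : HasCompactSupport fun z => (φ z).im := hφ.2.1.comp_left Complex.zero_im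
  have hred : ∀ z, fderiv ℝ (fun z => (φ z).re) z eξ = (fderiv ℝ φ z eξ).re := fun z =>
    congrArg (fun T : ℝ × ℝ →L[ℝ] ℝ => T eξ)
      (Complex.reCLM.hasFDerivAt.comp z (hφ.differentiableAt z).hasFDerivAt).fderiv
  have himd : ∀ z, fderiv ℝ (fun z => (φ z).im) z eξ = (fderiv ℝ φ z eξ).im := fun z =>
    congrArg (fun T : ℝ × ℝ →L[ℝ] ℝ => T eξ)
      (Complex.imCLM.hasFDerivAt.comp z (hφ.differentiableAt z).hasFDerivAt).fderiv
  have key : ∀ (ψ : ℝ × ℝ → ℂ) (u : S.L2), Continuous ψ → HasCompactSupport ψ →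
      ∫ z in S.G, u z * ψ z = (∫ z in S.G, (ψ z).re • u z) +
        Complex.I * ∫ z in S.G, (ψ z).im • u z := by
    intro ψ u hψ hψs
    have i1 : Integrable (fun z => (ψ z).re • u z) (volume.restrict S.G) :=
      S.integrable_smul u (Complex.continuous_re.comp hψ) (hψs.comp_left Complex.zero_re)
    have i2 : Integrable (fun z => (ψ z).im • u z) (volume.restrict S.G) :=
      S.integrable_smul u (Complex.continuous_im.comp hψ) (hψs.comp_left Complex.zero_im)
    rw [← integral_const_mul, ← integral_add i1 (i2.const_mul _)]
    refine integral_congr_ae (.of_forall fun z => ?_)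
    simp only [Complex.real_smul]
    conv_lhs => rw [← Complex.re_add_im (ψ z)]
    ring
  have e1 := h.integral_real hre hres
  have e2 := h.integral_real him hims
  simp only [hred, himd] at e1 e2
  rw [key _ _ (hφ.continuous_fderiv eξ) (hφ.2.1.fderiv_apply ℝ eξ), key _ _ hφ.1.continuous hφ.2.1,
    e1, e2]
  ring

/-- Integration by parts in the `ξ`-direction. -/
lemma HasWeakDeriv.wint_eq (h : S.HasWeakDeriv eξ g g') {Ψ : S.L2 × S.L2 × S.L2}
    (hΨ : Ψ ∈ S.H10) : S.wint (fun _ => 1) g Ψ.2.1 = -S.wint (fun _ => 1) g' Ψ.1 := by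
  have h1 : S.BddCont fun _ => 1 := bddCont_const 1
  refine H10_induction (P := fun Ψ => S.wint (fun _ => 1) g Ψ.2.1 =
    -S.wint (fun _ => 1) g' Ψ.1) (isClosed_eq
      ((continuous_wint_right h1 g).comp (continuous_fst.comp continuous_snd))
      ((continuous_wint_right h1 g').comp continuous_fst).neg) (fun φ hφ => ?_) hΨ
  have := h.integral_test hφ.conj
  simp only [hφ.fderiv_conj] at this
  rw [wint, wint]
  convert this using 1
  · refine integral_congr_ae ?_
    filter_upwards [ae_iff.1 (coeFn_testJet_ξ (S := S) hφ)] with z hz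
    rw [hz, Complex.ofReal_one, one_mul]
  · congr 1
    refine integral_congr_ae ?_
    filter_upwards [ae_iff.1 (coeFn_testJet (S := S) hφ)] with z hz
    rw [hz, Complex.ofReal_one, one_mul]

/-- Integration by parts in the `ξ`-direction, with a coefficient depending on `η` only. -/
lemma wint_snd_eq_neg {c : ℝ → ℝ} (hc : ContinuousOn c (Icc 0 S.δ)) {Ψ Φ : S.L2 × S.L2 × S.L2}
    (hΨ : Ψ ∈ S.H10) (hΦ : Φ ∈ S.H10) :
    S.wint (fun z => c z.2) Ψ.2.1 Φ.1 = -S.wint (fun z => c z.2) Ψ.1 Φ.2.1 := by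
  -- The coefficient is merely continuous, hence perhaps no multiplier; polynomials in `η` are, with
  -- zero `ξ`-derivative, and approximate it uniformly.
  choose q hq using fun n : ℕ => exists_polynomial_near_of_continuousOn 0 S.δ c hc
    (1 / ((n : ℝ) + 1)) Nat.one_div_pos_of_nat
  have hqb : ∀ n, S.BddCont fun z => (q n).eval z.2 := fun n =>
    bddCont_of_Icc (q n).continuous.continuousOn
  have key : ∀ n, S.wint (fun z => (q n).eval z.2) Ψ.2.1 Φ.1 =
      -S.wint (fun z => (q n).eval z.2) Ψ.1 Φ.2.1 := by
    intro n
    have hm := S.isMult_snd (b := fun x => (q n).eval x)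
      (b' := fun x => (Polynomial.derivative (q n)).eval x)
      (fun x _ => ((q n).hasDerivAt x).hasDerivWithinAt)
      (Polynomial.derivative (q n)).continuous.continuousOn
    have h1 : S.BddCont fun _ => 1 := bddCont_const 1
    have := (S.hasWeakDeriv_of_mem_H10 hΨ).1.wint_eq (hm.mem Φ hΦ)
    simp only [wint_add_right h1, wint_mulOp_right, one_mul] at this
    have h0 : S.wint (fun _ => 0) Ψ.1 Φ.1 = 0 := by simp [wint]
    rw [h0, add_zero] at this
    rw [this, neg_neg]
  have hb : ∀ n, ∀ z ∈ S.G, |(q n).eval z.2 - c z.2| ≤ 1 / ((n : ℝ) + 1) := fun n z hz =>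
    (hq n z.2 ⟨hz.1.le, hz.2.le⟩).le
  have t := fun u v => tendsto_wint_coeff (bddCont_of_Icc hc) hqb
    tendsto_one_div_add_atTop_nhds_zero_nat hb u v
  exact tendsto_nhds_unique ((t Ψ.2.1 Φ.1).congr key) (t Ψ.1 Φ.2.1).neg

end ibp

/-! ### The Poincaré inequality -/

lemma G_eq_prod : S.G = (univ : Set ℝ) ×ˢ Ioo 0 S.δ := by
  ext z
  simp [G]

/-- A `η`-derivative of a function vanishing on the boundary has integral zero. -/
lemma integral_η_deriv_eq_zero {H K : ℝ × ℝ → ℝ} (hK : Continuous K) (hs : HasCompactSupport K)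
    (hd : ∀ x y, HasDerivAt (fun t => H (x, t)) (K (x, y)) y) (h0 : ∀ x, H (x, 0) = 0)
    (hδ : ∀ x, H (x, S.δ) = 0) : ∫ z in S.G, K z = 0 := by
  have hint : IntegrableOn K ((univ : Set ℝ) ×ˢ Ioo 0 S.δ) (volume.prod volume) :=
    (hK.integrable_of_hasCompactSupport hs).integrableOn
  rw [G_eq_prod, Measure.volume_eq_prod, setIntegral_prod _ hint]
  refine (setIntegral_congr_fun MeasurableSet.univ fun x _ => ?_).trans (integral_zero _ _)
  rw [← integral_Ioc_eq_integral_Ioo, ← intervalIntegral.integral_of_le S.δ_pos.le,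
    intervalIntegral.integral_eq_sub_of_hasDerivAt (f := fun t => H (x, t)) (fun y _ => hd x y)
      ((hK.comp (Continuous.prodMk_right x)).intervalIntegrable _ _), h0, hδ, sub_zero]

/-- Integrate the η-derivative of (η - δ)|φ|²: the boundary terms vanish at η = 0 because of φ and
at η = δ because of the factor. -/
lemma IsTest.poincare_identity {φ : ℝ × ℝ → ℂ} (hφ : IsTest φ) :
    (S.wint (fun _ => 1) (S.testJet hφ).1 (S.testJet hφ).1).re =
      -2 * (S.wint (fun z => z.2 - S.δ) (S.testJet hφ).2.2 (S.testJet hφ).1).re := by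
  set K1 : ℝ × ℝ → ℝ := fun z => ‖φ z‖ ^ 2 with hK1
  set K2 : ℝ × ℝ → ℝ := fun z => (z.2 - S.δ) * (fderiv ℝ φ z eη * (starRingEnd ℂ) (φ z)).re with hK2
  have hc1 : Continuous K1 := (hφ.1.continuous.norm.pow 2)
  have hc2 : Continuous K2 := (continuous_snd.sub continuous_const).mul
    (Complex.continuous_re.comp ((hφ.continuous_fderiv eη).mul
      (Complex.continuous_conj.comp hφ.1.continuous)))
  have hs1 : HasCompactSupport K1 := hφ.2.1.comp_left (g := fun x : ℂ => ‖x‖ ^ 2) (by simp)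
  have hs2 : HasCompactSupport K2 := by
    refine hφ.2.1.mono fun z hz h0 => hz ?_
    simp [hK2, show φ z = 0 from h0]
  have hder : ∀ x y, HasDerivAt (fun t => φ (x, t)) (fderiv ℝ φ (x, y) eη) y := fun x y => by
    have h1 : HasDerivAt (fun t : ℝ => (x, t)) (0, 1) y :=
      (hasDerivAt_const y x).prodMk (hasDerivAt_id y)
    exact (hφ.differentiableAt (x, y)).hasFDerivAt.comp_hasDerivAt y h1
  have h0 : ∀ x, φ (x, 0) = 0 := fun x =>
    image_eq_zero_of_notMem_tsupport fun h => lt_irrefl (0 : ℝ) (hφ.2.2 h)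
  have key := S.integral_η_deriv_eq_zero (H := fun z => (z.2 - S.δ) * ‖φ z‖ ^ 2)
    (K := fun z => K1 z + 2 * K2 z) (hc1.add (continuous_const.mul hc2)) (hs1.add hs2.mul_left)
    (fun x y => ?_) (fun x => by simp [h0]) (fun x => by simp)
  · rw [integral_add (hc1.integrable_of_hasCompactSupport hs1).integrableOn
      ((hc2.integrable_of_hasCompactSupport hs2).const_mul 2).integrableOn,
      integral_const_mul] at key
    have e1 : (S.wint (fun _ => 1) (S.testJet hφ).1 (S.testJet hφ).1).re = ∫ z in S.G, K1 z := by
      have : S.wint (fun _ => 1) (S.testJet hφ).1 (S.testJet hφ).1 =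
          ((∫ z in S.G, K1 z : ℝ) : ℂ) := by
        rw [wint, ← integral_complex_ofReal]
        refine integral_congr_ae ?_
        filter_upwards [ae_iff.1 (coeFn_testJet (S := S) hφ)] with z hz
        rw [hz, Complex.ofReal_one, one_mul, Complex.mul_conj']
        simp only [hK1, Complex.ofReal_pow]
      rw [this, Complex.ofReal_re]
    have e2 : (S.wint (fun z => z.2 - S.δ) (S.testJet hφ).2.2 (S.testJet hφ).1).re =
        ∫ z in S.G, K2 z := by
      have hb : S.BddCont fun z => z.2 - S.δ := S.bddCont_snd.sub (bddCont_const S.δ)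
      rw [re_wint hb]
      refine integral_congr_ae ?_
      filter_upwards [ae_iff.1 (coeFn_testJet (S := S) hφ),
        ae_iff.1 (coeFn_testJet_η (S := S) hφ)] with z hz hz'
      rw [hz, hz', mul_assoc]
      exact Complex.re_ofReal_mul _ _
    rw [e1, e2]
    linarith
  · have h1 := ((hasDerivAt_id y).sub_const S.δ).mul (hder x y).norm_sq
    refine h1.congr_deriv ?_
    simp only [hK1, hK2, Complex.inner, id]
    rw [mul_comm (fderiv ℝ φ (x, y) eη)]
    ring

/-- The identity and Cauchy–Schwarz bound the square of the norm by a product containing the norm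
once; this form is closed under limits of jets, and the common factor is divided out at the end. -/
lemma exists_poincare : ∃ C : ℝ, 0 ≤ C ∧ ∀ Ψ ∈ S.H10, ‖Ψ.1‖ ≤ C * ‖Ψ.2.2‖ := by
  obtain ⟨C, hC0, hC⟩ := S.exists_norm_wint_le
  obtain ⟨W, hW⟩ := S.bddCont_w.bdd
  have hW0 : 0 ≤ |W| := abs_nonneg W
  have hδ := S.δ_pos
  refine ⟨|W| * (2 * (S.δ * C)), by positivity, fun Ψ hΨ => ?_⟩
  have key : ‖Ψ.1‖ ^ 2 ≤ |W| * (2 * (S.δ * C)) * ‖Ψ.2.2‖ * ‖Ψ.1‖ := by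
    refine H10_induction (P := fun Ψ => ‖Ψ.1‖ ^ 2 ≤ |W| * (2 * (S.δ * C)) * ‖Ψ.2.2‖ * ‖Ψ.1‖)
      (isClosed_le (by fun_prop) (by fun_prop)) (fun φ hφ => ?_) hΨ
    set u := (S.testJet hφ).1 with hu
    set v := (S.testJet hφ).2.2 with hv
    have h1 : ‖u‖ ^ 2 = (S.wint S.w u u).re := by
      rw [← inner_eq_wint, inner_self_eq_norm_sq_to_K]
      norm_cast
    have h2 : (S.wint S.w u u).re ≤ |W| * (S.wint (fun _ => 1) u u).re := by
      have hb1 : S.BddCont fun _ => 1 := bddCont_const 1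
      rw [re_wint S.bddCont_w, re_wint hb1, ← integral_const_mul]
      refine integral_mono_ae (S.bddCont_w.integrable _ _).re
        ((hb1.integrable _ _).re.const_mul _) ?_
      filter_upwards [ae_restrict_mem S.isOpen_G.measurableSet] with z hz
      have e : ∀ a : ℝ, ((a : ℂ) * u z * (starRingEnd ℂ) (u z)).re = a * ‖u z‖ ^ 2 := by
        intro a
        rw [mul_assoc, Complex.mul_conj']
        norm_cast
      simp only [e]
      rw [one_mul]
      exact mul_le_mul_of_nonneg_right ((le_abs_self _).trans ((hW z hz).trans (le_abs_self W)))
        (by positivity)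
    have h3 : (S.wint (fun _ => 1) u u).re ≤ 2 * (S.δ * (C * (‖v‖ * ‖u‖))) := by
      rw [hu, IsTest.poincare_identity S hφ]
      have h4 := hC (fun z => z.2 - S.δ) S.δ (fun z hz => by
        rw [abs_le]; constructor <;> linarith [hz.1, hz.2]) v u
      have h5 := (abs_le.1 (Complex.abs_re_le_norm (S.wint (fun z => z.2 - S.δ) v u))).1
      linarith
    calc ‖u‖ ^ 2 ≤ |W| * (2 * (S.δ * (C * (‖v‖ * ‖u‖)))) := by
          rw [h1]; exact h2.trans (mul_le_mul_of_nonneg_left h3 hW0)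
      _ = _ := by ring
  by_cases h0 : ‖Ψ.1‖ = 0
  · rw [h0]; positivity
  · have : 0 < ‖Ψ.1‖ := lt_of_le_of_ne (norm_nonneg _) (Ne.symm h0)
    rw [sq] at key
    exact le_of_mul_le_mul_right key this

end

end ShelfStrip

/-- Bounded sequences in a Hilbert space have weak limits along an ultrafilter. -/
lemma exists_weak_limit_of_bounded {E : Type*} [NormedAddCommGroup E] [InnerProductSpace ℂ E]
    [CompleteSpace E] {x : ℕ → E} {C : ℝ} (hx : ∀ n, ‖x n‖ ≤ C) :
    ∃ y, ∀ l : E →L[ℂ] ℂ, Tendsto (fun n => l (x n)) (hyperfilter ℕ : Filter ℕ) (𝓝 (l y)) := by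
  let f : ℕ → WeakDual ℂ E := fun n =>
    StrongDual.toWeakDual (InnerProductSpace.toDual ℂ E (x n))
  -- Banach–Alaoglu, with the space identified with its dual by Riesz; the ultrafilter replaces the
  -- choice of a subsequence.
  have hcomp := WeakDual.isCompact_closedBall (𝕜 := ℂ) (0 : StrongDual ℂ E) C
  obtain ⟨g, -, hg⟩ := hcomp.ultrafilter_le_nhds ((hyperfilter ℕ).map f) (by
    rw [le_principal_iff, Ultrafilter.mem_coe, Ultrafilter.mem_map]
    refine Filter.univ_mem' fun n => ?_
    change InnerProductSpace.toDual ℂ E (x n) ∈ Metric.closedBall 0 C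
    rw [mem_closedBall_zero_iff, LinearIsometryEquiv.norm_map]
    exact hx n)
  refine ⟨(InnerProductSpace.toDual ℂ E).symm (WeakDual.toStrongDual g), fun l => ?_⟩
  obtain ⟨v, rfl⟩ := (InnerProductSpace.toDual ℂ E).surjective l
  have h1 : Tendsto (fun n => f n v) (hyperfilter ℕ : Filter ℕ) (𝓝 (g v)) :=
    ((WeakDual.eval_continuous v).tendsto g).comp hg
  have h2 := (Complex.continuous_conj.tendsto _).comp h1
  refine Tendsto.congr (fun n => ?_) (h2.trans (le_of_eq ?_))
  · change (starRingEnd ℂ) (inner ℂ (x n) v) = inner ℂ v (x n)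
    rw [inner_conj_symm]
  · congr 1
    rw [InnerProductSpace.toDual_apply_apply, ← inner_conj_symm,
      InnerProductSpace.toDual_symm_apply]
    rfl

namespace ShelfStrip

noncomputable section

variable (S : ShelfStrip)

/-! ### The energy form and the energy space -/

/-- The coefficient `exp (-β) / p`. -/
def κ (z : ℝ × ℝ) : ℝ := Real.exp (-S.β z.2) * (1 / S.p z)

lemma bddCont_κ : S.BddCont S.κ := S.bddCont_exp_neg.mul S.bddCont_p_inv

/-- The sesquilinear form of `𝓛_γ`. -/
def lSesq (Ψ Φ : S.L2 × S.L2 × S.L2) : ℂ :=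
  S.wint S.κ Ψ.2.1 Φ.2.1 + S.wint S.w Ψ.2.2 Φ.2.2

/-- The gradient map from `H̃₀¹`. -/
def grad : S.H10 →L[ℂ] WithLp 2 (S.L2 × S.L2) :=
  (WithLp.prodContinuousLinearEquiv 2 ℂ S.L2 S.L2).symm.toContinuousLinearMap ∘L
    ((mulOp S.bddCont_p_inv ∘L ContinuousLinearMap.fst ℂ S.L2 S.L2 ∘L
        ContinuousLinearMap.snd ℂ S.L2 (S.L2 × S.L2)).prod
      (ContinuousLinearMap.snd ℂ S.L2 S.L2 ∘L ContinuousLinearMap.snd ℂ S.L2 (S.L2 × S.L2))) ∘L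
    S.H10.subtypeL

lemma grad_apply (Ψ : S.H10) :
    S.grad Ψ = WithLp.toLp 2 (mulOp S.bddCont_p_inv Ψ.1.2.1, Ψ.1.2.2) := rfl

/-- The factor `1 / p` in the first component of `grad` turns the weight `w` into `w / p² = κ`. -/
lemma inner_grad (Ψ Φ : S.H10) : inner ℂ (S.grad Φ) (S.grad Ψ) = S.lSesq Ψ.1 Φ.1 := by
  rw [grad_apply, grad_apply, WithLp.prod_inner_apply, lSesq, inner_eq_wint, inner_eq_wint,
    wint_mulOp_left, wint_mulOp_right]
  congr 1
  refine wint_congr (fun z hz => ?_) _ _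
  have := (S.p_pos hz).ne'
  simp only [w, κ]
  field_simp

lemma norm_grad_sq (Ψ : S.H10) : ((‖S.grad Ψ‖ ^ 2 : ℝ) : ℂ) = S.lSesq Ψ.1 Ψ.1 := by
  rw [← inner_grad, inner_self_eq_norm_sq_to_K]
  push_cast
  rfl

/-- The Poincaré inequality controls the function and boundedness of `p` controls its
`ξ`-derivative. This closes the range of `grad` and so makes the energy space complete. -/
lemma exists_norm_le_grad : ∃ C : ℝ, 0 < C ∧ ∀ Ψ : S.H10, ‖Ψ‖ ≤ C * ‖S.grad Ψ‖ := by
  obtain ⟨C, hC, hP⟩ := S.exists_poincare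
  obtain ⟨D, hD⟩ := S.bddCont_p.bdd
  refine ⟨C + |D| + 1, by positivity, fun Ψ => ?_⟩
  have hη : ‖Ψ.1.2.2‖ ≤ ‖S.grad Ψ‖ := WithLp.norm_snd_le _ (S.grad Ψ)
  have hξ' : ‖mulOp S.bddCont_p_inv Ψ.1.2.1‖ ≤ ‖S.grad Ψ‖ := WithLp.norm_fst_le _ (S.grad Ψ)
  have hξ : ‖Ψ.1.2.1‖ ≤ |D| * ‖S.grad Ψ‖ := by
    have e : Ψ.1.2.1 = mulOp S.bddCont_p (mulOp S.bddCont_p_inv Ψ.1.2.1) := by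
      refine Lp.ext ?_
      filter_upwards [coeFn_mulOp S.bddCont_p (mulOp S.bddCont_p_inv Ψ.1.2.1),
        coeFn_mulOp S.bddCont_p_inv Ψ.1.2.1, S.ae_mem_G] with z h1 h2 hz
      have : (S.p z : ℂ) ≠ 0 := by exact_mod_cast (S.p_pos hz).ne'
      rw [h1, h2]
      push_cast
      field_simp
    calc ‖Ψ.1.2.1‖ = ‖mulOp S.bddCont_p (mulOp S.bddCont_p_inv Ψ.1.2.1)‖ := by rw [← e]
      _ ≤ |D| * ‖mulOp S.bddCont_p_inv Ψ.1.2.1‖ :=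
        norm_mulOp_le _ (fun z hz => (hD z hz).trans (le_abs_self D)) _
      _ ≤ _ := by gcongr
  have h0 : ‖Ψ.1.1‖ ≤ C * ‖S.grad Ψ‖ :=
    (hP Ψ.1 Ψ.2).trans (mul_le_mul_of_nonneg_left hη hC)
  have hg := norm_nonneg (S.grad Ψ)
  have hD0 := abs_nonneg D
  change ‖Ψ.1‖ ≤ _
  rw [Prod.norm_def, Prod.norm_def]
  refine max_le ?_ (max_le ?_ ?_) <;> nlinarith

instance : CompleteSpace S.H10 := isClosed_H10.completeSpace_coe

lemma exists_antilipschitz_grad : ∃ C, AntilipschitzWith C S.grad := by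
  obtain ⟨C, hC, h⟩ := S.exists_norm_le_grad
  refine ⟨C.toNNReal, AddMonoidHomClass.antilipschitz_of_bound S.grad fun Ψ => ?_⟩
  rw [Real.coe_toNNReal _ hC.le]
  exact h Ψ

lemma grad_injective : Function.Injective S.grad :=
  S.exists_antilipschitz_grad.choose_spec.injective

lemma isClosed_range_grad : IsClosed (Set.range S.grad) :=
  S.exists_antilipschitz_grad.choose_spec.isClosed_range S.grad.uniformContinuous

/-- The energy space: gradients of elements of `H̃₀¹`. It is `H̃₀¹` with the form of `𝓛_γ` as
inner product. -/
abbrev Energy : Type := LinearMap.range (S.grad : S.H10 →ₗ[ℂ] WithLp 2 (S.L2 × S.L2))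

instance : CompleteSpace S.Energy := S.isClosed_range_grad.completeSpace_coe

/-- The identification of `H̃₀¹` with the energy space. -/
def toEnergy : S.H10 ≃L[ℂ] S.Energy := S.grad.equivRange S.grad_injective S.isClosed_range_grad

lemma inner_toEnergy (Ψ Φ : S.H10) :
    inner ℂ (S.toEnergy Φ) (S.toEnergy Ψ) = S.lSesq Ψ.1 Φ.1 := S.inner_grad Ψ Φ

/-- `Ψ` solves `𝓛_γ Ψ = f` in the weak sense. -/
def IsWeakSol (Ψ : S.L2 × S.L2 × S.L2) (f : S.L2) : Prop :=
  ∀ Φ ∈ S.H10, S.lSesq Ψ Φ = S.wint S.w f Φ.1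

/-! ### Translations of jets -/

/-- Translation of a jet. -/
def shiftJet (s : ℝ) (Ψ : S.L2 × S.L2 × S.L2) : S.L2 × S.L2 × S.L2 :=
  (S.shift s Ψ.1, S.shift s Ψ.2.1, S.shift s Ψ.2.2)

lemma IsTest.trans {φ : ℝ × ℝ → ℂ} (hφ : IsTest φ) (s : ℝ) :
    IsTest fun z => φ (ShelfStrip.trans s z) := by
  have hh : IsHomeomorph (ShelfStrip.trans s) := by
    rw [trans_eq]
    exact (Homeomorph.addRight ((s, 0) : ℝ × ℝ)).isHomeomorph
  refine ⟨?_, ?_, ?_⟩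
  · rw [trans_eq]
    exact hφ.1.comp (contDiff_id.add contDiff_const)
  · exact hφ.2.1.comp_homeomorph hh.homeomorph
  · refine (tsupport_comp_subset_preimage φ hh.continuous).trans fun z hz => ?_
    have h : ShelfStrip.trans s z ∈ tsupport φ := hz
    have h' := hφ.2.2 h
    exact h'

lemma fderiv_comp_trans (φ : ℝ × ℝ → ℂ) (s : ℝ) (z : ℝ × ℝ) :
    fderiv ℝ (fun z => φ (trans s z)) z = fderiv ℝ φ (trans s z) := by
  rw [trans_eq]
  exact fderiv_comp_add_right _

lemma shiftJet_testJet {φ : ℝ × ℝ → ℂ} (hφ : IsTest φ) (s : ℝ) :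
    S.shiftJet s (S.testJet hφ) = S.testJet (hφ.trans s) := by
  refine Prod.ext (Lp.ext ?_) (Prod.ext (Lp.ext ?_) (Lp.ext ?_))
  · filter_upwards [S.coeFn_shift s (S.testJet hφ).1, S.ae_trans s (coeFn_testJet (S := S) hφ),
      coeFn_testJet (S := S) (hφ.trans s)] with z h1 h2 h3
    rw [h3, ← h2]
    exact h1
  · filter_upwards [S.coeFn_shift s (S.testJet hφ).2.1,
      S.ae_trans s (coeFn_testJet_ξ (S := S) hφ),
      coeFn_testJet_ξ (S := S) (hφ.trans s)] with z h1 h2 h3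
    rw [h3, fderiv_comp_trans, ← h2]
    exact h1
  · filter_upwards [S.coeFn_shift s (S.testJet hφ).2.2,
      S.ae_trans s (coeFn_testJet_η (S := S) hφ),
      coeFn_testJet_η (S := S) (hφ.trans s)] with z h1 h2 h3
    rw [h3, fderiv_comp_trans, ← h2]
    exact h1

lemma shiftJet_mem {Ψ : S.L2 × S.L2 × S.L2} (hΨ : Ψ ∈ S.H10) (s : ℝ) :
    S.shiftJet s Ψ ∈ S.H10 := by
  refine H10_induction (P := fun Ψ => S.shiftJet s Ψ ∈ S.H10) ?_ (fun φ hφ => ?_) hΨ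
  · have h := (S.shift s).continuous
    exact isClosed_H10.preimage ((h.comp continuous_fst).prodMk
      ((h.comp (continuous_fst.comp continuous_snd)).prodMk
        (h.comp (continuous_snd.comp continuous_snd))))
  · rw [shiftJet_testJet]
    exact testJet_mem _

variable {S} in
lemma BddCont.comp_trans {a : ℝ × ℝ → ℝ} (ha : S.BddCont a) (s : ℝ) :
    S.BddCont fun z => a (trans s z) := by
  obtain ⟨C, hC⟩ := ha.bdd
  refine ⟨ha.cont.comp (Continuous.continuousOn ?_) fun z hz => hz, C, fun z hz => hC _ hz⟩
  rw [trans_eq]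
  fun_prop

lemma exists_lipschitz_p : ∃ C : ℝ, 0 ≤ C ∧ ∀ s, ∀ z ∈ S.G, |S.p (trans s z) - S.p z| ≤ C * |s| := by
  obtain ⟨C, hC⟩ := S.exists_bound_deriv_γ
  have hC0 : 0 ≤ C := (abs_nonneg _).trans (hC 0)
  refine ⟨S.δ * C, mul_nonneg S.δ_pos.le hC0, fun s z hz => ?_⟩
  have h1 := convex_univ.norm_image_sub_le_of_norm_deriv_le (f := S.γ) (C := C)
    (fun x _ => S.differentiable_γ x) (fun x _ => hC x) (mem_univ z.1) (mem_univ (z.1 + s))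
  rw [add_sub_cancel_left, Real.norm_eq_abs, Real.norm_eq_abs] at h1
  have h2 : S.p (trans s z) - S.p z = z.2 * (S.γ (z.1 + s) - S.γ z.1) := by
    simp only [p, trans]; ring
  rw [h2, abs_mul, mul_assoc]
  exact mul_le_mul (S.abs_le_δ hz) h1 (abs_nonneg _) S.δ_pos.le

lemma exists_lipschitz_coeff : ∃ C : ℝ, 0 ≤ C ∧ ∀ s, ∀ z ∈ S.G,
    |S.κ (trans s z) - S.κ z| ≤ C * |s| ∧ |S.w (trans s z) - S.w z| ≤ C * |s| := by
  obtain ⟨C, hC0, hC⟩ := S.exists_lipschitz_p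
  obtain ⟨B, hB⟩ := S.bddCont_exp_neg.bdd
  obtain ⟨D, hD⟩ := S.bddCont_p_inv.bdd
  refine ⟨|B| * (|D| * C * |D|) + |B| * C, by positivity, fun s z hz => ⟨?_, ?_⟩⟩
  · have hz' : trans s z ∈ S.G := hz
    have h0 := (S.p_pos hz).ne'
    have h0' := (S.p_pos hz').ne'
    have h1 : S.κ (trans s z) - S.κ z = Real.exp (-S.β z.2) *
        ((1 / S.p (trans s z)) * -(S.p (trans s z) - S.p z) * (1 / S.p z)) := by
      have : (trans s z).2 = z.2 := rfl
      simp only [κ, this]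
      field_simp
      ring
    rw [h1, abs_mul, abs_mul, abs_mul, abs_neg]
    calc _ ≤ |B| * (|D| * (C * |s|) * |D|) :=
          mul_le_mul ((hB z hz).trans (le_abs_self B)) (mul_le_mul (mul_le_mul
            ((hD _ hz').trans (le_abs_self D)) (hC s z hz) (abs_nonneg _) (abs_nonneg _))
            ((hD _ hz).trans (le_abs_self D)) (abs_nonneg _) (by positivity)) (by positivity)
            (abs_nonneg _)
      _ ≤ _ := by
        have : 0 ≤ |B| * C * |s| := by positivity
        nlinarith
  · have h1 : S.w (trans s z) - S.w z = Real.exp (-S.β z.2) * (S.p (trans s z) - S.p z) := by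
      have : (trans s z).2 = z.2 := rfl
      simp only [w, this]
      ring
    rw [h1, abs_mul]
    calc _ ≤ |B| * (C * |s|) :=
          mul_le_mul ((hB z hz).trans (le_abs_self B)) (hC s z hz) (abs_nonneg _) (abs_nonneg _)
      _ ≤ _ := by
        have : 0 ≤ |B| * (|D| * C * |D|) * |s| := by positivity
        nlinarith

/-- The energy form is almost translation invariant. -/
lemma exists_lSesq_shiftJet_sub_le : ∃ C : ℝ, 0 ≤ C ∧ ∀ (s : ℝ) (Ψ Φ : S.L2 × S.L2 × S.L2),
    ‖S.lSesq (S.shiftJet s Ψ) (S.shiftJet s Φ) - S.lSesq Ψ Φ‖ ≤ C * |s| * ‖Ψ‖ * ‖Φ‖ := by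
  obtain ⟨L, hL0, hL⟩ := S.exists_lipschitz_coeff
  obtain ⟨C, hC0, hC⟩ := S.exists_norm_wint_le
  refine ⟨2 * (L * C), by positivity, fun s Ψ Φ => ?_⟩
  have e : S.lSesq (S.shiftJet s Ψ) (S.shiftJet s Φ) - S.lSesq Ψ Φ =
      S.wint (fun z => S.κ (trans (-s) z) - S.κ z) Ψ.2.1 Φ.2.1 +
      S.wint (fun z => S.w (trans (-s) z) - S.w z) Ψ.2.2 Φ.2.2 := by
    rw [wint_sub_coeff (S.bddCont_κ.comp_trans _) S.bddCont_κ,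
      wint_sub_coeff (S.bddCont_w.comp_trans _) S.bddCont_w]
    simp only [lSesq, shiftJet, wint_shift]
    ring
  have h1 := hC (fun z => S.κ (trans (-s) z) - S.κ z) (L * |s|) (fun z hz => by
    simpa using (hL (-s) z hz).1) Ψ.2.1 Φ.2.1
  have h2 := hC (fun z => S.w (trans (-s) z) - S.w z) (L * |s|) (fun z hz => by
    simpa using (hL (-s) z hz).2) Ψ.2.2 Φ.2.2
  have n1 : ‖Ψ.2.1‖ ≤ ‖Ψ‖ := (norm_fst_le Ψ.2).trans (norm_snd_le Ψ)
  have n2 : ‖Ψ.2.2‖ ≤ ‖Ψ‖ := (norm_snd_le Ψ.2).trans (norm_snd_le Ψ)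
  have n3 : ‖Φ.2.1‖ ≤ ‖Φ‖ := (norm_fst_le Φ.2).trans (norm_snd_le Φ)
  have n4 : ‖Φ.2.2‖ ≤ ‖Φ‖ := (norm_snd_le Φ.2).trans (norm_snd_le Φ)
  rw [e]
  calc _ ≤ _ := norm_add_le _ _
    _ ≤ _ := add_le_add h1 h2
    _ ≤ L * |s| * (C * (‖Ψ‖ * ‖Φ‖)) + L * |s| * (C * (‖Ψ‖ * ‖Φ‖)) := by gcongr
    _ = _ := by ring

lemma shift_zero (u : S.L2) : S.shift 0 u = u := by
  refine Lp.ext ?_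
  filter_upwards [S.coeFn_shift 0 u] with z h
  rw [h]
  simp [trans]

/-- Differentiation of pairings with translated test functions. -/
lemma hasDerivAt_wint_shift {a : ℝ × ℝ → ℝ} (ha : S.BddCont a) (u : S.L2) {φ : ℝ × ℝ → ℂ}
    (hφ : IsTest φ) (s : ℝ) : HasDerivAt (fun t => S.wint a u (S.shift t (S.testJet hφ).1))
      (S.wint a u (S.shift s (S.testJet hφ).2.1)) s := by
  set ψ : ℝ × ℝ → ℂ := fun z => fderiv ℝ φ z eξ with hψ
  have hψc : Continuous ψ := hφ.continuous_fderiv eξ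
  have hψs : HasCompactSupport ψ := hφ.2.1.fderiv_apply ℝ eξ
  obtain ⟨C, hC⟩ := hψs.exists_bound_of_continuous hψc
  -- A compact set containing the supports of all translates of `ψ` by `t` with `|t - s| < 1`; its
  -- indicator provides the dominating function.
  set K : Set (ℝ × ℝ) := (fun q : ℝ × (ℝ × ℝ) => trans (-q.1) q.2) ''
    (Metric.closedBall s 1 ×ˢ tsupport ψ) with hK
  have hKc : IsCompact K := ((isCompact_closedBall s 1).prod hψs).image (by
    unfold trans; fun_prop)
  have hmem : ∀ t ∈ Metric.ball s 1, ∀ z, ψ (trans t z) ≠ 0 → z ∈ K := by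
    intro t ht z hz
    refine ⟨(t, trans t z), ⟨Metric.ball_subset_closedBall ht, subset_tsupport _ hz⟩, ?_⟩
    simp [trans]
  set au : S.L2 := mulOp ha u with hau
  have hw : ∀ (t : ℝ) (f : ℝ × ℝ → ℂ) (v : S.L2), v =ᵐ[S.wMeasure] f →
      S.wint a u (S.shift t v) = ∫ z in S.G, au z * (starRingEnd ℂ) (f (trans t z)) := by
    intro t f v hv
    refine integral_congr_ae ?_
    filter_upwards [ae_iff.1 (S.coeFn_shift t v), ae_iff.1 (S.ae_trans t hv),
      ae_iff.1 (coeFn_mulOp ha u)] with z h1 h2 h3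
    rw [h1, h2, h3]
  have e1 : (fun t => S.wint a u (S.shift t (S.testJet hφ).1)) =
      fun t => ∫ z in S.G, au z * (starRingEnd ℂ) (φ (trans t z)) :=
    funext fun t => hw t φ _ (coeFn_testJet hφ)
  rw [e1, hw s ψ _ (coeFn_testJet_ξ hφ)]
  have hmeas : ∀ f : ℝ × ℝ → ℂ, Continuous f → ∀ t, AEStronglyMeasurable
      (fun z => au z * (starRingEnd ℂ) (f (trans t z))) (volume.restrict S.G) := by
    intro f hf t
    refine (S.memLp_restrict au).1.mul (Continuous.aestronglyMeasurable ?_)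
    refine Complex.continuous_conj.comp (hf.comp ?_)
    rw [trans_eq]
    fun_prop
  refine (hasDerivAt_integral_of_dominated_loc_of_deriv_le (Metric.ball_mem_nhds s one_pos)
    (F' := fun t z => au z * (starRingEnd ℂ) (ψ (trans t z)))
    (bound := fun z => ‖au z‖ * K.indicator (fun _ => C) z)
    (.of_forall fun t => hmeas φ hφ.1.continuous t) ?_ (hmeas ψ hψc s) ?_ ?_ ?_).2
  · refine S.integrable_mul au (φ := fun z => (starRingEnd ℂ) (φ (trans s z))) ?_ ?_
    · exact (hφ.trans s).conj.1.continuous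
    · exact (hφ.trans s).conj.2.1
  · refine .of_forall fun z t ht => ?_
    rw [norm_mul, RCLike.norm_conj]
    refine mul_le_mul_of_nonneg_left ?_ (norm_nonneg _)
    by_cases h0 : ψ (trans t z) = 0
    · rw [h0, norm_zero]
      exact indicator_nonneg (fun _ _ => (norm_nonneg _).trans (hC 0)) z
    · rw [indicator_of_mem (hmem t ht z h0)]
      exact hC _
  · have hind : MemLp (K.indicator fun _ => C) 2 (volume.restrict S.G) :=
      memLp_indicator_const 2 hKc.measurableSet C
        (Or.inr (ne_top_of_le_ne_top hKc.measure_lt_top.ne (Measure.restrict_le_self K)))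
    exact (S.memLp_restrict au).norm.integrable_mul hind
  · refine .of_forall fun z t _ => ?_
    have h1 : HasDerivAt (fun t => trans t z) eξ t := by
      refine HasDerivAt.prodMk ?_ (hasDerivAt_const _ _)
      exact (hasDerivAt_id t).const_add z.1
    have h2 := (hφ.differentiableAt (trans t z)).hasFDerivAt.comp_hasDerivAt t h1
    exact (h2.star).const_mul (au z)

/-- Translation is Lipschitz in a weak sense on `H̃₀¹`. -/
lemma exists_wint_shift_sub_le : ∃ C : ℝ, 0 ≤ C ∧ ∀ (s : ℝ) (f : S.L2), ∀ Φ ∈ S.H10,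
    ‖S.wint S.w f (S.shift s Φ.1 - Φ.1)‖ ≤ C * ‖f‖ * ‖Φ.2.1‖ * |s| := by
  obtain ⟨C, hC0, hC⟩ := S.exists_norm_wint_le
  obtain ⟨D, hD0, hD⟩ := S.exists_norm_shift_le
  obtain ⟨W, hW⟩ := S.bddCont_w.bdd
  have hW' : ∀ z ∈ S.G, |S.w z| ≤ |W| := fun z hz => (hW z hz).trans (le_abs_self W)
  refine ⟨|W| * C * D, by positivity, fun s f Φ hΦ => ?_⟩
  refine H10_induction (P := fun Φ => ‖S.wint S.w f (S.shift s Φ.1 - Φ.1)‖ ≤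
    |W| * C * D * ‖f‖ * ‖Φ.2.1‖ * |s|) (isClosed_le ?_ (by fun_prop)) (fun φ hφ => ?_) hΦ
  · exact ((continuous_wint_right S.bddCont_w f).comp
      (((S.shift s).continuous.comp continuous_fst).sub continuous_fst)).norm
  · have h1 := convex_univ.norm_image_sub_le_of_norm_hasDerivWithin_le
      (f := fun t => S.wint S.w f (S.shift t (S.testJet hφ).1))
      (f' := fun t => S.wint S.w f (S.shift t (S.testJet hφ).2.1))
      (C := |W| * C * D * ‖f‖ * ‖(S.testJet hφ).2.1‖)
      (fun t _ => (S.hasDerivAt_wint_shift S.bddCont_w f hφ t).hasDerivWithinAt)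
      (fun t _ => (hC S.w |W| hW' f _).trans ?_) (mem_univ 0) (mem_univ s)
    · rw [S.shift_zero, sub_zero, ← wint_sub_right S.bddCont_w] at h1
      exact h1
    · calc |W| * (C * (‖f‖ * ‖S.shift t (S.testJet hφ).2.1‖))
          ≤ |W| * (C * (‖f‖ * (D * ‖(S.testJet hφ).2.1‖))) := by gcongr; exact hD _ _
        _ = _ := by ring

variable {S}

lemma lSesq_sub_left (Ψ Ψ' Φ : S.L2 × S.L2 × S.L2) :
    S.lSesq (Ψ - Ψ') Φ = S.lSesq Ψ Φ - S.lSesq Ψ' Φ := by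
  simp only [lSesq, Prod.snd_sub, Prod.fst_sub, wint_sub_left S.bddCont_κ,
    wint_sub_left S.bddCont_w]
  ring

lemma shiftJet_neg_shiftJet (s : ℝ) (Ψ : S.L2 × S.L2 × S.L2) :
    S.shiftJet s (S.shiftJet (-s) Ψ) = Ψ := by
  simp only [shiftJet, shift_neg_shift]

/-- The translates of a weak solution form a Lipschitz family in `H̃₀¹`. -/
lemma IsWeakSol.exists_norm_shiftJet_sub_le {Ψ : S.L2 × S.L2 × S.L2} (hΨ : Ψ ∈ S.H10) {f : S.L2}
    (h : S.IsWeakSol Ψ f) : ∃ C : ℝ, ∀ s, ‖S.shiftJet s Ψ - Ψ‖ ≤ C * |s| := by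
  obtain ⟨C1, hC1, h1⟩ := S.exists_lSesq_shiftJet_sub_le
  obtain ⟨C2, hC2, h2⟩ := S.exists_wint_shift_sub_le
  obtain ⟨C3, hC3, h3⟩ := S.exists_norm_le_grad
  obtain ⟨D, hD0, hD⟩ := S.exists_norm_shift_le
  refine ⟨C3 ^ 2 * (D * (C1 * ‖Ψ‖ + C2 * ‖f‖)), fun s => ?_⟩
  have hd : S.shiftJet s Ψ - Ψ ∈ S.H10 := S.H10.sub_mem (S.shiftJet_mem hΨ s) hΨ
  set d := S.shiftJet s Ψ - Ψ with hdef
  set v := S.shiftJet (-s) d with hv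
  have hvm : v ∈ S.H10 := S.shiftJet_mem hd (-s)
  have hsv : S.shiftJet s v = d := shiftJet_neg_shiftJet s d
  have hvn : ‖v‖ ≤ D * ‖d‖ := by
    have m1 : ‖d.1‖ ≤ ‖d‖ := norm_fst_le d
    have m2 : ‖d.2.1‖ ≤ ‖d‖ := (norm_fst_le d.2).trans (norm_snd_le d)
    have m3 : ‖d.2.2‖ ≤ ‖d‖ := (norm_snd_le d.2).trans (norm_snd_le d)
    rw [Prod.norm_def, Prod.norm_def]
    refine max_le ?_ (max_le ?_ ?_)
    · exact (hD _ _).trans (by gcongr)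
    · exact (hD _ _).trans (by gcongr)
    · exact (hD _ _).trans (by gcongr)
  -- The increment `d` is tested against itself. Written as the translate of `v`, it splits the
  -- energy into the commutator of form and translation and a term in which the weak equation
  -- replaces the form by `f`; both are O(|s|).
  have e1 : S.lSesq d d = (S.lSesq (S.shiftJet s Ψ) (S.shiftJet s v) - S.lSesq Ψ v) -
      S.wint S.w f (S.shift s v.1 - v.1) := by
    have h4 : S.lSesq Ψ d = S.wint S.w f (S.shift s v.1) := by
      rw [h d hd]
      exact congrArg (fun x => S.wint S.w f x.1) hsv.symm
    rw [wint_sub_right S.bddCont_w, ← h v hvm, ← h4, hsv, hdef, lSesq_sub_left]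
    ring
  have e2 : ‖S.grad ⟨d, hd⟩‖ ^ 2 = ‖S.lSesq d d‖ := by
    have := S.norm_grad_sq ⟨d, hd⟩
    rw [← this, Complex.norm_real, Real.norm_of_nonneg (by positivity)]
  have e3 : ‖S.lSesq d d‖ ≤ (C1 * ‖Ψ‖ + C2 * ‖f‖) * |s| * ‖v‖ := by
    rw [e1]
    have n1 : ‖v.2.1‖ ≤ ‖v‖ := (norm_fst_le v.2).trans (norm_snd_le v)
    calc _ ≤ _ := norm_sub_le _ _
      _ ≤ _ := add_le_add (h1 s Ψ v) (h2 s f v hvm)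
      _ ≤ C1 * |s| * ‖Ψ‖ * ‖v‖ + C2 * ‖f‖ * ‖v‖ * |s| := by gcongr
      _ = _ := by ring
  have e4 : ‖d‖ ≤ C3 * ‖S.grad ⟨d, hd⟩‖ := h3 ⟨d, hd⟩
  have e5 : ‖d‖ ^ 2 ≤ C3 ^ 2 * ((C1 * ‖Ψ‖ + C2 * ‖f‖) * |s| * (D * ‖d‖)) := by
    calc ‖d‖ ^ 2 ≤ (C3 * ‖S.grad ⟨d, hd⟩‖) ^ 2 := by gcongr
      _ = C3 ^ 2 * ‖S.lSesq d d‖ := by rw [mul_pow, e2]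
      _ ≤ C3 ^ 2 * ((C1 * ‖Ψ‖ + C2 * ‖f‖) * |s| * ‖v‖) := by gcongr
      _ ≤ _ := by gcongr
  by_cases h0 : ‖d‖ = 0
  · rw [h0]; positivity
  · have : 0 < ‖d‖ := lt_of_le_of_ne (norm_nonneg _) (Ne.symm h0)
    refine le_of_mul_le_mul_right ?_ this
    calc ‖d‖ * ‖d‖ = ‖d‖ ^ 2 := (sq _).symm
      _ ≤ _ := e5
      _ = _ := by ring

lemma HasWeakDeriv.unique {e : ℝ × ℝ} {u v v' : S.L2} (h : S.HasWeakDeriv e u v)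
    (h' : S.HasWeakDeriv e u v') : v = v' := by
  have := h.add (h'.smul (-1))
  rw [neg_one_smul, neg_one_smul, add_neg_cancel, ← sub_eq_add_neg] at this
  exact sub_eq_zero.1 this.eq_zero

/-- A real test function with support in the open strip, as a complex test function. -/
lemma isTest_ofReal {φ : ℝ × ℝ → ℝ} (hφ : ContDiff ℝ (⊤ : ℕ∞) φ) (hs : HasCompactSupport φ)
    (hG : tsupport φ ⊆ S.G) : IsTest fun z => (φ z : ℂ) := by
  have hsub : Function.support (fun z => (φ z : ℂ)) ⊆ Function.support φ := fun z hz h0 =>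
    hz (by simp only [show φ z = 0 from h0, Complex.ofReal_zero])
  exact ⟨Complex.ofRealCLM.contDiff.comp hφ, hs.mono hsub,
    (closure_mono hsub).trans (hG.trans fun z hz => hz.1)⟩

lemma fderiv_ofReal {φ : ℝ × ℝ → ℝ} (hφ : ContDiff ℝ (⊤ : ℕ∞) φ) (z e : ℝ × ℝ) :
    fderiv ℝ (fun z => (φ z : ℂ)) z e = (fderiv ℝ φ z e : ℝ) :=
  congrArg (fun T : ℝ × ℝ →L[ℝ] ℂ => T e) (Complex.ofRealCLM.hasFDerivAt.comp z
    (hφ.differentiable (by simp) z).hasFDerivAt).fderiv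

/-- Weak derivatives in terms of the jets of test functions. -/
lemma hasWeakDeriv_iff_wint {u v : S.L2} :
    (S.HasWeakDeriv eξ u v ↔ ∀ φ : ℝ × ℝ → ℝ, ContDiff ℝ (⊤ : ℕ∞) φ → HasCompactSupport φ →
      tsupport φ ⊆ S.G → ∀ hφ : IsTest fun z => (φ z : ℂ),
        S.wint (fun _ => 1) u (S.testJet hφ).2.1 = -S.wint (fun _ => 1) v (S.testJet hφ).1) ∧
    (S.HasWeakDeriv eη u v ↔ ∀ φ : ℝ × ℝ → ℝ, ContDiff ℝ (⊤ : ℕ∞) φ → HasCompactSupport φ →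
      tsupport φ ⊆ S.G → ∀ hφ : IsTest fun z => (φ z : ℂ),
        S.wint (fun _ => 1) u (S.testJet hφ).2.2 = -S.wint (fun _ => 1) v (S.testJet hφ).1) := by
  have key : ∀ (φ : ℝ × ℝ → ℝ) (w J : S.L2), J =ᵐ[S.wMeasure] (fun z => (φ z : ℂ)) →
      ∫ z in S.G, φ z • w z = S.wint (fun _ => 1) w J := by
    intro φ w J hJ
    refine integral_congr_ae ?_
    filter_upwards [ae_iff.1 hJ] with z hz
    rw [hz, Complex.conj_ofReal, Complex.real_smul]
    push_cast
    ring
  constructor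
  · refine forall_congr' fun φ => forall_congr' fun h1 => forall_congr' fun h2 =>
      forall_congr' fun h3 => ?_
    have hφ := isTest_ofReal h1 h2 h3
    rw [key _ u (S.testJet hφ).2.1 ((coeFn_testJet_ξ hφ).trans (.of_forall fun z =>
      fderiv_ofReal h1 z eξ)), key φ v (S.testJet hφ).1 (coeFn_testJet hφ)]
    exact ⟨fun h _ => h, fun h => h hφ⟩
  · refine forall_congr' fun φ => forall_congr' fun h1 => forall_congr' fun h2 =>
      forall_congr' fun h3 => ?_
    have hφ := isTest_ofReal h1 h2 h3
    rw [key _ u (S.testJet hφ).2.2 ((coeFn_testJet_η hφ).trans (.of_forall fun z =>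
      fderiv_ofReal h1 z eη)), key φ v (S.testJet hφ).1 (coeFn_testJet hφ)]
    exact ⟨fun h _ => h, fun h => h hφ⟩

lemma wint_shift_left (s : ℝ) (u v : S.L2) :
    S.wint (fun _ => 1) (S.shift s u) v = S.wint (fun _ => 1) u (S.shift (-s) v) := by
  conv_lhs => rw [← S.shift_neg_shift s v, wint_shift]

/-- Regularity of weak solutions in the `ξ`-direction. -/
lemma IsWeakSol.exists_mem_H10_eq_ξ {Ψ : S.L2 × S.L2 × S.L2} (hΨ : Ψ ∈ S.H10) {f : S.L2}
    (h : S.IsWeakSol Ψ f) : ∃ Θ ∈ S.H10, Θ.1 = Ψ.2.1 := by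
  obtain ⟨C, hC⟩ := h.exists_norm_shiftJet_sub_le hΨ
  set s : ℕ → ℝ := fun n => 1 / ((n : ℝ) + 1) with hs
  have hspos : ∀ n, 0 < s n := fun n => Nat.one_div_pos_of_nat
  -- The difference quotients, bounded by the Lipschitz estimate; their weak limit in the energy
  -- space is the candidate for the `ξ`-derivative.
  let y : ℕ → S.H10 := fun n => ((s n)⁻¹ : ℂ) • ⟨S.shiftJet (s n) Ψ - Ψ,
    S.H10.sub_mem (S.shiftJet_mem hΨ _) hΨ⟩
  have hy : ∀ n, ‖y n‖ ≤ C := by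
    intro n
    have h1 : ‖y n‖ = (s n)⁻¹ * ‖S.shiftJet (s n) Ψ - Ψ‖ := by
      rw [norm_smul, norm_inv, Complex.norm_real, Real.norm_of_nonneg (hspos n).le]
      rfl
    rw [h1, inv_mul_eq_div, div_le_iff₀ (hspos n)]
    simpa [abs_of_pos (hspos n)] using hC (s n)
  obtain ⟨e, he⟩ := exists_weak_limit_of_bounded (E := S.Energy) (x := fun n => S.toEnergy (y n))
    (C := ‖(S.toEnergy : S.H10 →L[ℂ] S.Energy)‖ * C) fun n =>
      ((S.toEnergy : S.H10 →L[ℂ] S.Energy).le_opNorm (y n)).trans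
        (mul_le_mul_of_nonneg_left (hy n) (ContinuousLinearMap.opNorm_nonneg _))
  obtain ⟨Θ, rfl⟩ := S.toEnergy.surjective e
  refine ⟨Θ.1, Θ.2, HasWeakDeriv.unique ?_ (S.hasWeakDeriv_of_mem_H10 hΨ).1⟩
  rw [hasWeakDeriv_iff_wint.1]
  intro φ h1 h2 h3 hφ
  set J := S.testJet hφ with hJ
  have hb : S.BddCont fun _ => 1 := bddCont_const 1
  let l : S.H10 →L[ℂ] ℂ :=
    { toFun := fun Φ => S.wint (fun _ => 1) Φ.1.1 J.1
      map_add' := fun Φ Φ' => wint_add_left hb _ _ _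
      map_smul' := fun c Φ => wint_smul_left c _ _
      cont := (continuous_wint_left hb J.1).comp (continuous_fst.comp continuous_subtype_val) }
  have t1 := he (l ∘L (S.toEnergy.symm : S.Energy →L[ℂ] S.H10))
  simp only [ContinuousLinearMap.comp_apply, ContinuousLinearEquiv.coe_coe,
    ContinuousLinearEquiv.symm_apply_apply] at t1
  -- On the other side, the pairings converge by differentiation of the translated test function;
  -- comparison identifies the limit with the weak derivative.
  have t2 : Tendsto (fun n => l (y n)) atTop (𝓝 (-S.wint (fun _ => 1) Ψ.1 J.2.1)) := by
    have d1 := S.hasDerivAt_wint_shift hb Ψ.1 hφ (-0)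
    have d2 := HasDerivAt.scomp (0 : ℝ) d1 (hasDerivAt_neg (0 : ℝ))
    have d3 := d2.tendsto_slope_zero_right
    have hs0 : Tendsto s atTop (𝓝[>] 0) := tendsto_nhdsWithin_iff.2
      ⟨tendsto_one_div_add_atTop_nhds_zero_nat, .of_forall hspos⟩
    have d4 := d3.comp hs0
    rw [neg_zero, S.shift_zero, neg_one_smul] at d4
    refine d4.congr fun n => ?_
    change (s n)⁻¹ • (S.wint (fun _ => 1) Ψ.1 (S.shift (-(0 + s n)) J.1) -
      S.wint (fun _ => 1) Ψ.1 (S.shift (-0) J.1)) =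
      S.wint (fun _ => 1) (((s n)⁻¹ : ℂ) • (S.shift (s n) Ψ.1 - Ψ.1)) J.1
    rw [wint_smul_left, wint_sub_left hb, wint_shift_left, neg_zero, zero_add, S.shift_zero,
      Complex.real_smul, Complex.ofReal_inv]
  have := tendsto_nhds_unique t1 (t2.mono_left Nat.hyperfilter_le_atTop)
  change S.wint (fun _ => 1) Θ.1.1 J.1 = _ at this
  rw [this, neg_neg]

end

end ShelfStrip

namespace ShelfStrip

noncomputable section

variable (S : ShelfStrip)

/-! ### Weak and strong solutions -/

lemma bddCont_p_inv_sq : S.BddCont fun z => 1 / S.p z * (1 / S.p z) :=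
  S.bddCont_p_inv.mul S.bddCont_p_inv

lemma bddCont_first_order_ξ : S.BddCont fun z => 1 / S.p z * (1 / S.p z) * (1 / S.p z) * S.pξ z :=
  (S.bddCont_p_inv_sq.mul S.bddCont_p_inv).mul S.bddCont_pξ

lemma bddCont_first_order_η : S.BddCont fun z => S.β' z - 1 / S.p z * S.pη z :=
  S.bddCont_β'.sub (S.bddCont_p_inv.mul S.bddCont_pη)

/-- The part of `𝓛_γ u` which does not contain the second `η`-derivative. -/
def lPart (uξ uη uξξ : S.L2) : S.L2 :=
  mulOp S.bddCont_first_order_ξ uξ + mulOp S.bddCont_first_order_η uη - mulOp S.bddCont_p_inv_sq uξξ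

lemma coeFn_lPart_sub (uξ uη uξξ uηη : S.L2) :
    (S.lPart uξ uη uξξ - uηη : S.L2) =ᵐ[S.wMeasure] S.Lexpr uξ uη uξξ uηη := by
  filter_upwards [Lp.coeFn_sub (S.lPart uξ uη uξξ) uηη,
    Lp.coeFn_sub (mulOp S.bddCont_first_order_ξ uξ + mulOp S.bddCont_first_order_η uη)
      (mulOp S.bddCont_p_inv_sq uξξ),
    Lp.coeFn_add (mulOp S.bddCont_first_order_ξ uξ) (mulOp S.bddCont_first_order_η uη),
    coeFn_mulOp S.bddCont_first_order_ξ uξ, coeFn_mulOp S.bddCont_first_order_η uη,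
    coeFn_mulOp S.bddCont_p_inv_sq uξξ] with z h1 h2 h3 h4 h5 h6
  rw [h1, Pi.sub_apply, lPart, h2, Pi.sub_apply, h3, Pi.add_apply, h4, h5, h6]
  simp only [Lexpr]
  push_cast
  ring

section Weak

variable {S} {Ψ Φ : S.L2 × S.L2 × S.L2} {f uξξ uηη : S.L2}

/-- This is the reciprocal of the weight `w`. Test functions multiplied by it turn the weighted weak
equation into an unweighted one with the coefficients of 𝓛. -/
lemma isMult_exp_div_p : S.IsMult (fun z => Real.exp (S.β z.2) * (1 / S.p z))
    (fun z => Real.exp (S.β z.2) * -(S.pξ z / S.p z ^ 2) + 0 * (1 / S.p z))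
    (fun z => Real.exp (S.β z.2) * -(S.pη z / S.p z ^ 2) +
      Real.exp (S.β z.2) * S.β' z * (1 / S.p z)) :=
  S.isMult_exp.mul S.isMult_p_inv

lemma w_mul_exp_div_p {z : ℝ × ℝ} (hz : z ∈ S.G) :
    S.w z * (Real.exp (S.β z.2) * (1 / S.p z)) = 1 := by
  have := (S.p_pos hz).ne'
  rw [w, Real.exp_neg]
  field_simp

/-- Green's formula for the energy form. -/
lemma lSesq_exp_div_p (hΦ : Φ ∈ S.H10) (h : S.HasWeakDeriv eξ Ψ.2.1 uξξ) :
    S.lSesq Ψ (mulOp isMult_exp_div_p.bdd Φ.1,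
      mulOp isMult_exp_div_p.bdd Φ.2.1 + mulOp isMult_exp_div_p.bdd_ξ Φ.1,
      mulOp isMult_exp_div_p.bdd Φ.2.2 + mulOp isMult_exp_div_p.bdd_η Φ.1) =
    S.wint (fun _ => 1) Ψ.2.2 Φ.2.2 +
      S.wint (fun _ => 1) (S.lPart Ψ.2.1 Ψ.2.2 uξξ) Φ.1 := by
  have h1 : S.BddCont fun _ => 1 := bddCont_const 1
  have hibp := h.wint_eq ((S.isMult_p_inv.mul S.isMult_p_inv).mem Φ hΦ)
  simp only [wint_add_right h1, wint_mulOp_right, one_mul] at hibp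
  -- The derivative of `p⁻²` yields two copies of the first-order term; one is cancelled by `e2`,
  -- where the derivative falls on the factor exp(β)/p, and the other is the term in 𝓛.
  have e0 : S.wint (fun z => 1 / S.p z * -(S.pξ z / S.p z ^ 2) +
      -(S.pξ z / S.p z ^ 2) * (1 / S.p z)) Ψ.2.1 Φ.1 =
      -(S.wint (fun z => 1 / S.p z * (1 / S.p z) * (1 / S.p z) * S.pξ z) Ψ.2.1 Φ.1 +
        S.wint (fun z => 1 / S.p z * (1 / S.p z) * (1 / S.p z) * S.pξ z) Ψ.2.1 Φ.1) := by
    rw [← wint_add_coeff S.bddCont_first_order_ξ S.bddCont_first_order_ξ, ← wint_neg_coeff]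
    refine wint_congr (fun z hz => ?_) _ _
    ring
  rw [e0] at hibp
  have e1 : S.wint (fun z => S.κ z * (Real.exp (S.β z.2) * (1 / S.p z))) Ψ.2.1 Φ.2.1 =
      S.wint (fun z => 1 / S.p z * (1 / S.p z)) Ψ.2.1 Φ.2.1 := by
    refine wint_congr (fun z hz => ?_) _ _
    have := (S.p_pos hz).ne'
    rw [κ, Real.exp_neg]
    field_simp
  have e2 : S.wint (fun z => S.κ z * (Real.exp (S.β z.2) * -(S.pξ z / S.p z ^ 2) +
      0 * (1 / S.p z))) Ψ.2.1 Φ.1 =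
      -S.wint (fun z => 1 / S.p z * (1 / S.p z) * (1 / S.p z) * S.pξ z) Ψ.2.1 Φ.1 := by
    rw [← wint_neg_coeff]
    refine wint_congr (fun z hz => ?_) _ _
    have := (S.p_pos hz).ne'
    rw [κ, Real.exp_neg]
    field_simp
    ring
  have e3 : S.wint (fun z => S.w z * (Real.exp (S.β z.2) * (1 / S.p z))) Ψ.2.2 Φ.2.2 =
      S.wint (fun _ => 1) Ψ.2.2 Φ.2.2 :=
    wint_congr (fun z hz => w_mul_exp_div_p hz) _ _
  have e4 : S.wint (fun z => S.w z * (Real.exp (S.β z.2) * -(S.pη z / S.p z ^ 2) +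
      Real.exp (S.β z.2) * S.β' z * (1 / S.p z))) Ψ.2.2 Φ.1 =
      S.wint (fun z => S.β' z - 1 / S.p z * S.pη z) Ψ.2.2 Φ.1 := by
    refine wint_congr (fun z hz => ?_) _ _
    have := (S.p_pos hz).ne'
    rw [w, Real.exp_neg]
    field_simp
    ring
  simp only [lSesq, wint_add_right S.bddCont_κ, wint_add_right S.bddCont_w, wint_mulOp_right, e1,
    e2, e3, e4, lPart, wint_sub_left h1, wint_add_left h1, wint_mulOp_left, one_mul]
  linear_combination hibp

/-- The weak equation in terms of `η`-derivatives. -/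
lemma isWeakSol_iff (h : S.HasWeakDeriv eξ Ψ.2.1 uξξ) : S.IsWeakSol Ψ f ↔
    ∀ Φ ∈ S.H10, S.wint (fun _ => 1) Ψ.2.2 Φ.2.2 =
      S.wint (fun _ => 1) (f - S.lPart Ψ.2.1 Ψ.2.2 uξξ) Φ.1 := by
  have h1 : S.BddCont fun _ => 1 := bddCont_const 1
  have hf : ∀ Φ : S.L2 × S.L2 × S.L2, S.wint S.w f (mulOp isMult_exp_div_p.bdd Φ.1) =
      S.wint (fun _ => 1) f Φ.1 := fun Φ => by
    rw [wint_mulOp_right]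
    exact wint_congr (fun z hz => w_mul_exp_div_p hz) _ _
  constructor
  · intro hw Φ hΦ
    have := hw _ (isMult_exp_div_p.mem Φ hΦ)
    rw [lSesq_exp_div_p hΦ h, hf] at this
    rw [wint_sub_left h1, ← this]
    ring
  · intro hw Φ hΦ
    -- Conversely, every `Φ` is exp(β)/p times the product of `w` and `Φ`; agreement of the first
    -- components suffices, by `H10_ext`.
    have hm := (S.isMult_exp_neg.mul S.isMult_p).mem Φ hΦ
    have e : mulOp (isMult_exp_div_p (S := S)).bdd
        (mulOp (S.isMult_exp_neg.mul S.isMult_p).bdd Φ.1) = Φ.1 := by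
      refine Lp.ext ?_
      filter_upwards [coeFn_mulOp (isMult_exp_div_p (S := S)).bdd
        (mulOp (S.isMult_exp_neg.mul S.isMult_p).bdd Φ.1),
        coeFn_mulOp (S.isMult_exp_neg.mul S.isMult_p).bdd Φ.1, S.ae_mem_G] with z h1 h2 hz
      have h3 := w_mul_exp_div_p hz
      rw [h1, h2, ← mul_assoc, ← Complex.ofReal_mul, mul_comm (_ * _), ← w, h3,
        Complex.ofReal_one, one_mul]
    have e' := S.H10_ext (isMult_exp_div_p.mem _ hm) hΦ e
    have := hw _ hm
    rw [← e', lSesq_exp_div_p hm h, hf, this, wint_sub_left h1]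
    ring

lemma wint_testJet_conj_η {φ : ℝ × ℝ → ℂ} (hφ : IsTest φ) (u v : S.L2) :
    ∫ z in S.G, (u z * fderiv ℝ φ z eη + v z * φ z) =
      S.wint (fun _ => 1) u (S.testJet hφ.conj).2.2 +
        S.wint (fun _ => 1) v (S.testJet hφ.conj).1 := by
  have h1 : S.BddCont fun _ => 1 := bddCont_const 1
  rw [wint, wint, ← integral_add (h1.integrable _ _) (h1.integrable _ _)]
  refine integral_congr_ae ?_
  filter_upwards [ae_iff.1 (coeFn_testJet (S := S) hφ.conj),
    ae_iff.1 (coeFn_testJet_η (S := S) hφ.conj)] with z hz hz'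
  rw [hz, hz', hφ.fderiv_conj, Complex.conj_conj, Complex.conj_conj]
  push_cast
  ring

/-- The Neumann condition, tested against all of `H̃₀¹`. -/
lemma IsDomJet.wint_eq {u uξ uη uξξ uξη uηη : S.L2} (h : S.IsDomJet u uξ uη uξξ uξη uηη)
    (hΦ : Φ ∈ S.H10) : S.wint (fun _ => 1) uη Φ.2.2 = S.wint (fun _ => 1) (-uηη) Φ.1 := by
  have h1 : S.BddCont fun _ => 1 := bddCont_const 1
  refine H10_induction (P := fun Φ => S.wint (fun _ => 1) uη Φ.2.2 =
    S.wint (fun _ => 1) (-uηη) Φ.1) (isClosed_eq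
      ((continuous_wint_right h1 _).comp (continuous_snd.comp continuous_snd))
      ((continuous_wint_right h1 _).comp continuous_fst)) (fun φ hφ => ?_) hΦ
  have h2 := h.neumann _ hφ.conj
  rw [wint_testJet_conj_η hφ.conj] at h2
  simp only [Complex.conj_conj] at h2
  rw [wint_neg_left]
  exact eq_neg_of_add_eq_zero_left h2

/-- Weak solutions are exactly the strong solutions in the domain of the pencil. -/
theorem isWeakSol_iff_isDomJet (hΨ : Ψ ∈ S.H10) : S.IsWeakSol Ψ f ↔
    ∃ uξξ uξη uηη, S.IsDomJet Ψ.1 Ψ.2.1 Ψ.2.2 uξξ uξη uηη ∧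
      f =ᵐ[S.wMeasure] S.Lexpr Ψ.2.1 Ψ.2.2 uξξ uηη := by
  constructor
  · intro h
    obtain ⟨Θ, hΘ, hΘΨ⟩ := h.exists_mem_H10_eq_ξ hΨ
    obtain ⟨hξ, hη⟩ := S.hasWeakDeriv_of_mem_H10 hΨ
    obtain ⟨hξξ, hξη⟩ := S.hasWeakDeriv_of_mem_H10 hΘ
    rw [hΘΨ] at hξξ hξη
    have hw := (isWeakSol_iff hξξ).1 h
    -- The second `η`-derivative is defined by the equation. The unweighted weak equation then
    -- contains both the weak derivative, by tests inside the strip, and the Neumann condition, by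
    -- tests reaching the upper edge.
    set uηη := S.lPart Ψ.2.1 Ψ.2.2 Θ.2.1 - f with hu
    have hneg : f - S.lPart Ψ.2.1 Ψ.2.2 Θ.2.1 = -uηη := by rw [hu, neg_sub]
    rw [hneg] at hw
    refine ⟨Θ.2.1, Θ.2.2, uηη, ⟨hξ, hη, hξξ, hξη, ?_, hΨ, ?_⟩, ?_⟩
    · rw [hasWeakDeriv_iff_wint.2]
      intro φ _ _ _ hφ
      rw [hw _ (testJet_mem hφ), wint_neg_left]
    · intro φ hφ
      rw [wint_testJet_conj_η hφ, hw _ (testJet_mem hφ.conj), wint_neg_left, neg_add_cancel]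
    · have := S.coeFn_lPart_sub Ψ.2.1 Ψ.2.2 Θ.2.1 uηη
      rwa [hu, sub_sub_cancel, ← hu] at this
  · rintro ⟨uξξ, uξη, uηη, h, hf⟩
    rw [isWeakSol_iff h.deriv_ξξ]
    intro Φ hΦ
    have : f = S.lPart Ψ.2.1 Ψ.2.2 uξξ - uηη :=
      Lp.ext (hf.trans (S.coeFn_lPart_sub _ _ _ _).symm)
    rw [this, sub_sub_cancel_left]
    exact h.wint_eq hΦ

end Weak

/-! ### The pencil as an operator in the energy space -/

/-- The embedding of the energy space into `L₂(G; h)`. -/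
def embed : S.Energy →L[ℂ] S.L2 :=
  ContinuousLinearMap.fst ℂ S.L2 (S.L2 × S.L2) ∘L S.H10.subtypeL ∘L
    (S.toEnergy.symm : S.Energy →L[ℂ] S.H10)

lemma embed_toEnergy (Ψ : S.H10) : S.embed (S.toEnergy Ψ) = Ψ.1.1 := by
  simp [embed]

lemma bddCont_mCoeff : S.BddCont fun z => 1 / S.p z * S.β' z := S.bddCont_p_inv.mul S.bddCont_β'

/-- `𝓜_γ`, from the energy space to `L₂(G; h)`. -/
def mOp : S.Energy →L[ℂ] S.L2 :=
  (-Complex.I) • (mulOp S.bddCont_mCoeff ∘L ContinuousLinearMap.fst ℂ S.L2 S.L2 ∘L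
    ContinuousLinearMap.snd ℂ S.L2 (S.L2 × S.L2) ∘L S.H10.subtypeL ∘L
    (S.toEnergy.symm : S.Energy →L[ℂ] S.H10))

lemma mOp_toEnergy (Ψ : S.H10) :
    S.mOp (S.toEnergy Ψ) = (-Complex.I) • mulOp S.bddCont_mCoeff Ψ.1.2.1 := by
  simp [mOp]

lemma coeFn_mOp_toEnergy (Ψ : S.H10) :
    S.mOp (S.toEnergy Ψ) =ᵐ[S.wMeasure] S.Mexpr Ψ.1.2.1 := by
  rw [mOp_toEnergy]
  filter_upwards [Lp.coeFn_smul (-Complex.I) (mulOp S.bddCont_mCoeff Ψ.1.2.1),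
    coeFn_mulOp S.bddCont_mCoeff Ψ.1.2.1] with z h1 h2
  rw [h1, Pi.smul_apply, h2, Mexpr, smul_eq_mul]
  push_cast
  ring

/-- The adjoint of the embedding: the solution operator of `𝓛_γ`. -/
def solve : S.L2 →L[ℂ] S.Energy := ContinuousLinearMap.adjoint S.embed

lemma embed_injective : Function.Injective S.embed := by
  intro x y h
  obtain ⟨Ψ, rfl⟩ := S.toEnergy.surjective x
  obtain ⟨Φ, rfl⟩ := S.toEnergy.surjective y
  rw [embed_toEnergy, embed_toEnergy] at h
  rw [Subtype.ext (S.H10_ext Ψ.2 Φ.2 h)]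

lemma isWeakSol_iff_toEnergy (Ψ : S.H10) (f : S.L2) :
    S.IsWeakSol Ψ.1 f ↔ S.toEnergy Ψ = S.solve f := by
  have e : ∀ Φ : S.H10, inner ℂ (S.toEnergy Φ) (S.solve f) = S.wint S.w f Φ.1.1 := fun Φ => by
    rw [solve, ContinuousLinearMap.adjoint_inner_right, embed_toEnergy, inner_eq_wint]
  constructor
  · intro h
    refine ext_inner_left ℂ fun x => ?_
    obtain ⟨Φ, rfl⟩ := S.toEnergy.surjective x
    rw [e, inner_toEnergy, h _ Φ.2]
  · intro h Φ hΦ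
    have := S.inner_toEnergy Ψ ⟨Φ, hΦ⟩
    rw [h, e] at this
    exact this.symm

/-- The graph of the pencil, in terms of the energy space. -/
theorem mem_graph_pencil_iff {ω : ℂ} (hω : ω ≠ 0) (u f : S.L2) :
    (u, f) ∈ (S.pencil ω).graph ↔ ∃ x, S.embed x = u ∧
      (ω • (1 : S.Energy →L[ℂ] S.Energy) - S.solve ∘L S.mOp) x = S.solve f := by
  rw [graph_pencil]
  constructor
  · rintro ⟨uξ, uη, uξξ, uξη, uηη, h, hf⟩
    let Ψ : S.H10 := ⟨(u, uξ, uη), h.dirichlet⟩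
    refine ⟨S.toEnergy Ψ, S.embed_toEnergy Ψ, ?_⟩
    have h1 := (S.isWeakSol_iff_toEnergy Ψ (S.lPart uξ uη uξξ - uηη)).1
      ((isWeakSol_iff_isDomJet Ψ.2).2 ⟨uξξ, uξη, uηη, h, S.coeFn_lPart_sub _ _ _ _⟩)
    have h2 : f = ω • (S.lPart uξ uη uξξ - uηη) - S.mOp (S.toEnergy Ψ) := by
      refine Lp.ext ?_
      filter_upwards [hf, S.coeFn_lPart_sub uξ uη uξξ uηη, S.coeFn_mOp_toEnergy Ψ,
        Lp.coeFn_smul ω (S.lPart uξ uη uξξ - uηη),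
        Lp.coeFn_sub (ω • (S.lPart uξ uη uξξ - uηη)) (S.mOp (S.toEnergy Ψ)) ]
        with z h1 h2 h3 h4 h5
      rw [h5, Pi.sub_apply, h4, Pi.smul_apply, h2, h3]
      exact h1
    rw [h2, map_sub, map_smul, ← h1]
    rfl
  · rintro ⟨x, rfl, hx⟩
    obtain ⟨Ψ, rfl⟩ := S.toEnergy.surjective x
    -- The value that 𝓛Ψ must have for the pencil equation to hold; `ω ≠ 0` is needed to solve for
    -- it.
    set g : S.L2 := ω⁻¹ • (f + S.mOp (S.toEnergy Ψ)) with hg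
    have h1 : S.toEnergy Ψ = S.solve g := by
      have : ω • S.toEnergy Ψ = S.solve f + S.solve (S.mOp (S.toEnergy Ψ)) := by
        rw [← hx]
        exact (sub_add_cancel _ _).symm
      rw [hg, map_smul, map_add, ← this, smul_smul, inv_mul_cancel₀ hω, one_smul]
    obtain ⟨uξξ, uξη, uηη, h, hgL⟩ := (isWeakSol_iff_isDomJet Ψ.2).1
      ((S.isWeakSol_iff_toEnergy Ψ g).2 h1)
    rw [embed_toEnergy]
    refine ⟨_, _, uξξ, uξη, uηη, h, ?_⟩
    filter_upwards [hgL, S.coeFn_mOp_toEnergy Ψ, Lp.coeFn_add f (S.mOp (S.toEnergy Ψ)),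
      Lp.coeFn_smul ω⁻¹ (f + S.mOp (S.toEnergy Ψ))] with z h1 h2 h3 h4
    rw [hg, h4, Pi.smul_apply, h3, Pi.add_apply, h2, smul_eq_mul] at h1
    rw [← h1, mul_inv_cancel_left₀ hω, add_sub_cancel_right]

/-- The operator `𝓛_γ⁻¹ 𝓜_γ` in the energy space. -/
def energyOp : S.Energy →L[ℂ] S.Energy := S.solve ∘L S.mOp

/-- The factor `p` of the measure cancels the one in 𝓜, leaving a function of `η` alone. The
one-sided derivative makes it continuous up to the boundary. -/
lemma w_mul_mCoeff {z : ℝ × ℝ} (hz : z ∈ S.G) : S.w z * (1 / S.p z * S.β' z) =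
    Real.exp (-S.β z.2) * derivWithin S.β (Icc 0 S.δ) z.2 := by
  have := (S.p_pos hz).ne'
  rw [w, S.derivWithin_β hz]
  field_simp

lemma continuousOn_mWeight :
    ContinuousOn (fun η => Real.exp (-S.β η) * derivWithin S.β (Icc 0 S.δ) η) (Icc 0 S.δ) :=
  S.β_contDiffOn.continuousOn.neg.rexp.mul S.continuousOn_derivWithin_β

lemma inner_energyOp_right (Ψ Φ : S.H10) :
    inner ℂ (S.toEnergy Φ) (S.energyOp (S.toEnergy Ψ)) = -Complex.I *
      S.wint (fun z => Real.exp (-S.β z.2) * derivWithin S.β (Icc 0 S.δ) z.2) Ψ.1.2.1 Φ.1.1 := by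
  rw [energyOp, ContinuousLinearMap.comp_apply, solve, ContinuousLinearMap.adjoint_inner_right,
    embed_toEnergy, mOp_toEnergy, inner_smul_right, inner_eq_wint, wint_mulOp_left]
  congr 1
  exact wint_congr (fun z hz => S.w_mul_mCoeff hz) _ _

/-- Integration by parts in `ξ` gives a sign, which conjugation of -i compensates. -/
lemma isSelfAdjoint_energyOp : IsSelfAdjoint S.energyOp := by
  rw [ContinuousLinearMap.isSelfAdjoint_iff_isSymmetric]
  intro x y
  obtain ⟨Ψ, rfl⟩ := S.toEnergy.surjective x
  obtain ⟨Φ, rfl⟩ := S.toEnergy.surjective y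
  change inner ℂ (S.energyOp (S.toEnergy Ψ)) (S.toEnergy Φ) =
    inner ℂ (S.toEnergy Ψ) (S.energyOp (S.toEnergy Φ))
  refine (inner_conj_symm (𝕜 := ℂ) (S.energyOp (S.toEnergy Ψ)) (S.toEnergy Φ)).symm.trans ?_
  rw [inner_energyOp_right, inner_energyOp_right, map_mul, wint_conj,
    wint_snd_eq_neg S.continuousOn_mWeight Φ.2 Ψ.2]
  simp

lemma lForm_eq (Ψ : S.H10) : S.lForm Ψ = ‖S.toEnergy Ψ‖ ^ 2 := by
  have h1 : ((‖S.toEnergy Ψ‖ ^ 2 : ℝ) : ℂ) = S.lSesq Ψ.1 Ψ.1 := S.norm_grad_sq Ψ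
  have h2 : ‖S.toEnergy Ψ‖ ^ 2 = (S.lSesq Ψ.1 Ψ.1).re := by rw [← h1, Complex.ofReal_re]
  have i1 : Integrable (fun z => ((S.κ z : ℂ) * Ψ.1.2.1 z * (starRingEnd ℂ) (Ψ.1.2.1 z)).re)
      (volume.restrict S.G) := (S.bddCont_κ.integrable _ _).re
  have i2 : Integrable (fun z => ((S.w z : ℂ) * Ψ.1.2.2 z * (starRingEnd ℂ) (Ψ.1.2.2 z)).re)
      (volume.restrict S.G) := (S.bddCont_w.integrable _ _).re
  rw [h2, lSesq, Complex.add_re, re_wint S.bddCont_κ, re_wint S.bddCont_w, ← integral_add i1 i2]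
  refine setIntegral_congr_fun S.isOpen_G.measurableSet fun z hz => ?_
  have e : ∀ (a : ℝ) (b : ℂ), ((a : ℂ) * b * (starRingEnd ℂ) b).re = a * ‖b‖ ^ 2 := by
    intro a b
    rw [mul_assoc, Complex.mul_conj']
    norm_cast
  simp only [e, κ, w]
  ring

lemma mForm_eq (Ψ : S.H10) : S.mForm Ψ = S.energyOp.reApplyInnerSelf (S.toEnergy Ψ) := by
  have h1 : S.energyOp.reApplyInnerSelf (S.toEnergy Ψ) =
      (inner ℂ (S.toEnergy Ψ) (S.energyOp (S.toEnergy Ψ))).re := by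
    rw [ContinuousLinearMap.reApplyInnerSelf, ← inner_conj_symm]
    exact Complex.conj_re _
  rw [h1, energyOp, ContinuousLinearMap.comp_apply, solve,
    ContinuousLinearMap.adjoint_inner_right, embed_toEnergy, L2.inner_def, mForm]
  congr 1
  refine integral_congr_ae ?_
  filter_upwards [S.coeFn_mOp_toEnergy Ψ] with z hz
  rw [hz, RCLike.inner_apply]

lemma mu_eq_minmax (j : ℕ) : S.mu j = minmax S.energyOp j := by
  rw [mu, minmax]
  refine Equiv.iSup_congr
    (Submodule.orderIsoMapComap S.toEnergy.toLinearEquiv).toEquiv fun U => ?_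
  have hf : Module.finrank ℂ (U.map (S.toEnergy.toLinearEquiv : S.H10 →ₗ[ℂ] S.Energy)) =
      Module.finrank ℂ U := LinearEquiv.finrank_map_eq S.toEnergy.toLinearEquiv U
  refine iSup_congr_Prop (by rw [← hf]; rfl) fun _ => ?_
  symm
  refine Equiv.iInf_congr S.toEnergy.toEquiv fun Ψ => ?_
  refine iInf_congr_Prop ?_ fun _ => iInf_congr_Prop ?_ fun _ => ?_
  · constructor
    · rintro ⟨Φ, hΦ, h⟩
      have : Φ = Ψ := S.toEnergy.injective h
      rwa [← this]
    · exact fun h => ⟨Ψ, h, rfl⟩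
  · exact (map_ne_zero_iff S.toEnergy S.toEnergy.injective)
  · rw [lForm_eq, mForm_eq]
    rfl

end

end ShelfStrip

/-! ### Lower bounds for min–max values from doubly orthogonal families. -/

section Orthogonal

variable {E : Type*} [NormedAddCommGroup E] [InnerProductSpace ℂ E]

lemma inner_map_sum_smul_of_pairwise {ι : Type*} [Fintype ι] (B : E →L[ℂ] E) {x : ι → E}
    (h : Pairwise fun i k => inner ℂ (x i) (B (x k)) = 0) (a : ι → ℂ) :
    inner ℂ (∑ i, a i • x i) (B (∑ i, a i • x i)) =
      ∑ i, ((‖a i‖ ^ 2 : ℝ) : ℂ) * inner ℂ (x i) (B (x i)) := by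
  simp only [map_sum, map_smul, sum_inner, inner_sum, inner_smul_left, inner_smul_right]
  refine Finset.sum_congr rfl fun i _ => ?_
  rw [Finset.sum_eq_single i (fun k _ hk => by rw [h hk]; simp) (by simp), ← mul_assoc,
    Complex.mul_conj']
  push_cast
  ring

/-- Vectors which are orthogonal with respect to both forms yield a lower bound for the min–max
values. -/
lemma le_minmax_of_pairwise {K : E →L[ℂ] E} {j : ℕ} {c : ℝ} {x : Fin j → E} (h0 : ∀ i, x i ≠ 0)
    (h1 : Pairwise fun i k => inner ℂ (x i) (x k) = 0)
    (h2 : Pairwise fun i k => inner ℂ (x i) (K (x k)) = 0)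
    (h3 : ∀ i, c * ‖x i‖ ^ 2 ≤ (inner ℂ (x i) (K (x i))).re) : (c : EReal) ≤ minmax K j := by
  have hli : LinearIndependent ℂ x := linearIndependent_of_ne_zero_of_inner_eq_zero h0 h1
  refine le_minmax (U := Submodule.span ℂ (range x))
    (by rw [finrank_span_eq_card hli, Fintype.card_fin]) fun y hy => ?_
  obtain ⟨a, rfl⟩ := (Submodule.mem_span_range_iff_exists_fun ℂ).1 hy
  have e1 := inner_map_sum_smul_of_pairwise K h2 a
  have e2 := inner_map_sum_smul_of_pairwise (1 : E →L[ℂ] E) (x := x) h1 a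
  have e3 : ‖∑ i, a i • x i‖ ^ 2 = ∑ i, ‖a i‖ ^ 2 * ‖x i‖ ^ 2 := by
    have : ((‖∑ i, a i • x i‖ ^ 2 : ℝ) : ℂ) = ((∑ i, ‖a i‖ ^ 2 * ‖x i‖ ^ 2 : ℝ) : ℂ) := by
      push_cast
      simpa [inner_self_eq_norm_sq_to_K] using e2
    exact_mod_cast this
  have e4 : K.reApplyInnerSelf (∑ i, a i • x i) =
      ∑ i, ‖a i‖ ^ 2 * (inner ℂ (x i) (K (x i))).re := by
    rw [ContinuousLinearMap.reApplyInnerSelf, ← inner_conj_symm, RCLike.conj_re, e1]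
    simp only [RCLike.re_to_complex, Complex.re_sum, Complex.re_ofReal_mul]
  rw [e3, e4, Finset.mul_sum]
  refine Finset.sum_le_sum fun i _ => ?_
  calc c * (‖a i‖ ^ 2 * ‖x i‖ ^ 2) = ‖a i‖ ^ 2 * (c * ‖x i‖ ^ 2) := by ring
    _ ≤ _ := mul_le_mul_of_nonneg_left (h3 i) (by positivity)

end Orthogonal

namespace ShelfStrip

noncomputable section

variable (S : ShelfStrip)

/-! ### A lower bound for the min–max values -/

/-- The longitudinal profile of the trial function. -/
def bumpξ : ContDiffBump (0 : ℝ) := ⟨1 / 8, 1 / 4, by norm_num, by norm_num⟩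

/-- The transversal profile of the trial function. -/
def bumpη : ContDiffBump (S.δ / 2) :=
  ⟨S.δ / 8, S.δ / 4, by linarith [S.δ_pos], by linarith [S.δ_pos]⟩

/-- A localized wave, travelling in the direction in which `𝓜_γ` is positive. -/
def trial (z : ℝ × ℝ) : ℂ :=
  (bumpξ z.1 * S.bumpη z.2 : ℝ) * Complex.exp (z.1 * Complex.I)

lemma trial_eq_zero {z : ℝ × ℝ} (hz : 1 / 4 ≤ |z.1|) : S.trial z = 0 := by
  have : bumpξ z.1 = 0 := bumpξ.zero_of_le_dist (by rwa [Real.dist_0_eq_abs])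
  rw [trial, this, zero_mul, Complex.ofReal_zero, zero_mul]

lemma isTest_trial : IsTest S.trial := by
  have hsub : Function.support S.trial ⊆
      Metric.closedBall 0 (1 / 4) ×ˢ Metric.closedBall (S.δ / 2) (S.δ / 4) := by
    intro z hz
    by_contra hn
    rw [mem_prod, not_and_or, Metric.mem_closedBall, Metric.mem_closedBall, not_le, not_le] at hn
    refine hz ?_
    rcases hn with h | h
    · exact S.trial_eq_zero (by rw [← Real.dist_0_eq_abs]; exact h.le)
    · rw [trial, S.bumpη.zero_of_le_dist h.le, mul_zero, Complex.ofReal_zero, zero_mul]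
  have hcpt : IsCompact (Metric.closedBall (0 : ℝ) (1 / 4) ×ˢ
      Metric.closedBall (S.δ / 2) (S.δ / 4)) :=
    (isCompact_closedBall _ _).prod (isCompact_closedBall _ _)
  refine ⟨?_, HasCompactSupport.of_support_subset_isCompact hcpt hsub,
    (closure_minimal hsub hcpt.isClosed).trans fun z hz => ?_⟩
  · refine ContDiff.mul (Complex.ofRealCLM.contDiff.comp
      ((bumpξ.contDiff.comp contDiff_fst).mul (S.bumpη.contDiff.comp contDiff_snd))) ?_
    exact ((Complex.ofRealCLM.contDiff.comp contDiff_fst).mul contDiff_const).cexp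
  · have h := hz.2
    rw [Metric.mem_closedBall, Real.dist_eq, abs_le] at h
    have := S.δ_pos
    change 0 < z.2
    linarith [h.1]

lemma fderiv_trial (z : ℝ × ℝ) : fderiv ℝ S.trial z eξ =
    ((deriv bumpξ z.1 * S.bumpη z.2 : ℝ) + (bumpξ z.1 * S.bumpη z.2 : ℝ) * Complex.I) *
      Complex.exp (z.1 * Complex.I) := by
  have h1 : HasDerivAt (fun t : ℝ => S.trial (t, z.2)) (fderiv ℝ S.trial z eξ) z.1 := by
    have h2 : HasDerivAt (fun t : ℝ => (t, z.2)) eξ z.1 :=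
      (hasDerivAt_id z.1).prodMk (hasDerivAt_const z.1 z.2)
    exact (S.isTest_trial.differentiableAt z).hasFDerivAt.comp_hasDerivAt z.1 h2
  refine h1.unique ?_
  have hb : HasDerivAt bumpξ (deriv bumpξ z.1) z.1 :=
    ((bumpξ.contDiff (n := 1)).differentiable (by simp) z.1).hasDerivAt
  have h3 := ((hb.mul_const (S.bumpη z.2)).ofReal_comp).mul
    (((Complex.ofRealCLM.hasDerivAt (x := z.1)).mul_const Complex.I).cexp)
  refine h3.congr_deriv ?_
  simp only [Complex.ofRealCLM_apply, Complex.ofReal_one, one_mul]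
  ring

/-- The jet of the trial function. -/
def trialJet : S.H10 := ⟨S.testJet S.isTest_trial, testJet_mem _⟩

lemma mWeight_pos {z : ℝ × ℝ} (hz : z ∈ S.G) :
    0 < Real.exp (-S.β z.2) * derivWithin S.β (Icc 0 S.δ) z.2 := by
  rw [S.derivWithin_β hz]
  exact mul_pos (Real.exp_pos _) (S.β_deriv_pos _ hz)

/-- With b the product of the bumps, -i∂/∂ξ applied to the phase gives exp(-β)β'b², while the
derivative of the bump contributes only an imaginary part. The remaining integrand is nonnegative,
and positive where both bumps equal 1. -/
lemma re_inner_energyOp_trialJet_pos :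
    0 < (inner ℂ (S.toEnergy S.trialJet) (S.energyOp (S.toEnergy S.trialJet))).re := by
  have hc : S.BddCont fun z => Real.exp (-S.β z.2) * derivWithin S.β (Icc 0 S.δ) z.2 :=
    bddCont_of_Icc S.continuousOn_mWeight
  rw [inner_energyOp_right, ← wint_smul_left, re_wint hc]
  have hi := (hc.integrable ((-Complex.I) • S.trialJet.1.2.1) S.trialJet.1.1).re
  have hae : (fun z => ((((Real.exp (-S.β z.2) * derivWithin S.β (Icc 0 S.δ) z.2 : ℝ) : ℂ)) *
      ((-Complex.I) • S.trialJet.1.2.1 : S.L2) z * (starRingEnd ℂ) (S.trialJet.1.1 z)).re)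
      =ᵐ[volume.restrict S.G] fun z => Real.exp (-S.β z.2) * derivWithin S.β (Icc 0 S.δ) z.2 *
        (bumpξ z.1 * S.bumpη z.2) ^ 2 := by
    filter_upwards [ae_iff.1 (Lp.coeFn_smul (-Complex.I) S.trialJet.1.2.1),
      ae_iff.1 (coeFn_testJet (S := S) S.isTest_trial),
      ae_iff.1 (coeFn_testJet_ξ (S := S) S.isTest_trial)] with z h1 h2 h3
    have h2' : S.trialJet.1.1 z = S.trial z := h2
    have h3' : S.trialJet.1.2.1 z = fderiv ℝ S.trial z eξ := h3
    rw [h1, Pi.smul_apply, h2', h3', fderiv_trial, trial, map_mul, Complex.conj_ofReal]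
    have he : Complex.exp (z.1 * Complex.I) * (starRingEnd ℂ) (Complex.exp (z.1 * Complex.I)) = 1 := by
      rw [Complex.mul_conj', Complex.norm_exp_ofReal_mul_I]
      norm_num
    set e := Complex.exp (z.1 * Complex.I)
    set c := Real.exp (-S.β z.2) * derivWithin S.β (Icc 0 S.δ) z.2
    set a := deriv bumpξ z.1 * S.bumpη z.2
    set b := bumpξ z.1 * S.bumpη z.2
    have : (c : ℂ) * (-Complex.I) • ((a + b * Complex.I) * e) * (b * (starRingEnd ℂ) e) =
        ((c * b ^ 2 : ℝ) : ℂ) + ((-(c * a * b) : ℝ) : ℂ) * Complex.I := by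
      rw [smul_eq_mul]
      push_cast
      linear_combination (-Complex.I * c * (a + b * Complex.I) * b) * he -
        c * b ^ 2 * Complex.I_mul_I
    rw [this, Complex.add_re, Complex.ofReal_re, Complex.re_ofReal_mul, Complex.I_re, mul_zero,
      add_zero]
  rw [integral_congr_ae hae, setIntegral_pos_iff_support_of_nonneg_ae]
  · have hO : IsOpen (Metric.ball (0 : ℝ) (1 / 8) ×ˢ Metric.ball (S.δ / 2) (S.δ / 8)) :=
      Metric.isOpen_ball.prod Metric.isOpen_ball
    have hδ := S.δ_pos
    refine lt_of_lt_of_le (hO.measure_pos volume ⟨(0, S.δ / 2), ?_, ?_⟩) (measure_mono ?_)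
    · exact Metric.mem_ball_self (by norm_num)
    · exact Metric.mem_ball_self (by positivity)
    · rintro z ⟨h1, h2⟩
      have h3 := h2
      rw [Metric.mem_ball, Real.dist_eq, abs_lt] at h3
      have hz : z ∈ S.G := ⟨by linarith [h3.1], by linarith [h3.2]⟩
      refine ⟨?_, hz⟩
      rw [Function.mem_support, bumpξ.one_of_mem_closedBall (Metric.ball_subset_closedBall h1),
        S.bumpη.one_of_mem_closedBall (Metric.ball_subset_closedBall h2)]
      have := S.mWeight_pos hz
      simpa using this.ne'
  · filter_upwards [ae_restrict_mem S.isOpen_G.measurableSet] with z hz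
    exact mul_nonneg (S.mWeight_pos hz).le (sq_nonneg _)
  · exact hi.congr hae

/-- The translates of the trial function. -/
def trialShift (s : ℝ) : S.H10 := ⟨S.shiftJet s S.trialJet.1, S.shiftJet_mem S.trialJet.2 s⟩

/-- The weight of the form of 𝓜 depends on `η` only. The energy norm of a translate does vary, but
stays bounded. -/
lemma inner_energyOp_trialShift (s : ℝ) :
    inner ℂ (S.toEnergy (S.trialShift s)) (S.energyOp (S.toEnergy (S.trialShift s))) =
      inner ℂ (S.toEnergy S.trialJet) (S.energyOp (S.toEnergy S.trialJet)) := by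
  rw [inner_energyOp_right, inner_energyOp_right]
  congr 1
  exact S.wint_shift _ s _ _

variable {S} in
lemma wint_eq_zero_of_ae {a : ℝ × ℝ → ℝ} {u v : S.L2}
    (h : ∀ᵐ z ∂S.wMeasure, u z = 0 ∨ v z = 0) : S.wint a u v = 0 := by
  rw [wint, ← integral_zero (ℝ × ℝ) ℂ (μ := volume.restrict S.G)]
  refine integral_congr_ae ?_
  filter_upwards [ae_iff.1 h] with z hz
  rcases hz with hz | hz <;> rw [hz] <;> simp

lemma fderiv_trial_eq_zero {z : ℝ × ℝ} (hz : 1 / 4 < |z.1|) : fderiv ℝ S.trial z = 0 := by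
  have : S.trial =ᶠ[𝓝 z] fun _ => 0 := by
    filter_upwards [(isOpen_lt continuous_const (continuous_abs.comp continuous_fst)).mem_nhds hz]
      with y hy
    exact S.trial_eq_zero (le_of_lt hy)
  rw [this.fderiv_eq]
  simp

lemma trialShift_ae (s : ℝ) : ∀ᵐ z ∂S.wMeasure, 1 / 4 < |z.1 + s| →
    (S.trialShift s).1.1 z = 0 ∧ (S.trialShift s).1.2.1 z = 0 ∧ (S.trialShift s).1.2.2 z = 0 := by
  filter_upwards [S.coeFn_shift s S.trialJet.1.1, S.coeFn_shift s S.trialJet.1.2.1,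
    S.coeFn_shift s S.trialJet.1.2.2,
    S.ae_trans s (coeFn_testJet (S := S) S.isTest_trial),
    S.ae_trans s (coeFn_testJet_ξ (S := S) S.isTest_trial),
    S.ae_trans s (coeFn_testJet_η (S := S) S.isTest_trial)] with z h1 h2 h3 h4 h5 h6 hz
  have hz' : 1 / 4 < |(trans s z).1| := hz
  refine ⟨h1.trans (h4.trans (S.trial_eq_zero hz'.le)), h2.trans (h5.trans ?_),
    h3.trans (h6.trans ?_)⟩ <;> rw [S.fderiv_trial_eq_zero hz'] <;> rfl

/-- Each translate vanishes at distance more than 1/4 from its centre, and distinct integers differ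
by at least 1. -/
lemma trialShift_disjoint {i k : ℕ} (h : i ≠ k) : ∀ᵐ z ∂S.wMeasure,
    ((S.trialShift i).1.1 z = 0 ∧ (S.trialShift i).1.2.1 z = 0 ∧ (S.trialShift i).1.2.2 z = 0) ∨
    ((S.trialShift k).1.1 z = 0 ∧ (S.trialShift k).1.2.1 z = 0 ∧
      (S.trialShift k).1.2.2 z = 0) := by
  filter_upwards [S.trialShift_ae i, S.trialShift_ae k] with z hi hk
  by_cases h1 : 1 / 4 < |z.1 + i|
  · exact Or.inl (hi h1)
  · refine Or.inr (hk ?_)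
    by_contra h2
    rw [not_lt, abs_le] at h1 h2
    rcases lt_or_gt_of_ne h with h3 | h3
    · have : (i : ℝ) + 1 ≤ k := by exact_mod_cast h3
      linarith [h1.1, h2.2]
    · have : (k : ℝ) + 1 ≤ i := by exact_mod_cast h3
      linarith [h2.1, h1.2]

lemma pairwise_inner_trialShift : Pairwise fun i k : ℕ =>
    inner ℂ (S.toEnergy (S.trialShift i)) (S.toEnergy (S.trialShift k)) = 0 := by
  intro i k h
  rw [inner_toEnergy, lSesq, wint_eq_zero_of_ae, wint_eq_zero_of_ae, add_zero]
  all_goals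
    filter_upwards [S.trialShift_disjoint h] with z hz
    tauto

lemma pairwise_inner_energyOp_trialShift : Pairwise fun i k : ℕ =>
    inner ℂ (S.toEnergy (S.trialShift i)) (S.energyOp (S.toEnergy (S.trialShift k))) = 0 := by
  intro i k h
  rw [inner_energyOp_right, wint_eq_zero_of_ae, mul_zero]
  filter_upwards [S.trialShift_disjoint h] with z hz
  tauto

/-- The min–max values are bounded away from zero. -/
lemma exists_pos_le_minmax : ∃ c : ℝ, 0 < c ∧ ∀ j, (c : EReal) ≤ minmax S.energyOp j := by
  obtain ⟨C, hC0, hC⟩ := S.exists_norm_shift_le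
  have hm := S.re_inner_energyOp_trialJet_pos
  set m := (inner ℂ (S.toEnergy S.trialJet) (S.energyOp (S.toEnergy S.trialJet))).re with hm'
  set B := ‖(S.toEnergy : S.H10 →L[ℂ] S.Energy)‖ * (C * ‖S.trialJet.1‖) with hB
  have hne : ∀ s : ℝ, S.toEnergy (S.trialShift s) ≠ 0 := fun s h0 => by
    have := S.inner_energyOp_trialShift s
    rw [h0, inner_zero_left] at this
    rw [← this, Complex.zero_re] at hm'
    exact hm.ne' hm'
  have hb : ∀ s, ‖S.toEnergy (S.trialShift s)‖ ≤ B := fun s => by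
    refine ((S.toEnergy : S.H10 →L[ℂ] S.Energy).le_opNorm _).trans ?_
    refine mul_le_mul_of_nonneg_left ?_ (ContinuousLinearMap.opNorm_nonneg _)
    have h1 : ‖S.trialJet.1.1‖ ≤ ‖S.trialJet.1‖ := norm_fst_le _
    have h2 : ‖S.trialJet.1.2‖ ≤ ‖S.trialJet.1‖ := norm_snd_le _
    have h3 : ‖S.trialJet.1.2.1‖ ≤ ‖S.trialJet.1.2‖ := norm_fst_le _
    have h4 : ‖S.trialJet.1.2.2‖ ≤ ‖S.trialJet.1.2‖ := norm_snd_le _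
    have key : ∀ u : S.L2, ‖u‖ ≤ ‖S.trialJet.1‖ → ‖S.shift s u‖ ≤ C * ‖S.trialJet.1‖ :=
      fun u hu => (hC s u).trans (mul_le_mul_of_nonneg_left hu hC0.le)
    exact norm_prod_le_iff.2 ⟨key _ h1, norm_prod_le_iff.2
      ⟨key _ (h3.trans h2), key _ (h4.trans h2)⟩⟩
  have hB0 : 0 < B := (norm_pos_iff.2 (hne 0)).trans_le (hb 0)
  -- `m` is the common value of the form of 𝓜 on the translates and `B` a common bound for their
  -- energy norms.
  refine ⟨m / B ^ 2, by positivity, fun j => ?_⟩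
  refine le_minmax_of_pairwise (x := fun i : Fin j => S.toEnergy (S.trialShift (i : ℕ)))
    (fun i => hne _) (fun i k h => S.pairwise_inner_trialShift (Fin.val_injective.ne h))
    (fun i k h => S.pairwise_inner_energyOp_trialShift (Fin.val_injective.ne h)) fun i => ?_
  rw [inner_energyOp_trialShift, ← hm', div_mul_eq_mul_div, div_le_iff₀ (by positivity)]
  gcongr
  exact hb _

/-! ### The spectra of the pencil -/

lemma isFredholmOp_pencil_iff {ω : ℝ} (hω : ω ≠ 0) : IsFredholmOp (S.pencil ω) ↔
    FiniteDimensional ℂ (LinearMap.ker (((ω : ℂ) • (1 : S.Energy →L[ℂ] S.Energy) - S.energyOp :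
        S.Energy →L[ℂ] S.Energy) : S.Energy →ₗ[ℂ] S.Energy)) ∧
      IsClosed (LinearMap.range (((ω : ℂ) • (1 : S.Energy →L[ℂ] S.Energy) - S.energyOp :
        S.Energy →L[ℂ] S.Energy) : S.Energy →ₗ[ℂ] S.Energy) : Set S.Energy) := by
  have hω' : (ω : ℂ) ≠ 0 := Complex.ofReal_ne_zero.2 hω
  exact ⟨fredholm_of_isFredholmOp hω' S.embed_injective (S.mem_graph_pencil_iff hω'),
    fun h => isFredholmOp_of_graph S.isSelfAdjoint_energyOp (S.mem_graph_pencil_iff hω') h.1 h.2⟩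

lemma mem_specDisc {m ω : ℝ} {j : ℕ} (hm : Tendsto (minmax S.energyOp) atTop (𝓝 (m : EReal)))
    (hm0 : 0 ≤ m) (hj : 1 ≤ j) (hωj : minmax S.energyOp j = ω) (hω : m < ω) : ω ∈ S.specDisc := by
  have hω0 : 0 < ω := hm0.trans_lt hω
  have hω' : (ω : ℂ) ≠ 0 := Complex.ofReal_ne_zero.2 hω0.ne'
  have hF := (S.isFredholmOp_pencil_iff hω0.ne').2
    (S.isSelfAdjoint_energyOp.fredholm_of_limit_minmax_lt hm hω)
  obtain ⟨hker, ε, hε, hu⟩ := S.isSelfAdjoint_energyOp.minmax_eigenvalue hm hj hωj hω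
  have hker' := ker_ne_bot_of_graph S.embed_injective (S.mem_graph_pencil_iff hω') hker
  refine ⟨fun hinv => hker' (LinearMap.ker_eq_bot.2 hinv.1.1), fun h => h hF,
    -- The radius is also kept below `ω` so that `ζ ≠ 0`, where the reduction to the energy space is
    -- valid.
    ⟨min ε ω, lt_min hε hω0, fun ζ hζ hne => ?_⟩, hker', hF.1⟩
  by_contra! hlt
  have hζ0 : ζ ≠ 0 := by
    rintro rfl
    have := hlt.trans_le (min_le_right _ _)
    rw [zero_sub, norm_neg, Complex.norm_real, Real.norm_of_nonneg hω0.le] at this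
    exact this.false
  exact hζ (isInvertibleOp_of_graph (S.mem_graph_pencil_iff hζ0)
    (hu ζ hne (hlt.trans_le (min_le_left _ _))))

end

end ShelfStrip

/-! ### The proposition. -/

theorem proposition3p1 (S : ShelfStrip) :
    (∀ j : ℕ, 1 ≤ j → S.mu (j + 1) ≤ S.mu j) ∧
    ∃ m : EReal, Filter.Tendsto S.mu Filter.atTop (nhds m) ∧
      (⊥ < m → sSup ((fun x : ℝ => (x : EReal)) '' S.specEss) = m) ∧
      (m = ⊥ → S.specEss = ∅) ∧
      ∀ j : ℕ, 1 ≤ j → m < S.mu j → ∃ ω ∈ S.specDisc, S.mu j = (ω : EReal) := by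
  have hmu : S.mu = minmax S.energyOp := funext S.mu_eq_minmax
  have hanti := antitone_minmax S.energyOp
  rw [hmu]
  refine ⟨fun j _ => hanti j.le_succ, ?_⟩
  -- The infimum includes j = 0, where the zero space makes the min–max value ⊤; by monotonicity
  -- this does not affect the limit.
  have hm := tendsto_atTop_iInf hanti
  obtain ⟨c, hc, hcj⟩ := S.exists_pos_le_minmax
  have hle : ∀ j, 1 ≤ j → minmax S.energyOp j ≤ (‖S.energyOp‖ : ℝ) :=
    fun j hj => minmax_le_norm S.energyOp hj
  have hcm : (c : EReal) ≤ ⨅ j, minmax S.energyOp j := le_iInf hcj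
  -- The limit is a real number: at most the norm of the operator, taken at j = 1, and at least `c`.
  obtain ⟨m, hm'⟩ : ∃ m : ℝ, ⨅ j, minmax S.energyOp j = (m : EReal) :=
    ⟨_, (EReal.coe_toReal (ne_top_of_le_ne_top (EReal.coe_ne_top _)
      ((iInf_le _ 1).trans (hle 1 le_rfl)))
      (ne_bot_of_le_ne_bot (EReal.coe_ne_bot c) hcm)).symm⟩
  rw [hm'] at hm hcm
  have hm0 : 0 < m := hc.trans_le (EReal.coe_le_coe_iff.1 hcm)
  refine ⟨m, hm, fun _ => ?_, fun h => absurd h (EReal.coe_ne_bot m), fun j hj hlt => ?_⟩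
  · refine le_antisymm (sSup_le ?_) (le_sSup ⟨m, fun hF => ?_, rfl⟩)
    · rintro _ ⟨ω, hω, rfl⟩
      by_contra! hlt
      have hlt' : m < ω := EReal.coe_lt_coe_iff.1 hlt
      exact hω ((S.isFredholmOp_pencil_iff (hm0.trans hlt').ne').2
        (S.isSelfAdjoint_energyOp.fredholm_of_limit_minmax_lt hm hlt'))
    · exact S.isSelfAdjoint_energyOp.not_fredholm_limit_minmax hm
        ((S.isFredholmOp_pencil_iff hm0.ne').1 hF)
  · obtain ⟨ω, hω⟩ : ∃ ω : ℝ, minmax S.energyOp j = (ω : EReal) :=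
      ⟨_, (EReal.coe_toReal (ne_top_of_le_ne_top (EReal.coe_ne_top _) (hle j hj))
        (ne_bot_of_gt hlt)).symm⟩
    rw [hω] at hlt ⊢
    exact ⟨ω, S.mem_specDisc hm hm0.le hj hω (EReal.coe_lt_coe_iff.1 hlt), rfl⟩
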